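/- Let $K$ be a number field and $\varphi\colon X\to \operatorname{Spec} O_K$ an arithmetic surface: $X$ is a two-dimensional integral regular scheme, $\varphi$ is proper and flat, and the generic fibre is a geometrically integral smooth projective curve. Fix representatives $\sigma\in B_\infty$ of the embeddings $K\hookrightarrow\mathbb C$ up to conjugation and let $X_\sigma$ be the base change of $X$ along $\sigma$. For a closed point $x$ of $X$ let $\mathcal O_x$ be the completed local ring. For an integral curve $y\subset X$ through $x$, let $\mathfrak z$ run through the local branches of $y$ at $x$ (the primes of $\mathcal O_x$ over the prime of $y$ in $\mathscr O_{X,x}$), put $\mathcal O_{x,\mathfrak z}=\widehat{(\mathcal O_x)_{\mathfrak z}}$, $\mathcal O_{x,y}=\prod_{\mathfrak z}\mathcal O_{x,\mathfrak z}$, $K_{x,y}=\prod_{\mathfrak z}\operatorname{Frac}\mathcal O_{x,\mathfrak z}$, and let $\mathfrak J_{x,y}$ be the Jacobson radical of $\mathcal O_{x,y}$. These rings are topologised by the iterated completion/localisation procedure that starts with the $\mathfrak m_x$-adic topology of $\mathscr O_{X,x}$ and uses fine module topologies and linear limits. Let $\mathbb A_y^{(0)}\{s\}$ be the group of $(a_x)_x\in\prod_{x\in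 y}\mathcal O_{x,y}$ with $a_x\in\mathcal O_x+\mathfrak J_{x,y}^s$ for all but finitely many closed points $x\in y$, with the restricted product topology; let $\mathbb A_y^{(0)}=\bigcap_s\mathbb A_y^{(0)}\{s\}$ with the inverse limit topology; for a uniformizing parameter $t_y$ of $\widehat{\mathscr O_{X,y}}$ let $\mathbb A_y^{(r)}=t_y^r\mathbb A_y^{(0)}$ $(r\in\mathbb Z)$ with the transferred topology, and $\mathbb A_y=\bigcup_r\mathbb A_y^{(r)}$ with the linear direct limit topology. For a closed point $p\in X_\sigma$ let $\mathcal O_{p,\sigma}=\widehat{\mathscr O_{X_\sigma,p}}$ and $K_{p,\sigma}=\operatorname{Frac}\mathcal O_{p,\sigma}$, with the ind/pro topology of $\mathbb C((t))$ transported through a fixed parametrization $\mathcal O_{p,\sigma}\cong\mathbb C[[t]]$, and let $\mathbf A_{X_\sigma}$ be the restricted product of the $K_{p,\sigma}$ with respect to the $\mathcal O_{p,\sigma}$. Let $y_\infty$ be the set of closed points of the $X_\sigma$ lying in the support of the pull-back of $y$ (it is finite, and empty for vertical $y$), let $\overline y=y\cup y_\infty$, and put $$\mathbb A_{\overline y}=\mathbb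 A_y\oplus\prod_{p\in y_\infty}K_{p,\sigma},\qquad \mathbb A^{(0)}_{\overline y}=\mathbb A_y^{(0)}\oplus\prod_{p\in y_\infty}\mathcal O_{p,\sigma},\qquad \mathbf A_{\widehat X}=\sideset{}{'}\prod_{\overline y}\mathbb A_{\overline y}\oplus\prod_{\sigma\in B_\infty}\mathbf A_{X_\sigma},$$ where the restricted product is taken with respect to the subgroups $\mathbb A^{(0)}_{\overline y}$. Here a restricted product $\prod'_iG_i$ with respect to subgroups $H_i\subseteq G_i$ carries the direct limit group topology of the groups $\prod_{i\in S}G_i\times\prod_{i\notin S}H_i$, $S$ finite. For a topological abelian group $G$ let $\widehat G=\operatorname{Hom}_{\rm cont}(G,\mathbb T)$ with the compact-open topology, and for a subgroup $H$ let $H^\perp\subseteq\widehat G$ be the group of characters trivial on $H$. Then the map $(\chi_{\overline y})_{\overline y}\times(\chi_\sigma)_\sigma\mapsto\prod_{\overline y}\chi_{\overline y}\prod_\sigma\chi_\sigma$ is a well-defined isomorphism of topological groups $$\sideset{}{'}\prod_{\overline y}\widehat{\mathbb A_{\overline y}}\times\prod_{\sigma\in B_\infty}\widehat{\mathbf A_{X_\sigma}}\;\xrightarrow{\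 \sim\ }\;\widehat{\mathbf A_{\widehat X}},$$ where the restricted product is taken with respect to the subgroups $(\mathbb A^{(0)}_{\overline y})^\perp\subseteq\widehat{\mathbb A_{\overline y}}$. Consequently, if every $\mathbf A_{X_\sigma}$ is isomorphic to its dual as a topological group, and there are isomorphisms of topological groups $\theta_{\overline y}\colon\mathbb A_{\overline y}\to\widehat{\mathbb A_{\overline y}}$ with $\theta_{\overline y}(\mathbb A^{(0)}_{\overline y})=(\mathbb A^{(0)}_{\overline y})^\perp$ for all but finitely many $\overline y$, then $\mathbf A_{\widehat X}$ is isomorphic to its dual as a topological group. -/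

import Mathlib

open CategoryTheory CategoryTheory.Limits AlgebraicGeometry Filter Topology
open scoped PowerSeries LaurentSeries

noncomputable section

namespace ArithAdele

/-! ## Topologies on abelian groups -/

section Topologies

/-- The finest group topology on `G` for which all the homomorphisms `f i` are continuous
(direct limits of topological abelian groups carry this topology). -/
@[reducible] def finestGroupTopology {ι : Type*} {H : ι → Type*} [∀ i, AddCommGroup (H i)]
    [∀ i, TopologicalSpace (H i)] {G : Type*} [AddCommGroup G] (f : ∀ i, H i →+ G) :
    TopologicalSpace G :=
  sInf {τ : TopologicalSpace G |
    @IsTopologicalAddGroup G τ _ ∧ ∀ i, @Continuous (H i) G _ τ (f i)}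

/-- The linear topology generated by a family of subgroups: the topology generated by all cosets
of its members. -/
@[reducible] def linearTopologyGeneratedBy {G : Type*} [AddCommGroup G] (F : Set (AddSubgroup G)) :
    TopologicalSpace G :=
  TopologicalSpace.generateFrom {s | ∃ x : G, ∃ U ∈ F, s = {g | g - x ∈ U}}

/-- The final linear topology with respect to the homomorphisms `f i`. -/
@[reducible] def linearFinal {ι : Type*} {H : ι → Type*} [∀ i, AddCommGroup (H i)]
    [∀ i, TopologicalSpace (H i)] {G : Type*} [AddCommGroup G] (f : ∀ i, H i →+ G) :
    TopologicalSpace G :=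
  linearTopologyGeneratedBy {U | ∀ i, IsOpen (U.comap (f i) : Set (H i))}

/-- The initial linear topology with respect to the homomorphisms `f i`. -/
@[reducible] def linearInitial {ι : Type*} {H : ι → Type*} [∀ i, AddCommGroup (H i)]
    [∀ i, TopologicalSpace (H i)] {G : Type*} [AddCommGroup G] (f : ∀ i, G →+ H i) :
    TopologicalSpace G :=
  linearTopologyGeneratedBy
    {W | ∃ i, ∃ V : AddSubgroup (H i), IsOpen (V : Set (H i)) ∧ W = V.comap (f i)}

/-- The fine `A`-module topology on `M`: the final linear topology with respect to all the maps
`a ↦ a • m`. -/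
@[reducible] def fineModuleTopology (A M : Type*) [CommRing A] [TopologicalSpace A] [AddCommGroup M]
    [Module A M] : TopologicalSpace M :=
  linearFinal fun m : M => (LinearMap.toSpanSingleton A M m).toAddMonoidHom

/-- The topology on the completion `lim A / I ^ r` induced by a topology on `A`: each `A / I ^ r`
has the fine `A`-module topology, the completion has the linear inverse limit topology. -/
@[reducible] def completionTopology (A : Type*) [CommRing A] [TopologicalSpace A] (I : Ideal A) :
    TopologicalSpace (AdicCompletion I A) :=
  letI (r : ℕ) : TopologicalSpace (A ⧸ I ^ r) := fineModuleTopology A (A ⧸ I ^ r)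
  linearInitial fun r : ℕ => ((AdicCompletion.evalₐ I r : AdicCompletion I A →+* A ⧸ I ^ r) :
    AdicCompletion I A →+ A ⧸ I ^ r)

/-- The ind/pro topology on `ℂ((t))`: `ℂ[[t]]` has the inverse limit (i.e. product) topology coming
from the usual topology of `ℂ`, and `ℂ((t))` has the finest group topology for which all the maps
`f ↦ f • m` from `ℂ[[t]]` are continuous. -/
@[reducible] def laurentTopology : TopologicalSpace ℂ⸨X⸩ :=
  letI : TopologicalSpace ℂ⟦X⟧ := PowerSeries.WithPiTopology.instTopologicalSpace ℂ
  finestGroupTopology fun m : ℂ⸨X⸩ => (LinearMap.toSpanSingleton ℂ⟦X⟧ ℂ⸨X⸩ m).toAddMonoidHom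

end Topologies

/-! ## Restricted products and character groups -/

section RestrictedProducts

variable {ι : Type*} (G : ι → Type*) [∀ i, AddCommGroup (G i)] (H : ∀ i, AddSubgroup (G i))

/-- Families `a` with `a i ∈ H i` for all but finitely many `i`. -/
def restrictedSubgroup : AddSubgroup (∀ i, G i) where
  carrier := {a | ∀ᶠ i in cofinite, a i ∈ H i}
  zero_mem' := Eventually.of_forall (f := cofinite) fun i => (H i).zero_mem
  add_mem' ha hb := Eventually.mp (f := cofinite) ha
    (Eventually.mono hb fun i hb ha => (H i).add_mem ha hb)
  neg_mem' ha := Eventually.mono (f := cofinite) ha fun i ha => (H i).neg_mem ha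

/-- The restricted product of the groups `G i` with respect to the subgroups `H i`. -/
def RestrictedProd : Type _ := restrictedSubgroup G H

instance : AddCommGroup (RestrictedProd G H) :=
  inferInstanceAs (AddCommGroup (restrictedSubgroup G H))

variable {G H} in
/-- The family underlying an element of the restricted product. -/
def RestrictedProd.coord (a : RestrictedProd G H) : ∀ i, G i :=
  (restrictedSubgroup G H).subtype a

/-- For a finite set `S` of indices, the families `a` with `a i ∈ H i` for all `i ∉ S`. -/
def restrictedLevel (S : Finset ι) : AddSubgroup (∀ i, G i) where
  carrier := {a | ∀ i, i ∉ S → a i ∈ H i}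
  zero_mem' i _ := (H i).zero_mem
  add_mem' ha hb i hi := (H i).add_mem (ha i hi) (hb i hi)
  neg_mem' ha i hi := (H i).neg_mem (ha i hi)

theorem restrictedLevel_le (S : Finset ι) : restrictedLevel G H S ≤ restrictedSubgroup G H :=
  fun _ ha => S.finite_toSet.subset fun i hi => by
    by_contra h
    exact hi (ha i h)

/-- The inclusion `∏_{i ∈ S} G i × ∏_{i ∉ S} H i → ∏' G i`. -/
def restrictedLevelHom (S : Finset ι) : restrictedLevel G H S →+ RestrictedProd G H :=
  AddSubgroup.inclusion (restrictedLevel_le G H S)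

/-- The restricted product is the direct limit, over the finite sets `S`, of the topological groups
`∏_{i ∈ S} G i × ∏_{i ∉ S} H i` with their product topologies. -/
instance [∀ i, TopologicalSpace (G i)] : TopologicalSpace (RestrictedProd G H) :=
  finestGroupTopology (restrictedLevelHom G H)

/-- The same direct limit, formed in the category of linearly topologised groups. -/
@[reducible] def linearRestrictedTopology [∀ i, TopologicalSpace (G i)] :
    TopologicalSpace (RestrictedProd G H) :=
  linearFinal (restrictedLevelHom G H)

end RestrictedProducts

section Dual

variable (G : Type*) [AddCommGroup G] [TopologicalSpace G]

/-- The group of unitary characters of `G`, written additively, with the compact-open topology. -/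
abbrev Dual : Type _ := G →ₜ+ Additive Circle

variable {G}

/-- The characters that are trivial on `H`. -/
def annihilator (H : AddSubgroup G) : AddSubgroup (Dual G) where
  carrier := {χ | ∀ h ∈ H, χ h = 0}
  zero_mem' _ _ := rfl
  add_mem' {χ ψ} hχ hψ h hh := by
    change χ h + ψ h = 0
    rw [hχ h hh, hψ h hh, add_zero]
  neg_mem' {χ} hχ h hh := by
    change - χ h = 0
    rw [hχ h hh, neg_zero]

end Dual

/-! ## The local rings of a flag -/

section Flags

variable (X : Scheme.{0})

/-- The completed local ring at the point `x`. -/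
abbrev CompletedLocalRing (x : X) : Type :=
  AdicCompletion (IsLocalRing.maximalIdeal (X.presheaf.stalk x)) (X.presheaf.stalk x)

/-- The topology of the completed local ring obtained from the `𝔪`-adic topology of the local
ring. -/
@[reducible] def completedLocalRingTopology (x : X) : TopologicalSpace (CompletedLocalRing X x) :=
  letI : TopologicalSpace (X.presheaf.stalk x) :=
    (IsLocalRing.maximalIdeal (X.presheaf.stalk x)).adicTopology
  completionTopology (X.presheaf.stalk x) (IsLocalRing.maximalIdeal (X.presheaf.stalk x))

/-- An integral curve on `X`, given by its generic point. -/
abbrev Curve : Type := {y : X // topologicalKrullDim (closure ({y} : Set X)) = 1}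

/-- The closed points of a scheme. -/
abbrev ClosedPoint : Type := {x : X // IsClosed ({x} : Set X)}

variable {X}

/-- The closed points of `X` that lie on the curve `y`. -/
abbrev Curve.Point (y : Curve X) : Type := {x : X // IsClosed ({x} : Set X) ∧ y.1 ⤳ x}

variable {x y : X} (h : y ⤳ x)

/-- The prime ideal of the local ring at `x` that corresponds to the generization `y` of `x`. -/
def flagPrime : Ideal (X.presheaf.stalk x) :=
  (IsLocalRing.maximalIdeal (X.presheaf.stalk y)).comap (X.presheaf.stalkSpecializes h).hom

instance : (flagPrime h).IsPrime := by
  unfold flagPrime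
  infer_instance

theorem isLocalization_stalkSpecializes :
    @IsLocalization.AtPrime (X.presheaf.stalk x) _ (X.presheaf.stalk y) _
      (X.presheaf.stalkSpecializes h).hom.toAlgebra (flagPrime h) inferInstance := by
  let := (X.presheaf.stalkSpecializes h).hom.toAlgebra
  obtain ⟨_, ⟨U, hU, rfl⟩, hxU, -⟩ :=
    X.isBasis_affineOpens.exists_subset_of_mem_open (Set.mem_univ x) isOpen_univ
  have hyU : y ∈ U := h.mem_open U.2 hxU
  let a1 : Algebra Γ(X, U) (X.presheaf.stalk x) := (X.presheaf.germ U x hxU).hom.toAlgebra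
  let a2 : Algebra Γ(X, U) (X.presheaf.stalk y) := (X.presheaf.germ U y hyU).hom.toAlgebra
  have i1 : IsLocalization.AtPrime (X.presheaf.stalk x) (hU.primeIdealOf ⟨x, hxU⟩).asIdeal :=
    hU.isLocalization_stalk ⟨x, hxU⟩
  have i2 : IsLocalization.AtPrime (X.presheaf.stalk y) (hU.primeIdealOf ⟨y, hyU⟩).asIdeal :=
    hU.isLocalization_stalk ⟨y, hyU⟩
  have tow : IsScalarTower Γ(X, U) (X.presheaf.stalk x) (X.presheaf.stalk y) := by
    refine IsScalarTower.of_algebraMap_eq' ?_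
    change (X.presheaf.germ U y hyU).hom = (X.presheaf.stalkSpecializes h).hom.comp
      (X.presheaf.germ U x hxU).hom
    rw [← CommRingCat.hom_comp, TopCat.Presheaf.germ_stalkSpecializes]
  have key : ∀ r : Γ(X, U), r ∈ (hU.primeIdealOf ⟨y, hyU⟩).asIdeal ↔
      algebraMap Γ(X, U) (X.presheaf.stalk y) r ∈ IsLocalRing.maximalIdeal (X.presheaf.stalk y) :=
    fun r => (IsLocalization.AtPrime.to_map_mem_maximal_iff _ _ r).symm
  have hle : (hU.primeIdealOf ⟨x, hxU⟩).asIdeal.primeCompl ≤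
      (hU.primeIdealOf ⟨y, hyU⟩).asIdeal.primeCompl := by
    intro r hr hr'
    apply (key r).1 hr'
    rw [IsScalarTower.algebraMap_apply Γ(X, U) (X.presheaf.stalk x) (X.presheaf.stalk y)]
    exact (IsLocalization.map_units (X.presheaf.stalk x) ⟨r, hr⟩).map _
  have i3 := IsLocalization.isLocalization_of_submonoid_le (X.presheaf.stalk x)
    (X.presheaf.stalk y) _ _ hle
  refine @IsLocalization.isLocalization_of_is_exists_mul_mem _ _ _ _ _ _ _ i3 ?_ ?_
  · rintro _ ⟨r, hr, rfl⟩ hr'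
    refine hr ((key r).2 ?_)
    rw [IsScalarTower.algebraMap_apply Γ(X, U) (X.presheaf.stalk x) (X.presheaf.stalk y)]
    exact hr'
  · rintro ⟨n, hn⟩
    obtain ⟨⟨r, s⟩, e⟩ := IsLocalization.surj (hU.primeIdealOf ⟨x, hxU⟩).asIdeal.primeCompl n
    refine ⟨algebraMap _ _ s.1, r, ?_, ?_⟩
    · intro hr
      have h1 := (key r).1 hr
      rw [IsScalarTower.algebraMap_apply Γ(X, U) (X.presheaf.stalk x) (X.presheaf.stalk y)] at h1
      have h2 : algebraMap Γ(X, U) (X.presheaf.stalk x) r ∈ flagPrime h := h1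
      rw [← e] at h2
      rcases Ideal.IsPrime.mem_or_mem inferInstance h2 with h3 | h3
      · exact hn h3
      · exact hle s.2 ((key _).2 (by
          rw [IsScalarTower.algebraMap_apply Γ(X, U) (X.presheaf.stalk x) (X.presheaf.stalk y)]
          exact h3))
    · rw [mul_comm]
      exact e.symm

/-- The local branches of `y` at `x`: the primes of the completed local ring at `x` lying over the
prime of `y`. -/
abbrev Branch : Type :=
  {z : PrimeSpectrum (CompletedLocalRing X x) //
    z.asIdeal.comap (algebraMap (X.presheaf.stalk x) (CompletedLocalRing X x)) = flagPrime h}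

variable {h} (z : Branch h)

/-- The completed local ring at `x`, localised at the branch `z`. -/
abbrev BranchLocalization : Type := Localization.AtPrime z.1.asIdeal

/-- The ring `𝒪_{x,z}`: the completion of the localisation at `z` of the completed local ring
at `x`. -/
def BranchRing : Type :=
  AdicCompletion (IsLocalRing.maximalIdeal (BranchLocalization z)) (BranchLocalization z)

instance : CommRing (BranchRing z) := inferInstanceAs (CommRing
  (AdicCompletion (IsLocalRing.maximalIdeal (BranchLocalization z)) (BranchLocalization z)))

/-- Starting from the topology of the completed local ring at `x`, the localisation has the fine
module topology and its completion the topology of `completionTopology`. -/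
instance : TopologicalSpace (BranchRing z) :=
  letI := completedLocalRingTopology X x
  letI : TopologicalSpace (BranchLocalization z) :=
    fineModuleTopology (CompletedLocalRing X x) (BranchLocalization z)
  completionTopology (BranchLocalization z) (IsLocalRing.maximalIdeal (BranchLocalization z))

/-- The two-dimensional local field `K_{x,z}`. -/
abbrev BranchField : Type := FractionRing (BranchRing z)

/-- The canonical map `𝒪_x → 𝒪_{x,z}`. -/
def toBranchRing : CompletedLocalRing X x →+* BranchRing z :=
  (algebraMap (BranchLocalization z)
    (AdicCompletion (IsLocalRing.maximalIdeal (BranchLocalization z)) (BranchLocalization z))).comp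
  (algebraMap (CompletedLocalRing X x) (BranchLocalization z))

/-- The canonical map from the local ring at `x` to the localisation at `z`. -/
def stalkToBranchLocalization : X.presheaf.stalk x →+* BranchLocalization z :=
  (algebraMap (CompletedLocalRing X x) (BranchLocalization z)).comp
    (algebraMap (X.presheaf.stalk x) (CompletedLocalRing X x))

theorem stalkToBranchLocalization_mem (a : X.presheaf.stalk x) :
    stalkToBranchLocalization z a ∈ IsLocalRing.maximalIdeal (BranchLocalization z) ↔
      a ∈ flagPrime h := by
  have hz : a ∈ flagPrime h ↔ a ∈ z.1.asIdeal.comap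
      (algebraMap (X.presheaf.stalk x) (CompletedLocalRing X x)) := by rw [z.2]
  rw [hz, Ideal.mem_comap]
  exact IsLocalization.AtPrime.to_map_mem_maximal_iff (BranchLocalization z) z.1.asIdeal _

/-- The extension of the previous map to the local ring at `y`, which is a localisation of the
local ring at `x`. -/
def genericToBranchLocalization : X.presheaf.stalk y →+* BranchLocalization z :=
  letI := (X.presheaf.stalkSpecializes h).hom.toAlgebra
  haveI : IsLocalization.AtPrime (X.presheaf.stalk y) (flagPrime h) :=
    isLocalization_stalkSpecializes h
  IsLocalization.lift (M := (flagPrime h).primeCompl) (g := stalkToBranchLocalization z)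
    fun a => by
      by_contra hu
      exact a.2 ((stalkToBranchLocalization_mem z a.1).1 hu)

theorem maximalIdeal_le_comap :
    IsLocalRing.maximalIdeal (X.presheaf.stalk y) ≤
      (IsLocalRing.maximalIdeal (BranchLocalization z)).comap (genericToBranchLocalization z) := by
  intro s hs
  let := (X.presheaf.stalkSpecializes h).hom.toAlgebra
  have : IsLocalization.AtPrime (X.presheaf.stalk y) (flagPrime h) :=
    isLocalization_stalkSpecializes h
  obtain ⟨⟨a, b⟩, e⟩ := IsLocalization.surj (flagPrime h).primeCompl s
  have hlift : ∀ c, genericToBranchLocalization z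
      (algebraMap (X.presheaf.stalk x) (X.presheaf.stalk y) c) = stalkToBranchLocalization z c :=
    fun c => IsLocalization.lift_eq _ c
  have ha : a ∈ flagPrime h := by
    change algebraMap (X.presheaf.stalk x) (X.presheaf.stalk y) a ∈
      IsLocalRing.maximalIdeal (X.presheaf.stalk y)
    rw [← e]
    exact Ideal.mul_mem_right _ _ hs
  have h1 := (stalkToBranchLocalization_mem z a).2 ha
  rw [← hlift, ← e, map_mul, hlift] at h1
  rcases Ideal.IsPrime.mem_or_mem inferInstance h1 with h2 | h2
  · exact h2
  · exact absurd ((stalkToBranchLocalization_mem z b.1).1 h2) b.2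

/-- The canonical map from the completed local ring at `y` to `𝒪_{x,z}`. -/
def genericToBranchRing : CompletedLocalRing X y →+* BranchRing z :=
  AdicCompletion.liftRingHom (IsLocalRing.maximalIdeal (BranchLocalization z))
    (fun n => (Ideal.quotientMap (I := IsLocalRing.maximalIdeal (X.presheaf.stalk y) ^ n)
        (IsLocalRing.maximalIdeal (BranchLocalization z) ^ n) (genericToBranchLocalization z)
        ((Ideal.pow_right_mono (maximalIdeal_le_comap z) n).trans
          (Ideal.le_comap_pow (genericToBranchLocalization z) n))).comp
      (AdicCompletion.evalₐ (IsLocalRing.maximalIdeal (X.presheaf.stalk y)) n :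
        CompletedLocalRing X y →+* _))
    (by
      intro m n hmn
      ext a
      obtain ⟨b, rfl⟩ := AdicCompletion.mk_surjective
        (IsLocalRing.maximalIdeal (X.presheaf.stalk y)) (X.presheaf.stalk y) a
      simp only [RingHom.comp_apply, RingHom.coe_coe, AdicCompletion.evalₐ_mk,
        Ideal.quotientMap_mk, Ideal.Quotient.factorPow, Ideal.Quotient.factor_mk]
      rw [← Ideal.quotientMap_mk (H := (Ideal.pow_right_mono (maximalIdeal_le_comap z) m).trans
          (Ideal.le_comap_pow (genericToBranchLocalization z) m)),
        AdicCompletion.Ideal.mk_eq_mk _ hmn, Ideal.quotientMap_mk])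

end Flags

/-! ## Adeles along a curve -/

section CurveAdeles

variable {X : Scheme.{0}} {y : Curve X}

/-- The ring `𝒪_{x,y}`, the product of the rings `𝒪_{x,z}` over the branches `z` of `y` at `x`. -/
abbrev FlagRing (x : y.Point) : Type := ∀ z : Branch x.2.2, BranchRing z

/-- The ring `K_{x,y}`, the product of the fields `K_{x,z}`. -/
abbrev FlagField (x : y.Point) : Type := ∀ z : Branch x.2.2, BranchField z

/-- The subgroup `𝒪_x + 𝔍_{x,y} ^ s` of `𝒪_{x,y}`, where `𝔍_{x,y}` is the Jacobson radical. -/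
def flagSubgroup (s : ℕ) (x : y.Point) : AddSubgroup (FlagRing x) :=
  (RingHom.pi fun z : Branch x.2.2 => toBranchRing z).toAddMonoidHom.range ⊔
    ((⊥ : Ideal (FlagRing x)).jacobson ^ s).toAddSubgroup

variable (y)

/-- The group `𝔸_y^{(0)}{s}`: the families in `∏ 𝒪_{x,y}` that lie in `𝒪_x + 𝔍_{x,y} ^ s` for all
but finitely many `x`. -/
def IntegralLevel (s : ℕ) : Type := RestrictedProd (FlagRing (y := y)) (flagSubgroup s)

instance (s : ℕ) : AddCommGroup (IntegralLevel y s) :=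
  inferInstanceAs (AddCommGroup (RestrictedProd (FlagRing (y := y)) (flagSubgroup s)))

instance (s : ℕ) : TopologicalSpace (IntegralLevel y s) :=
  linearRestrictedTopology (FlagRing (y := y)) (flagSubgroup s)

/-- The group `𝔸_y^{(0)}`, the intersection of the groups `𝔸_y^{(0)}{s}`. -/
def integralSubgroup : AddSubgroup (∀ x : y.Point, FlagRing x) :=
  ⨅ s : ℕ, restrictedSubgroup (FlagRing (y := y)) (flagSubgroup s)

/-- The group `𝔸_y^{(0)}` as a type. -/
def IntegralAdele : Type := integralSubgroup y

instance : AddCommGroup (IntegralAdele y) := inferInstanceAs (AddCommGroup (integralSubgroup y))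

/-- The inclusion `𝔸_y^{(0)} → ∏ 𝒪_{x,y}`. -/
def IntegralAdele.coord : IntegralAdele y →+ ∀ x : y.Point, FlagRing x :=
  (integralSubgroup y).subtype

/-- The inclusion `𝔸_y^{(0)} → 𝔸_y^{(0)}{s}`. -/
def IntegralAdele.toLevel (s : ℕ) : IntegralAdele y →+ IntegralLevel y s :=
  AddSubgroup.inclusion (iInf_le (fun s : ℕ => restrictedSubgroup (FlagRing (y := y))
    (flagSubgroup s)) s)

/-- `𝔸_y^{(0)}` has the linear inverse limit topology. -/
instance : TopologicalSpace (IntegralAdele y) := linearInitial (IntegralAdele.toLevel y)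

variable {y}

/-- The power `t ^ r` in `K_{x,z}` of a uniformizing parameter `t` of the completed local ring
at `y`. (The image of `t` in the field `K_{x,z}` is nonzero, so `Ring.inverse` is its inverse.) -/
def uniformizerPow (t : CompletedLocalRing X y.1) (r : ℤ) {x : y.Point} (z : Branch x.2.2) :
    BranchField z :=
  if 0 ≤ r then algebraMap (BranchRing z) (BranchField z) (genericToBranchRing z t) ^ r.toNat
  else Ring.inverse (algebraMap (BranchRing z) (BranchField z) (genericToBranchRing z t)) ^
    (-r).toNat

/-- The map `b ↦ t ^ r * b` from `𝔸_y^{(0)}` to `∏ K_{x,y}`. -/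
def twist (t : CompletedLocalRing X y.1) (r : ℤ) :
    IntegralAdele y →+ ∀ x : y.Point, FlagField x where
  toFun b x z := uniformizerPow t r z *
    algebraMap (BranchRing z) (BranchField z) (IntegralAdele.coord y b x z)
  map_zero' := by
    funext x z
    rw [map_zero]
    simp
  map_add' a b := by
    funext x z
    rw [map_add]
    simp [mul_add]

/-- The group `𝔸_y^{(r)} = t ^ r 𝔸_y^{(0)}`. -/
def adeleFiltration (t : CompletedLocalRing X y.1) (r : ℤ) :
    AddSubgroup (∀ x : y.Point, FlagField x) :=
  (twist t r).range

/-- The additive group of adeles `𝔸_y` along the curve `y`, the union of the increasing chain of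
subgroups `𝔸_y^{(r)}`. -/
def CurveAdele (t : CompletedLocalRing X y.1) : Type :=
  (⨆ r : ℤ, adeleFiltration t r : AddSubgroup (∀ x : y.Point, FlagField x))

instance (t : CompletedLocalRing X y.1) : AddCommGroup (CurveAdele t) :=
  inferInstanceAs (AddCommGroup
    (⨆ r : ℤ, adeleFiltration t r : AddSubgroup (∀ x : y.Point, FlagField x)))

/-- The map `b ↦ t ^ r * b` from `𝔸_y^{(0)}` to `𝔸_y`, with image `𝔸_y^{(r)}`. -/
def CurveAdele.twist (t : CompletedLocalRing X y.1) (r : ℤ) : IntegralAdele y →+ CurveAdele t :=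
  (AddSubgroup.inclusion (le_iSup (adeleFiltration t) r)).comp (ArithAdele.twist t r).rangeRestrict

/-- Each `𝔸_y^{(r)}` carries the topology of `𝔸_y^{(0)}`, transferred by multiplication with
`t ^ r`, and `𝔸_y` is the linear direct limit of the `𝔸_y^{(r)}`. -/
instance (t : CompletedLocalRing X y.1) : TopologicalSpace (CurveAdele t) :=
  linearFinal (CurveAdele.twist t)

end CurveAdeles

/-! ## The arithmetic surface and its completed adeles -/

section ArithmeticSurface

variable {K : Type} [Field K] [NumberField K] {X : Scheme.{0}}

/-- `X` is an arithmetic surface over the ring of integers of `K`. -/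
structure IsArithmeticSurface (φ : X ⟶ Spec (.of (NumberField.RingOfIntegers K))) : Prop where
  dim_eq_two : topologicalKrullDim X = 2
  isIntegral : IsIntegral X
  isRegular : ∀ x : X, IsRegularLocalRing (X.presheaf.stalk x)
  isProper : IsProper φ
  flat : Flat φ
  smooth_genericFibre : SmoothOfRelativeDimension 1 (pullback.snd φ
    (Spec.map (CommRingCat.ofHom (algebraMap (NumberField.RingOfIntegers K) K))))
  geometricallyIntegral_genericFibre : GeometricallyIntegral (pullback.snd φ
    (Spec.map (CommRingCat.ofHom (algebraMap (NumberField.RingOfIntegers K) K))))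

/-- The fibre at infinity `X_σ`, the base change of `X` along `σ : K → ℂ`. -/
abbrev archFibre (φ : X ⟶ Spec (.of (NumberField.RingOfIntegers K))) (σ : K →+* ℂ) : Scheme.{0} :=
  pullback φ (Spec.map (CommRingCat.ofHom (σ.comp (algebraMap (NumberField.RingOfIntegers K) K))))

/-- The projection `X_σ → X`. -/
abbrev archProj (φ : X ⟶ Spec (.of (NumberField.RingOfIntegers K))) (σ : K →+* ℂ) :
    archFibre φ σ ⟶ X :=
  pullback.fst φ _

/-- The auxiliary choices that are fixed once and for all: representatives of the embeddings
`K → ℂ` up to conjugation, a uniformizing parameter of the completed local ring of every curve,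
and a parametrization `𝒪_{p,σ} ≃ ℂ[[t]]` (hence `K_{p,σ} ≃ ℂ((t))`) at every closed point `p` of
every fibre at infinity. -/
structure Choices (φ : X ⟶ Spec (.of (NumberField.RingOfIntegers K))) where
  embedding : NumberField.InfinitePlace K → K →+* ℂ
  mk_embedding : ∀ σ, NumberField.InfinitePlace.mk (embedding σ) = σ
  uniformizer : ∀ y : Curve X, CompletedLocalRing X y.1
  span_uniformizer : ∀ y : Curve X, Ideal.span {uniformizer y} =
    (IsLocalRing.maximalIdeal (X.presheaf.stalk y.1)).map
      (algebraMap (X.presheaf.stalk y.1) (CompletedLocalRing X y.1))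
  parametrization : ∀ σ (p : ClosedPoint (archFibre φ (embedding σ))),
    CompletedLocalRing (archFibre φ (embedding σ)) p.1 ≃+* ℂ⟦X⟧

variable {φ : X ⟶ Spec (.of (NumberField.RingOfIntegers K))} (c : Choices φ)

/-- The closed points of the fibre at infinity `X_σ`. -/
abbrev FibrePoint (σ : NumberField.InfinitePlace K) : Type :=
  ClosedPoint (archFibre φ (c.embedding σ))

variable {c} in
/-- The field `K_{p,σ}`, the fraction field of the completed local ring `𝒪_{p,σ}`. -/
def ArchField {σ : NumberField.InfinitePlace K} (p : FibrePoint c σ) : Type :=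
  FractionRing (CompletedLocalRing (archFibre φ (c.embedding σ)) p.1)

instance {σ : NumberField.InfinitePlace K} (p : FibrePoint c σ) : CommRing (ArchField p) :=
  inferInstanceAs (CommRing (FractionRing (CompletedLocalRing (archFibre φ (c.embedding σ)) p.1)))

variable {c} in
/-- The isomorphism `K_{p,σ} ≃ ℂ((t))` induced by the parametrization. -/
def laurentEquiv {σ : NumberField.InfinitePlace K} (p : FibrePoint c σ) : ArchField p ≃+* ℂ⸨X⸩ :=
  IsFractionRing.ringEquivOfRingEquiv
    (K := FractionRing (CompletedLocalRing (archFibre φ (c.embedding σ)) p.1))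
    (c.parametrization σ p)

/-- The ind/pro topology on `K_{p,σ}`, carried over from `ℂ((t))`. -/
instance {σ : NumberField.InfinitePlace K} (p : FibrePoint c σ) : TopologicalSpace (ArchField p) :=
  laurentTopology.induced (laurentEquiv p)

variable {c} in
/-- The subgroup `𝒪_{p,σ}` of `K_{p,σ}`. -/
def archIntegers {σ : NumberField.InfinitePlace K} (p : FibrePoint c σ) :
    AddSubgroup (ArchField p) :=
  (algebraMap (CompletedLocalRing (archFibre φ (c.embedding σ)) p.1)
    (FractionRing (CompletedLocalRing (archFibre φ (c.embedding σ)) p.1))).toAddMonoidHom.range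

/-- The points at infinity of the completed curve of `y`: the closed points of the fibres at
infinity in the support of the pull-back of `y`. (There are none if `y` is vertical.) -/
abbrev PointAtInfinity (y : Curve X) : Type :=
  {p : Σ σ : NumberField.InfinitePlace K, FibrePoint c σ //
    y.1 ⤳ archProj φ (c.embedding p.1) p.2.1}

/-- The adeles of the completed curve of `y`: the adeles along `y` times the fields at the points
at infinity, with the product topology. -/
abbrev CompletedCurveAdele (y : Curve X) : Type :=
  CurveAdele (c.uniformizer y) × ∀ p : PointAtInfinity c y, ArchField p.1.2

/-- The subgroup `𝔸^{(0)}` of the adeles of the completed curve of `y`. -/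
def completedIntegral (y : Curve X) : AddSubgroup (CompletedCurveAdele c y) :=
  (CurveAdele.twist (c.uniformizer y) 0).range.prod
    (AddSubgroup.pi Set.univ fun p : PointAtInfinity c y => archIntegers p.1.2)

/-- The adeles of the Riemann surface `X_σ`. -/
abbrev FibreAdele (σ : NumberField.InfinitePlace K) : Type :=
  RestrictedProd (fun p : FibrePoint c σ => ArchField p) archIntegers

/-- The completed adeles of the completed surface: the restricted product of the adeles of all
completed curves, times the adeles of all fibres at infinity. -/
abbrev CompletedAdele : Type :=
  RestrictedProd (CompletedCurveAdele c) (completedIntegral c) ×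
    ∀ σ : NumberField.InfinitePlace K, FibreAdele c σ

end ArithmeticSurface

end ArithAdele

end

open ArithAdele

noncomputable section

namespace ArithAdele

/-! ## Characters -/

section CircleNorm

/-! Write `G i` for the adele groups of the completed curves and `H i` for their integral subgroups.
Algebraically, the dual of the restricted product is the restricted product of the duals because the
circle has no small subgroups. A character maps a neighbourhood of zero in `∏ H i` into a small arc,
this neighbourhood contains the subgroup of all families vanishing on some finite set of indices,
and so the character kills that subgroup (`exists_finset_character_eq_zero`).

For the topologies, the countability of the set of curves is used twice. Continuity of the map from
the product of duals: characters in the annihilators see only finitely many coordinates of a compact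
set (`finite_of_isCompact`), since every weighted sum of chordal distances is a continuous seminorm
on the direct limit and hence bounded on compacta. Continuity of the inverse
(`dualProdHom_nhds_zero`): a character that is small on a suitable product of compact sets is split
into a family of annihilating characters plus a finite sum of single coordinates, the `i`-th of
which lies in a prescribed member of a chain of neighbourhoods with `W (n + 1) + W (n + 1) ⊆ W n`.
The splitting exists as soon as restriction of characters from `G i` to `H i` is open onto its
image, which is `DualRestrictionOpen`. This is the only property of the pairs that has to be proved.

At infinity, the power series are a continuous retract of the Laurent series. Along a curve,
`dualRestrictionOpen_of_complete` applies: the topology is linear, quotients by open subgroups are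
torsion, and `H` is complete. Let `D` be the closed subgroup generated by a compact set. All
ultrafilters on `D` are Cauchy, so `D ∩ H` is compact, a character that is small there vanishes
there, it even vanishes on `D ∩ (H + U)` for some open subgroup `U`, and by divisibility of the
circle its restriction to `D` extends to a character of `G` that kills `H + U`.

The hypotheses reduce to the local rings of flags (`FlagConditions`). Quotients are torsion because
residue characteristics at closed points are positive. Since no prime lies strictly between a branch
`z` and the maximal ideal `𝔪` of the completed local ring `O`, the sets `𝔪 ^ j · 1` are a basis of
neighbourhoods of zero in each quotient of the localisation at `z` by a power of its maximal ideal.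
Hence completeness of `O` passes to the branch rings, and Artin–Rees makes multiplication by a
uniformizer an embedding; this in turn makes `𝔸_y^{(0)}` a topological subgroup of `𝔸_y`.

The conditions for almost all points `x` need `𝔪_x = (t₀, π)` with `t₀` a generator of the prime of
`y`, that is, regularity of `y` at `x`. This is generic regularity of one-dimensional domains of
finite type over `ℤ`, proved by comparison with a Dedekind domain having the same fraction field. -/

/-- The chordal distance of an element of the circle from the identity. -/
def chord (θ : Additive Circle) : ℝ := ‖((Additive.toMul θ : Circle) : ℂ) - 1‖

theorem chord_nonneg (θ : Additive Circle) : 0 ≤ chord θ := norm_nonneg _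

theorem chord_zero : chord 0 = 0 := by simp [chord]

theorem chord_eq_zero {θ : Additive Circle} : chord θ = 0 ↔ θ = 0 := by
  rw [chord, norm_eq_zero, sub_eq_zero]
  exact ⟨fun h => Additive.toMul.injective (Circle.ext h), fun h => by simp [h]⟩

theorem chord_add_le (θ η : Additive Circle) : chord (θ + η) ≤ chord θ + chord η := by
  have h : ((Additive.toMul (θ + η) : Circle) : ℂ) - 1 =
      ((Additive.toMul θ : Circle) : ℂ) * (((Additive.toMul η : Circle) : ℂ) - 1) +
        (((Additive.toMul θ : Circle) : ℂ) - 1) := by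
    simp only [toMul_add, Circle.coe_mul]
    ring
  rw [chord, h]
  refine (norm_add_le _ _).trans ?_
  rw [norm_mul, Circle.norm_coe, one_mul, add_comm]
  rfl

theorem chord_neg (θ : Additive Circle) : chord (-θ) = chord θ := by
  have h : ((Additive.toMul (-θ) : Circle) : ℂ) - 1 =
      - ((((Additive.toMul θ : Circle) : ℂ) - 1) * ((Additive.toMul (-θ) : Circle) : ℂ)) := by
    simp only [toMul_neg, sub_mul, ← Circle.coe_mul]
    simp
  rw [chord, h, norm_neg, norm_mul, Circle.norm_coe, mul_one]
  rfl

theorem continuous_chord : Continuous chord :=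
  continuous_norm.comp
    ((continuous_subtype_val.comp continuous_toMul : Continuous fun θ : Additive Circle =>
      ((Additive.toMul θ : Circle) : ℂ)).sub continuous_const)

/-- The factorisation `z² - 1 = (z - 1)(z + 1)`, where `|z + 1| ≥ 3 / 2` as long as `|z - 1| ≤ 1 /
2`. -/
theorem chord_two_nsmul (θ : Additive Circle) (h : chord θ ≤ 1 / 2) :
    3 / 2 * chord θ ≤ chord (2 • θ) := by
  set z : ℂ := ((Additive.toMul θ : Circle) : ℂ) with hz
  have h1 : ((Additive.toMul (2 • θ) : Circle) : ℂ) - 1 = (z - 1) * (z + 1) := by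
    rw [toMul_nsmul, Circle.coe_pow]
    ring
  have h2 : (3 / 2 : ℝ) ≤ ‖z + 1‖ := by
    have := norm_sub_norm_le (2 : ℂ) (1 - z)
    rw [show (2 : ℂ) - (1 - z) = z + 1 by ring, norm_sub_rev 1 z] at this
    have h3 : ‖z - 1‖ ≤ 1 / 2 := h
    have h4 : ‖(2 : ℂ)‖ = 2 := by simp
    linarith
  have h3 : chord (2 • θ) = ‖z - 1‖ * ‖z + 1‖ := (congrArg norm h1).trans (norm_mul _ _)
  have h4 : chord θ = ‖z - 1‖ := rfl
  rw [h3, h4]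
  nlinarith [norm_nonneg (z - 1)]

/-- The elements of the circle of chordal distance at most `1 / 2` from the identity. -/
def smallArc : Set (Additive Circle) := {θ | chord θ ≤ 1 / 2}

theorem setOf_chord_lt_mem_nhds {ε : ℝ} (hε : 0 < ε) :
    {θ | chord θ < ε} ∈ 𝓝 (0 : Additive Circle) :=
  (isOpen_lt continuous_chord continuous_const).mem_nhds (by simpa [chord_zero] using hε)

theorem smallArc_mem_nhds : smallArc ∈ 𝓝 (0 : Additive Circle) :=
  mem_of_superset (setOf_chord_lt_mem_nhds (by norm_num : (0 : ℝ) < 1 / 2)) fun θ (h : chord θ < 1 / 2) =>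
    (h.le : chord θ ≤ 1 / 2)

theorem exists_chord_lt_subset {V : Set (Additive Circle)} (hV : V ∈ 𝓝 0) :
    ∃ ε > 0, {θ | chord θ < ε} ⊆ V := by
  obtain ⟨W, hW, hWV⟩ : ∃ W ∈ 𝓝 (1 : Circle), Additive.toMul ⁻¹' W ⊆ V :=
    ⟨Additive.ofMul ⁻¹' V, continuous_ofMul.continuousAt.preimage_mem_nhds hV, fun _ h => h⟩
  obtain ⟨ε, hε, h⟩ := Metric.mem_nhds_iff.1 hW
  refine ⟨ε, hε, fun θ hθ => hWV (h ?_)⟩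
  change dist ((Additive.toMul θ : Circle) : ℂ) ((1 : Circle) : ℂ) < ε
  rw [dist_eq_norm, Circle.coe_one]
  exact hθ

theorem chord_le_of_nsmul_mem (n : ℕ) (θ : Additive Circle)
    (h : ∀ k ≤ n, 2 ^ k • θ ∈ smallArc) : (3 / 2) ^ n * chord θ ≤ 1 / 2 := by
  have key : ∀ k ≤ n, (3 / 2) ^ k * chord θ ≤ chord (2 ^ k • θ) := by
    intro k
    induction k with
    | zero => simp
    | succ k ih =>
      intro hk
      have h1 := chord_two_nsmul (2 ^ k • θ) (h k (by omega))
      rw [← mul_nsmul, ← pow_succ] at h1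
      refine le_trans ?_ h1
      rw [pow_succ, mul_comm ((3 / 2 : ℝ) ^ k), mul_assoc]
      exact mul_le_mul_of_nonneg_left (ih (by omega)) (by norm_num)
  exact (key n le_rfl).trans (h n le_rfl)

/-- Doubling expands the small arc by `3 / 2`, so staying in it for many doublings forces closeness
to the identity. This lets the one fixed arc replace every other neighbourhood. -/
theorem exists_nsmul_mem_imp_mem {V : Set (Additive Circle)} (hV : V ∈ 𝓝 0) :
    ∃ n : ℕ, ∀ θ, (∀ k ≤ n, 2 ^ k • θ ∈ smallArc) → θ ∈ V := by
  obtain ⟨ε, hε, hV⟩ := exists_chord_lt_subset hV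
  obtain ⟨n, hn⟩ := pow_unbounded_of_one_lt (1 / ε) (by norm_num : (1 : ℝ) < 3 / 2)
  refine ⟨n, fun θ h => hV ?_⟩
  have h1 := chord_le_of_nsmul_mem n θ h
  have h2 : 1 < (3 / 2) ^ n * ε := by rwa [div_lt_iff₀ hε] at hn
  by_contra h3
  have h4 : ε ≤ chord θ := not_lt.1 h3
  have : (3 / 2 : ℝ) ^ n * ε ≤ (3 / 2) ^ n * chord θ :=
    mul_le_mul_of_nonneg_left h4 (by positivity)
  linarith

/-- The circle has no small subgroups. -/
theorem eq_zero_of_subgroup_subset_smallArc {S : AddSubgroup (Additive Circle)}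
    (hS : (S : Set (Additive Circle)) ⊆ smallArc) {θ : Additive Circle} (hθ : θ ∈ S) : θ = 0 := by
  by_contra h
  have hpos : 0 < chord θ := lt_of_le_of_ne (chord_nonneg θ) fun h' => h (chord_eq_zero.1 h'.symm)
  obtain ⟨n, hn⟩ := exists_nsmul_mem_imp_mem (setOf_chord_lt_mem_nhds hpos)
  have h1 : chord θ < chord θ := hn θ fun k _ => hS (S.nsmul_mem hθ _)
  exact lt_irrefl _ h1

/-- Divisibility makes the circle injective among abelian groups, which is what extends characters
from subgroups. -/
instance : DivisibleBy (Additive Circle) ℤ := by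
  refine divisibleByOfSMulRightSurj (Additive Circle) ℤ ?_
  intro n hn θ
  obtain ⟨t, ht⟩ := Circle.exp_surjective (Additive.toMul θ)
  refine ⟨Additive.ofMul (Circle.exp (t / n)), ?_⟩
  apply Additive.toMul.injective
  change Circle.exp (t / n) ^ n = Additive.toMul θ
  have h0 : (n : ℝ) ≠ 0 := by exact_mod_cast hn
  have h1 := map_zsmul Circle.expHom n (t / n)
  rw [zsmul_eq_mul, mul_div_cancel₀ _ h0] at h1
  rw [← ht]
  exact h1.symm

end CircleNorm

/-! ### Neighbourhoods of zero in the compact-open topology -/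

section DualTopology

variable {G : Type*} [AddCommGroup G] [TopologicalSpace G]

theorem dual_nhds_zero_basis : (𝓝 (0 : Dual G)).HasBasis
    (fun p : Set G × Set (Additive Circle) => IsCompact p.1 ∧ p.2 ∈ 𝓝 0)
    fun p => {χ | ∀ c ∈ p.1, χ c ∈ p.2} := by
  rw [(ContinuousAddMonoidHom.isInducing_toContinuousMap G (Additive Circle)).nhds_eq_comap]
  exact ((𝓝 (0 : Additive Circle)).basis_sets.nhds_continuousMapConst (X := G)).comap _

theorem mem_nhds_zero_dual {C : Set G} (hC : IsCompact C) {V : Set (Additive Circle)}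
    (hV : V ∈ 𝓝 0) : {χ : Dual G | ∀ c ∈ C, χ c ∈ V} ∈ 𝓝 0 :=
  dual_nhds_zero_basis.mem_of_mem (i := (C, V)) ⟨hC, hV⟩

/-- A continuous character is determined by a homomorphism that is continuous at zero. -/
def dualMk [IsTopologicalAddGroup G] (f : G →+ Additive Circle) (h : Tendsto f (𝓝 0) (𝓝 0)) :
    Dual G :=
  ⟨f, continuous_of_continuousAt_zero f (by rwa [ContinuousAt, map_zero])⟩

end DualTopology

/-! ### Universal property of the direct limit topology -/

section FinestTopology

variable {ι : Type*} {H : ι → Type*} [∀ i, AddCommGroup (H i)] [∀ i, TopologicalSpace (H i)]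
  {G : Type*} [AddCommGroup G] (f : ∀ i, H i →+ G)

theorem isTopologicalAddGroup_finest : @IsTopologicalAddGroup G (finestGroupTopology f) _ :=
  topologicalAddGroup_sInf fun _ ht => ht.1

theorem continuous_finest (i : ι) : @Continuous _ _ _ (finestGroupTopology f) (f i) :=
  continuous_sInf_rng.2 fun _ ht => ht.2 i

theorem continuous_of_finest {Q : Type*} [AddCommGroup Q] [TopologicalSpace Q]
    [IsTopologicalAddGroup Q] (g : G →+ Q) (h : ∀ i, Continuous fun x => g (f i x)) :
    @Continuous G Q (finestGroupTopology f) _ g := by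
  refine continuous_iff_le_induced.2 (sInf_le ⟨topologicalAddGroup_induced g, fun i => ?_⟩)
  exact continuous_induced_rng.2 (h i)

/-- The topology defined by the seminorm is itself a group topology for which all `f i` are
continuous, so it is coarser than the finest one. -/
theorem continuous_seminorm_of_finest [∀ i, IsTopologicalAddGroup (H i)] (q : AddGroupSeminorm G)
    (h : ∀ i, Continuous fun x => q (f i x)) : @Continuous G ℝ (finestGroupTopology f) _ q := by
  let N : SeminormedAddCommGroup G := q.toSeminormedAddCommGroup
  have hle : finestGroupTopology f ≤ N.toPseudoMetricSpace.toUniformSpace.toTopologicalSpace := by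
    refine sInf_le ⟨inferInstance, fun i => ?_⟩
    refine continuous_of_continuousAt_zero (f i) ?_
    rw [ContinuousAt, map_zero, tendsto_zero_iff_norm_tendsto_zero]
    have h1 := (h i).tendsto 0
    rwa [map_zero, map_zero] at h1
  have h1 : Continuous (q : G → ℝ) := continuous_norm (E := G)
  exact continuous_le_dom hle h1

end FinestTopology

/-! ## The dual of a restricted product -/

/-- Up to characters that vanish on `H`, a character of `G` that is small on a suitable compact
subset of `H` is small on a given compact subset of `G`; in other words, the restriction of
characters from `G` to `H` is open onto its image. -/
def DualRestrictionOpen {G : Type*} [AddCommGroup G] [TopologicalSpace G] (H : AddSubgroup G) :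
    Prop :=
  ∀ C : Set G, IsCompact C → ∀ V ∈ 𝓝 (0 : Additive Circle), ∃ C' : Set G, IsCompact C' ∧
    C' ⊆ H ∧ ∃ V' ∈ 𝓝 (0 : Additive Circle), ∀ χ : Dual G, (∀ c ∈ C', χ c ∈ V') →
      ∃ ψ ∈ annihilator H, ∀ c ∈ C, (χ - ψ) c ∈ V

/-- Adding the multiples `2 ^ k • C` to the compact set trades the neighbourhood `V` for the fixed
arc. A single arc is needed because one condition must later serve infinitely many factors at once;
`0 ∈ C'` lets elements of a single factor belong to the product of such sets. -/
theorem exists_compact_smallArc {G : Type*} [AddCommGroup G] [TopologicalSpace G]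
    [IsTopologicalAddGroup G] (H : AddSubgroup G) {C : Set G} (hC : IsCompact C) (hCH : C ⊆ H)
    {V : Set (Additive Circle)} (hV : V ∈ 𝓝 0) :
    ∃ C' : Set G, IsCompact C' ∧ C' ⊆ H ∧ 0 ∈ C' ∧
      ∀ χ : Dual G, (∀ c ∈ C', χ c ∈ smallArc) → ∀ c ∈ C, χ c ∈ V := by
  obtain ⟨n, hn⟩ := exists_nsmul_mem_imp_mem hV
  refine ⟨{0} ∪ ⋃ k ∈ Finset.range (n + 1), (fun c => 2 ^ k • c) '' C, ?_, ?_, ?_, ?_⟩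
  · exact isCompact_singleton.union ((Finset.range (n + 1)).isCompact_biUnion fun k _ =>
      hC.image (continuous_const_smul _))
  · rintro x (rfl | hx)
    · exact H.zero_mem
    · simp only [Set.mem_iUnion] at hx
      obtain ⟨k, -, c, hc, rfl⟩ := hx
      exact H.nsmul_mem (hCH hc) _
  · exact Or.inl rfl
  · intro χ h c hc
    refine hn _ fun k hk => ?_
    rw [← map_nsmul]
    refine h _ (Or.inr ?_)
    simp only [Set.mem_iUnion]
    exact ⟨k, by simpa using Nat.lt_succ_of_le hk, c, hc, rfl⟩

section RestrictedProd

variable {ι : Type*} {G : ι → Type*} [∀ i, AddCommGroup (G i)] {H : ∀ i, AddSubgroup (G i)}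

namespace RestrictedProd

variable (G H) in
/-- An element of the restricted product from its family of coordinates. -/
def mk (a : ∀ i, G i) (ha : ∀ᶠ i in cofinite, a i ∈ H i) : RestrictedProd G H :=
  (⟨a, ha⟩ : restrictedSubgroup G H)

@[simp] theorem coord_mk (a : ∀ i, G i) (ha : ∀ᶠ i in cofinite, a i ∈ H i) :
    (mk G H a ha).coord = a := rfl

theorem eventually_coord_mem (a : RestrictedProd G H) : ∀ᶠ i in cofinite, a.coord i ∈ H i :=
  Subtype.property (p := (· ∈ restrictedSubgroup G H)) a

@[ext] theorem ext {a b : RestrictedProd G H} (h : ∀ i, a.coord i = b.coord i) : a = b :=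
  Subtype.ext (p := (· ∈ restrictedSubgroup G H)) (funext h)

/-- The `i`-th coordinate as a homomorphism. -/
def coordHom (i : ι) : RestrictedProd G H →+ G i :=
  (Pi.evalAddMonoidHom G i).comp (restrictedSubgroup G H).subtype

@[simp] theorem coord_add (a b : RestrictedProd G H) (i : ι) :
    (a + b).coord i = a.coord i + b.coord i := rfl

@[simp] theorem coord_sub (a b : RestrictedProd G H) (i : ι) :
    (a - b).coord i = a.coord i - b.coord i := rfl

@[simp] theorem coord_zero (i : ι) : (0 : RestrictedProd G H).coord i = 0 := rfl

theorem coord_sum {κ : Type*} (s : Finset κ) (f : κ → RestrictedProd G H) (i : ι) :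
    (∑ k ∈ s, f k).coord i = ∑ k ∈ s, (f k).coord i := map_sum (coordHom i) f s

@[simp] theorem coord_levelHom (S : Finset ι) (a : restrictedLevel G H S) :
    (restrictedLevelHom G H S a).coord = a.1 := rfl

theorem exists_level (a : RestrictedProd G H) :
    ∃ (S : Finset ι) (b : restrictedLevel G H S), restrictedLevelHom G H S b = a := by
  have h : {i | a.coord i ∉ H i}.Finite := a.eventually_coord_mem
  refine ⟨h.toFinset, ⟨a.coord, fun i hi => ?_⟩, rfl⟩
  by_contra h'
  exact hi (h.mem_toFinset.2 h')

variable [DecidableEq ι]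

variable (G H) in
/-- The inclusion of the `i`-th factor. -/
def single (i : ι) : G i →+ RestrictedProd G H where
  toFun g := mk G H (Pi.single i g) ((Set.finite_singleton i).subset fun j hj => by
    by_contra h
    replace h : j ≠ i := h
    refine hj ?_
    change Pi.single i g j ∈ H j
    rw [Pi.single_eq_of_ne h]
    exact (H j).zero_mem)
  map_zero' := ext fun j => by simp
  map_add' a b := ext fun j => congrFun (Pi.single_add i a b) j

@[simp] theorem coord_single (i : ι) (g : G i) : (single G H i g).coord = Pi.single i g := rfl

theorem eq_sum_single (a : RestrictedProd G H) (S : Finset ι) (h : ∀ i ∉ S, a.coord i = 0) :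
    a = ∑ i ∈ S, single G H i (a.coord i) := by
  ext i
  rw [coord_sum]
  simp only [coord_single]
  by_cases hi : i ∈ S
  · rw [Finset.sum_eq_single i (fun j _ hj => Pi.single_eq_of_ne hj.symm _)
      (fun h' => absurd hi h'), Pi.single_eq_same]
  · rw [h i hi, Finset.sum_eq_zero fun j hj => Pi.single_eq_of_ne (by rintro rfl; exact hi hj) _]

end RestrictedProd

open RestrictedProd

variable [∀ i, TopologicalSpace (G i)]

instance : IsTopologicalAddGroup (RestrictedProd G H) := isTopologicalAddGroup_finest _

theorem continuous_restrictedLevelHom (S : Finset ι) : Continuous (restrictedLevelHom G H S) :=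
  continuous_finest (restrictedLevelHom G H) S

theorem continuous_of_level {Q : Type*} [AddCommGroup Q] [TopologicalSpace Q]
    [IsTopologicalAddGroup Q] (g : RestrictedProd G H →+ Q)
    (h : ∀ S, Continuous fun x => g (restrictedLevelHom G H S x)) : Continuous g :=
  continuous_of_finest _ g h

theorem continuous_coordHom [∀ i, IsTopologicalAddGroup (G i)] (i : ι) :
    Continuous (coordHom i : RestrictedProd G H →+ G i) :=
  continuous_of_level _ fun _ => (continuous_apply i).comp continuous_subtype_val

theorem continuous_single [DecidableEq ι] (i : ι) : Continuous (single G H i) := by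
  have h : ∀ g, Pi.single i g ∈ restrictedLevel G H {i} := fun g j hj => by
    rw [Pi.single_eq_of_ne (by simpa using hj)]
    exact (H j).zero_mem
  exact (continuous_restrictedLevelHom {i}).comp
    ((_root_.continuous_single i).subtype_mk h)

/-! ### The pairing -/

/-- The restricted product of the character groups with respect to the annihilators. -/
abbrev DualProd (H : ∀ i, AddSubgroup (G i)) : Type _ :=
  RestrictedProd (fun i => Dual (G i)) fun i => annihilator (H i)

theorem pairing_finite (χ : DualProd H) (β : RestrictedProd G H) :
    {i | χ.coord i (β.coord i) ≠ 0}.Finite := by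
  have h : ∀ᶠ i in cofinite, χ.coord i (β.coord i) = 0 :=
    (χ.eventually_coord_mem.and β.eventually_coord_mem).mono fun i hi => hi.1 _ hi.2
  exact h

/-- The evaluation pairing, additive in both variables. -/
def pairing : DualProd H →+ RestrictedProd G H →+ Additive Circle where
  toFun χ :=
    { toFun := fun β => ∑ᶠ i, χ.coord i (β.coord i)
      map_zero' := by simp
      map_add' := fun β γ => by
        rw [← finsum_add_distrib (pairing_finite χ β) (pairing_finite χ γ)]
        simp }
  map_zero' := AddMonoidHom.ext fun β => finsum_zero
  map_add' χ ψ := AddMonoidHom.ext fun β =>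
    finsum_add_distrib (pairing_finite χ β) (pairing_finite ψ β)

theorem pairing_eq_sum (χ : DualProd H) (β : RestrictedProd G H) (T : Finset ι)
    (h : ∀ i ∉ T, χ.coord i (β.coord i) = 0) : pairing χ β = ∑ i ∈ T, χ.coord i (β.coord i) :=
  finsum_eq_sum_of_support_subset _ fun i hi => by
    by_contra h'
    exact hi (h i h')

theorem pairing_level (S T : Finset ι) (χ : restrictedLevel (fun i => Dual (G i))
    (fun i => annihilator (H i)) S) (β : restrictedLevel G H T) [DecidableEq ι] :
    pairing (restrictedLevelHom _ _ S χ) (restrictedLevelHom _ _ T β) =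
      ∑ i ∈ S ∪ T, χ.1 i (β.1 i) :=
  pairing_eq_sum _ _ _ fun i hi => by
    simp only [Finset.mem_union, not_or] at hi
    exact χ.2 i hi.1 _ (β.2 i hi.2)

theorem pairing_single [DecidableEq ι] (χ : DualProd H) (i : ι) (g : G i) :
    pairing χ (single G H i g) = χ.coord i g := by
  rw [pairing_eq_sum _ _ {i} fun j hj => ?_]
  · simp
  · rw [coord_single, Pi.single_eq_of_ne (by simpa using hj), map_zero]

/-- If `χ` has level `S`, then on the level `T` only the indices in `S ∪ T` contribute, so the
pairing is a finite sum there. -/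
theorem continuous_pairing (χ : DualProd H) : Continuous (pairing χ) := by
  classical
  obtain ⟨S, χ, rfl⟩ := χ.exists_level
  refine continuous_of_level _ fun T => ?_
  simp only [pairing_level]
  exact continuous_finsetSum _ fun i _ => (map_continuous (χ.1 i)).comp
    ((continuous_apply i).comp continuous_subtype_val)

/-- The homomorphism from the restricted product of the character groups to the character group of
the restricted product. -/
def dualProdHom : DualProd H →+ Dual (RestrictedProd G H) where
  toFun χ := ⟨pairing χ, continuous_pairing χ⟩
  map_zero' := ContinuousAddMonoidHom.ext fun β =>
    congrArg (fun f : RestrictedProd G H →+ Additive Circle => f β) (map_zero pairing)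
  map_add' χ ψ := ContinuousAddMonoidHom.ext fun β =>
    congrArg (fun f : RestrictedProd G H →+ Additive Circle => f β) (map_add pairing χ ψ)

theorem dualProdHom_apply (χ : DualProd H) (β : RestrictedProd G H) :
    dualProdHom χ β = pairing χ β := rfl

theorem dualProdHom_injective : Function.Injective (dualProdHom (H := H)) := by
  classical
  rw [injective_iff_map_eq_zero]
  intro χ h
  refine RestrictedProd.ext fun i => ContinuousAddMonoidHom.ext fun g => ?_
  rw [← pairing_single χ i g, ← dualProdHom_apply, h]
  rfl

/-- A continuous character of the restricted product vanishes on all families in the `H i` that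
are zero at a suitable finite set of indices. -/
theorem exists_finset_character_eq_zero (η : Dual (RestrictedProd G H)) :
    ∃ T : Finset ι, ∀ β : restrictedLevel G H ∅, (∀ i ∈ T, β.1 i = 0) →
      η (restrictedLevelHom G H ∅ β) = 0 := by
  have hc : Continuous fun β => η (restrictedLevelHom G H ∅ β) :=
    (map_continuous η).comp (continuous_restrictedLevelHom ∅)
  have h1 : {β | η (restrictedLevelHom G H ∅ β) ∈ smallArc} ∈ 𝓝 0 :=
    hc.continuousAt.preimage_mem_nhds (by simpa using smallArc_mem_nhds)
  rw [nhds_subtype_eq_comap, mem_comap] at h1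
  obtain ⟨W, hW, hWs⟩ := h1
  change W ∈ 𝓝 (0 : ∀ i, G i) at hW
  rw [nhds_pi, Filter.mem_pi] at hW
  obtain ⟨T, hT, t, ht, htW⟩ := hW
  refine ⟨hT.toFinset, fun β hβ => ?_⟩
  let Z : AddSubgroup (restrictedLevel G H ∅) :=
    { carrier := {β | ∀ i ∈ hT.toFinset, β.1 i = 0}
      zero_mem' := fun i _ => rfl
      add_mem' := fun {a b} ha hb i hi => by
        change a.1 i + b.1 i = 0
        rw [ha i hi, hb i hi, add_zero]
      neg_mem' := fun {a} ha i hi => by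
        change - a.1 i = 0
        rw [ha i hi, neg_zero] }
  -- The families that vanish on `T` form a subgroup inside the neighbourhood, so their image is a
  -- subgroup of the small arc and is trivial.
  refine eq_zero_of_subgroup_subset_smallArc
    (S := Z.map ((η : RestrictedProd G H →+ Additive Circle).comp (restrictedLevelHom G H ∅)))
    ?_ ⟨β, hβ, rfl⟩
  rintro _ ⟨γ, hγ, rfl⟩
  refine hWs (htW fun i hi => ?_)
  have h2 : γ.1 i = 0 := hγ i (hT.mem_toFinset.2 hi)
  rw [h2]
  exact mem_of_mem_nhds (ht i)

/-- The components of a character are its restrictions to the factors. Up to an integral tail on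
which the character vanishes, every element is a finite sum of elements of single factors. -/
theorem dualProdHom_surjective : Function.Surjective (dualProdHom (H := H)) := by
  classical
  intro η
  obtain ⟨T, hT⟩ := exists_finset_character_eq_zero η
  have hmem : ∀ᶠ i in cofinite, η.comp ⟨single G H i, continuous_single i⟩ ∈
      annihilator (H i) := by
    refine T.finite_toSet.subset fun i hi => ?_
    by_contra hiT
    refine hi fun h hh => hT ⟨Pi.single i h, fun j _ => ?_⟩ fun j hj => ?_
    · by_cases hj : j = i
      · subst hj
        rwa [Pi.single_eq_same]
      · rw [Pi.single_eq_of_ne hj]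
        exact (H j).zero_mem
    · exact Pi.single_eq_of_ne (fun e : j = i => hiT (e ▸ hj)) _
  refine ⟨RestrictedProd.mk _ _ _ hmem, ContinuousAddMonoidHom.ext fun b => ?_⟩
  obtain ⟨S, hS⟩ : ∃ S : Finset ι, ∀ i ∉ S, b.coord i ∈ H i := by
    obtain ⟨S, β, rfl⟩ := b.exists_level
    exact ⟨S, β.2⟩
  have hγ : ∀ i, (if i ∈ S ∪ T then 0 else b.coord i) ∈ H i := fun i => by
    split_ifs with h
    · exact (H i).zero_mem
    · exact hS i fun h' => h (Finset.mem_union_left _ h')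
  -- The tail of `b` outside `S ∪ T`: it is integral everywhere and vanishes on `T`, hence `η` kills
  -- it.
  let γ : restrictedLevel G H ∅ := ⟨fun i => if i ∈ S ∪ T then 0 else b.coord i, fun i _ => hγ i⟩
  have hγT : η (restrictedLevelHom G H ∅ γ) = 0 :=
    hT γ fun i hi => if_pos (Finset.mem_union_right _ hi)
  have hγc : ∀ i, (restrictedLevelHom G H ∅ γ).coord i = if i ∈ S ∪ T then 0 else b.coord i :=
    fun i => rfl
  have hdec : b - restrictedLevelHom G H ∅ γ = ∑ i ∈ S ∪ T, single G H i (b.coord i) := by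
    rw [eq_sum_single (b - restrictedLevelHom G H ∅ γ) (S ∪ T) fun i hi => ?_]
    · refine Finset.sum_congr rfl fun i hi => ?_
      rw [coord_sub, hγc, if_pos hi, sub_zero]
    · rw [coord_sub, hγc, if_neg hi, sub_self]
  have h1 : η b = ∑ i ∈ S ∪ T, η (single G H i (b.coord i)) := by
    rw [← map_sum, ← hdec, map_sub, hγT, sub_zero]
  rw [h1, dualProdHom_apply, pairing_eq_sum _ _ (S ∪ T) fun i hi => ?_]
  · rfl
  · refine hT ⟨Pi.single i (b.coord i), fun j _ => ?_⟩
      fun j hj => Pi.single_eq_of_ne (fun e : j = i => hi (Finset.mem_union_right _ (e ▸ hj))) _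
    by_cases hj : j = i
    · subst hj
      rw [Pi.single_eq_same]
      exact hS j fun h => hi (Finset.mem_union_left _ h)
    · rw [Pi.single_eq_of_ne hj]
      exact (H j).zero_mem

end RestrictedProd

open RestrictedProd

/-! ### The topological isomorphism for restricted products -/

section RestrictedDuality

variable {ι : Type*} {G : ι → Type*} [∀ i, AddCommGroup (G i)] {H : ∀ i, AddSubgroup (G i)}
  [∀ i, TopologicalSpace (G i)]

/-- For characters `χ i` that vanish on `H i`, the weighted sum of the chords of the values. -/
def weightedChord (w : ι → ℝ) (hw : ∀ i, 0 ≤ w i) (χ : ∀ i, Dual (G i))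
    (hχ : ∀ i, χ i ∈ annihilator (H i)) : AddGroupSeminorm (RestrictedProd G H) :=
  have hfin (β : RestrictedProd G H) :
      (Function.support fun i => w i * chord (χ i (β.coord i))).Finite := by
    have h : ∀ᶠ i in cofinite, w i * chord (χ i (β.coord i)) = 0 :=
      β.eventually_coord_mem.mono fun i hi => by rw [hχ i _ hi, chord_zero, mul_zero]
    exact h
  { toFun := fun β => ∑ᶠ i, w i * chord (χ i (β.coord i))
    map_zero' := by simp [chord_zero]
    add_le' := fun β γ => by
      rw [← finsum_add_distrib (hfin β) (hfin γ)]
      refine finsum_le_finsum' (hfin _) ?_ fun i => ?_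
      · exact ((hfin β).union (hfin γ)).subset (Function.support_add _ _)
      · rw [← mul_add, coord_add, map_add]
        exact mul_le_mul_of_nonneg_left (chord_add_le _ _) (hw i)
    neg' := fun β => finsum_congr fun i => by
      rw [← chord_neg, ← map_neg]
      congr 3
      exact neg_neg (β.coord i) }

theorem le_weightedChord (w : ι → ℝ) (hw : ∀ i, 0 ≤ w i) (χ : ∀ i, Dual (G i))
    (hχ : ∀ i, χ i ∈ annihilator (H i)) (β : RestrictedProd G H) (i : ι) :
    w i * chord (χ i (β.coord i)) ≤ weightedChord w hw χ hχ β := by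
  have hfin : (Function.support fun i => w i * chord (χ i (β.coord i))).Finite := by
    have h : ∀ᶠ i in cofinite, w i * chord (χ i (β.coord i)) = 0 :=
      β.eventually_coord_mem.mono fun i hi => by rw [hχ i _ hi, chord_zero, mul_zero]
    exact h
  exact single_le_finsum i hfin fun j => mul_nonneg (hw j) (chord_nonneg _)

/-- Such a product of compact sets lies in the single level `T`, where Tychonoff's theorem applies.
-/
theorem isCompact_setOf_coord_mem (T : Finset ι) {C : ∀ i, Set (G i)} (hC : ∀ i, IsCompact (C i))
    (hCH : ∀ i ∉ T, C i ⊆ H i) : IsCompact {β : RestrictedProd G H | ∀ i, β.coord i ∈ C i} := by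
  have h1 : IsCompact {x : restrictedLevel G H T | ∀ i, x.1 i ∈ C i} := by
    rw [IsEmbedding.subtypeVal.isCompact_iff]
    convert isCompact_univ_pi hC
    ext a
    constructor
    · rintro ⟨x, hx, rfl⟩ i -
      exact hx i
    · exact fun ha => ⟨⟨a, fun i hi => hCH i hi (ha i trivial)⟩, fun i => ha i trivial, rfl⟩
  convert h1.image (continuous_restrictedLevelHom T)
  ext β
  constructor
  · exact fun hβ => ⟨⟨β.coord, fun i hi => hCH i hi (hβ i)⟩, hβ, rfl⟩
  · rintro ⟨x, hx, rfl⟩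
    exact hx

variable [∀ i, IsTopologicalAddGroup (G i)]

theorem continuous_weightedChord (w : ι → ℝ) (hw : ∀ i, 0 ≤ w i) (χ : ∀ i, Dual (G i))
    (hχ : ∀ i, χ i ∈ annihilator (H i)) : Continuous (weightedChord w hw χ hχ) := by
  refine continuous_seminorm_of_finest _ _ fun S => ?_
  have h : ∀ x, weightedChord w hw χ hχ (restrictedLevelHom G H S x) =
      ∑ i ∈ S, w i * chord (χ i (x.1 i)) := fun x =>
    finsum_eq_sum_of_support_subset _ fun i hi => by
      by_contra h'
      refine hi ?_
      change w i * chord (χ i (x.1 i)) = 0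
      rw [hχ i _ (x.2 i h'), chord_zero, mul_zero]
  simp only [h]
  exact continuous_finsetSum _ fun i _ => continuous_const.mul (continuous_chord.comp
    ((map_continuous (χ i)).comp ((continuous_apply i).comp continuous_subtype_val)))

/-- Characters in the annihilators of the `H i` vanish on the coordinates of a compact subset of the
restricted product, for all but finitely many indices. -/
theorem finite_of_isCompact [Countable ι] {C : Set (RestrictedProd G H)} (hC : IsCompact C) :
    {i | ∃ β ∈ C, ∃ χ ∈ annihilator (H i), χ (β.coord i) ≠ 0}.Finite := by
  classical
  set I := {i | ∃ β ∈ C, ∃ χ ∈ annihilator (H i), χ (β.coord i) ≠ 0} with hI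
  -- A witness for each index of `I`; elsewhere the pair is a dummy, of which only membership in the
  -- annihilator is used.
  have hex : ∀ i, ∃ p : RestrictedProd G H × Dual (G i), p.2 ∈ annihilator (H i) ∧
      (i ∈ I → p.1 ∈ C ∧ p.2 (p.1.coord i) ≠ 0) := fun i => by
    by_cases hi : i ∈ I
    · obtain ⟨β, hβ, χ, hχ, h⟩ := hi
      exact ⟨(β, χ), hχ, fun _ => ⟨hβ, h⟩⟩
    · exact ⟨(0, 0), (annihilator (H i)).zero_mem, fun h => absurd h hi⟩
  choose p hp hpI using hex
  obtain ⟨k, hk⟩ := exists_injective_nat ι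
  -- The weight is chosen so that the `i`-th term of the seminorm at the `i`-th witness equals `k
  -- i`. Off `I` the denominator is zero and so is the weight.
  let w : ι → ℝ := fun i => k i / chord ((p i).2 ((p i).1.coord i))
  have hw : ∀ i, 0 ≤ w i := fun i => div_nonneg (Nat.cast_nonneg _) (chord_nonneg _)
  obtain ⟨b, hb⟩ := (hC.image (continuous_weightedChord w hw (fun i => (p i).2) hp)).bddAbove
  -- The seminorm is bounded on `C`, so the injective function `k` is bounded on `I`.
  refine Set.Finite.of_finite_image (f := k) ?_ hk.injOn
  refine (Set.finite_le_nat ⌊b⌋₊).subset ?_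
  rintro _ ⟨i, hi, rfl⟩
  refine Nat.le_floor ?_
  have h1 := hb ⟨_, (hpI i hi).1, rfl⟩
  have h2 := le_weightedChord w hw (fun i => (p i).2) hp (p i).1 i
  have h3 : chord ((p i).2 ((p i).1.coord i)) ≠ 0 := fun h => (hpI i hi).2 (chord_eq_zero.1 h)
  have h4 : w i * chord ((p i).2 ((p i).1.coord i)) = k i := div_mul_cancel₀ _ h3
  linarith

/-- On a fixed level the characters outside `S` are annihilating, so only finitely many coordinates
of a compact set matter, and there smallness is imposed one coordinate at a time. -/
theorem continuous_dualProdHom [Countable ι] : Continuous (dualProdHom (H := H)) := by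
  classical
  refine continuous_of_level _ fun S => ?_
  refine continuous_of_continuousAt_zero
    ((dualProdHom (H := H)).comp (restrictedLevelHom _ _ S)) ?_
  rw [ContinuousAt, map_zero]
  refine dual_nhds_zero_basis.tendsto_right_iff.2 ?_
  rintro ⟨C, V⟩ ⟨hC, hV⟩
  obtain ⟨ε, hε, hV⟩ := exists_chord_lt_subset hV
  -- All indices that can contribute to the value of a character of level `S` on `C`.
  set T := S ∪ (finite_of_isCompact hC).toFinset with hT
  have hδ : 0 < ε / (T.card + 1) := by positivity
  have hev : ∀ i ∈ T, ∀ᶠ x : restrictedLevel (fun i => Dual (G i)) (fun i => annihilator (H i)) S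
      in 𝓝 0, ∀ β ∈ C, chord (x.1 i (β.coord i)) < ε / (T.card + 1) := fun i _ => by
    have h1 : Continuous fun x : restrictedLevel (fun i => Dual (G i))
        (fun i => annihilator (H i)) S => x.1 i :=
      (continuous_apply i).comp continuous_subtype_val
    have h2 := mem_nhds_zero_dual (hC.image (continuous_coordHom (H := H) i))
      (setOf_chord_lt_mem_nhds hδ)
    exact (h1.tendsto' 0 0 rfl (mem_of_superset h2 fun χ hχ β hβ => hχ _ ⟨β, hβ, rfl⟩) :)
  filter_upwards [(Filter.eventually_all_finset T).2 hev] with x hx β hβ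
  refine hV ?_
  change chord (pairing (restrictedLevelHom _ _ S x) β) < ε
  rw [pairing_eq_sum _ _ T fun i hi => ?_]
  · have hsum : ∀ U : Finset ι, U ⊆ T →
        chord (∑ i ∈ U, x.1 i (β.coord i)) ≤ U.card * (ε / (T.card + 1)) := by
      intro U
      induction U using Finset.induction_on with
      | empty => simp [chord_zero]
      | insert a U ha ih =>
        intro hU
        rw [Finset.sum_insert ha, Finset.card_insert_of_notMem ha]
        have h1 := ih ((Finset.subset_insert _ _).trans hU)
        have h2 := hx a (hU (Finset.mem_insert_self _ _)) β hβ
        have h3 := chord_add_le (x.1 a (β.coord a)) (∑ i ∈ U, x.1 i (β.coord i))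
        push_cast
        linarith
    refine (hsum T subset_rfl).trans_lt ?_
    rw [mul_div_assoc', div_lt_iff₀ (by positivity)]
    nlinarith
  · by_contra h
    rw [hT, Finset.mem_union, not_or] at hi
    exact hi.2 ((finite_of_isCompact hC).mem_toFinset.2 ⟨β, hβ, x.1 i, x.2 i hi.1, h⟩)

/-- Injectivity of `k` uses every member of the chain at most once, so the sum telescopes down to `W
0` however many terms it has. This is where a countable index set is needed. -/
theorem sum_mem_of_nhds_chain {Q : Type*} [AddCommGroup Q] {W : ℕ → Set Q}
    (h0 : ∀ n, (0 : Q) ∈ W n) (hW : ∀ n, ∀ a ∈ W (n + 1), ∀ b ∈ W (n + 1), a + b ∈ W n)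
    {κ : Type*} (k : κ → ℕ) (hk : Function.Injective k) (f : κ → Q)
    (hf : ∀ i, f i ∈ W (k i + 1)) (T : Finset κ) : ∑ i ∈ T, f i ∈ W 0 := by
  classical
  -- The induction is on the length of the window `[n, n + m)` of values of `k`, with target `W n`.
  have key : ∀ (m n : ℕ) (T : Finset κ), (∀ i ∈ T, n ≤ k i ∧ k i < n + m) →
      ∑ i ∈ T, f i ∈ W n := by
    intro m
    induction m with
    | zero =>
      intro n T hT
      have : T = ∅ := Finset.eq_empty_of_forall_notMem fun i hi => by have := hT i hi; omega
      rw [this, Finset.sum_empty]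
      exact h0 n
    | succ m ih =>
      intro n T hT
      by_cases h : ∃ i ∈ T, k i = n
      · obtain ⟨i, hi, hin⟩ := h
        rw [← Finset.add_sum_erase T f hi]
        refine hW n _ (hin ▸ hf i) _ (ih (n + 1) _ fun j hj => ?_)
        have h1 := hT j (Finset.mem_of_mem_erase hj)
        have h2 : k j ≠ n := fun h => Finset.ne_of_mem_erase hj (hk (h.trans hin.symm))
        omega
      · push Not at h
        rw [← zero_add (∑ i ∈ T, f i)]
        refine hW n _ (h0 _) _ (ih (n + 1) T fun j hj => ?_)
        have h1 := hT j hj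
        have h2 := h j hj
        omega
  refine key (T.sup k + 1) 0 T fun i hi => ⟨Nat.zero_le _, ?_⟩
  have := Finset.le_sup (f := k) hi
  omega

theorem exists_nhds_chain {Q : Type*} [AddCommGroup Q] [TopologicalSpace Q]
    [IsTopologicalAddGroup Q] {U : Set Q} (hU : U ∈ 𝓝 0) : ∃ W : ℕ → Set Q, (∀ n, W n ∈ 𝓝 0) ∧
      (∀ n, ∀ a ∈ W (n + 1), ∀ b ∈ W (n + 1), a + b ∈ W n) ∧ W 0 ⊆ U := by
  let S : ℕ → {s : Set Q // s ∈ 𝓝 (0 : Q)} := Nat.rec ⟨U, hU⟩ fun _ s =>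
    ⟨(exists_nhds_zero_half s.2).choose, (exists_nhds_zero_half s.2).choose_spec.1⟩
  exact ⟨fun n => (S n).1, fun n => (S n).2,
    fun n => (exists_nhds_zero_half (S n).2).choose_spec.2, subset_rfl⟩

/-- Openness of the duality map. Half of `U` absorbs a family of annihilating characters that
vanishes on a finite set `T`; the other half absorbs the differences at single coordinates, with
tolerance `W (k i + 1)` at `i`. -/
theorem dualProdHom_nhds_zero [Countable ι] (hH : ∀ i, DualRestrictionOpen (H i))
    {U : Set (DualProd H)} (hU : U ∈ 𝓝 0) : ∃ C : Set (RestrictedProd G H), IsCompact C ∧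
      ∀ χ : DualProd H, (∀ c ∈ C, dualProdHom χ c ∈ smallArc) → χ ∈ U := by
  classical
  obtain ⟨U', hU', hUU⟩ := exists_nhds_zero_half hU
  obtain ⟨W, hW, hWW, hW0⟩ := exists_nhds_chain hU'
  obtain ⟨k, hk⟩ := exists_injective_nat ι
  -- the part with coordinates in the annihilators
  have h1 : {x | restrictedLevelHom (fun i => Dual (G i)) (fun i => annihilator (H i)) ∅ x ∈ U'} ∈
      𝓝 0 := (continuous_restrictedLevelHom ∅).continuousAt.preimage_mem_nhds (by simpa using hU')
  rw [nhds_subtype_eq_comap, mem_comap] at h1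
  obtain ⟨W', hW', hWs⟩ := h1
  change W' ∈ 𝓝 (0 : ∀ i, Dual (G i)) at hW'
  rw [nhds_pi, Filter.mem_pi] at hW'
  obtain ⟨T, hT, t, ht, htW⟩ := hW'
  -- the single coordinates
  have h2 : ∀ i, ∃ C : Set (G i), IsCompact C ∧ 0 ∈ C ∧ (i ∉ T → C ⊆ H i) ∧
      ∀ χ : Dual (G i), (∀ c ∈ C, χ c ∈ smallArc) → ∃ ψ ∈ annihilator (H i), (i ∈ T → ψ = 0) ∧
        single _ _ i (χ - ψ) ∈ W (k i + 1) := fun i => by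
    have h3 : single (fun i => Dual (G i)) (fun i => annihilator (H i)) i ⁻¹' W (k i + 1) ∈ 𝓝 0 :=
      (continuous_single i).tendsto' 0 0 (map_zero _) (hW _)
    obtain ⟨⟨C, V⟩, ⟨hC, hV⟩, hCV⟩ := dual_nhds_zero_basis.mem_iff.1 h3
    by_cases hi : i ∈ T
    -- At the finitely many indices of `T` the compact set need not lie in `H i`, so the whole
    -- character can be made small and the annihilating part is zero.
    · obtain ⟨C', hC', -, h0, h⟩ := exists_compact_smallArc ⊤ hC (Set.subset_univ _) hV
      exact ⟨C', hC', h0, fun h => absurd hi h, fun χ hχ => ⟨0, (annihilator (H i)).zero_mem,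
        fun _ => rfl, by rw [sub_zero]; exact hCV (h χ hχ)⟩⟩
    · obtain ⟨C', hC', hCH, V', hV', h⟩ := hH i C hC V hV
      obtain ⟨C'', hC'', hCH'', h0, h''⟩ := exists_compact_smallArc (H i) hC' hCH hV'
      refine ⟨C'', hC'', h0, fun _ => hCH'', fun χ hχ => ?_⟩
      obtain ⟨ψ, hψ, hψC⟩ := h χ (h'' χ hχ)
      exact ⟨ψ, hψ, fun h => absurd h hi, hCV hψC⟩
  choose C hC hC0 hCH hCW using h2
  refine ⟨{β | ∀ i, β.coord i ∈ C i}, isCompact_setOf_coord_mem hT.toFinset hC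
    fun i hi => hCH i fun h => hi (hT.mem_toFinset.2 h), fun χ hχ => ?_⟩
  have hχC : ∀ i, ∀ c ∈ C i, χ.coord i c ∈ smallArc := fun i c hc => by
    rw [← pairing_single χ i c]
    refine hχ _ fun j => ?_
    rw [coord_single]
    by_cases hj : j = i
    · subst hj
      rwa [Pi.single_eq_same]
    · rw [Pi.single_eq_of_ne hj]
      exact hC0 j
  obtain ⟨E, hE⟩ : ∃ E : Finset ι, ∀ i ∉ E, χ.coord i ∈ annihilator (H i) := by
    obtain ⟨E, x, rfl⟩ := χ.exists_level
    exact ⟨E, x.2⟩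
  -- Outside the finite set `E ∪ T` the character already annihilates `H i` and is taken whole, so
  -- that only finitely many differences remain.
  have h4 : ∀ i, ∃ ψ ∈ annihilator (H i), (i ∈ T → ψ = 0) ∧ (i ∉ E ∪ hT.toFinset → ψ = χ.coord i) ∧
      single _ _ i (χ.coord i - ψ) ∈ W (k i + 1) := fun i => by
    by_cases hi : i ∈ E ∪ hT.toFinset
    · obtain ⟨ψ, h5, h6, h7⟩ := hCW i (χ.coord i) (hχC i)
      exact ⟨ψ, h5, h6, fun h => absurd hi h, h7⟩
    · rw [Finset.mem_union, not_or, hT.mem_toFinset] at hi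
      refine ⟨χ.coord i, hE i hi.1, fun h => absurd h hi.2, fun _ => rfl, ?_⟩
      rw [sub_self, map_zero]
      exact mem_of_mem_nhds (hW _)
  choose ψ hψ hψT hψE hψW using h4
  let x : restrictedLevel (fun i => Dual (G i)) (fun i => annihilator (H i)) ∅ :=
    ⟨ψ, fun i _ => hψ i⟩
  have hdec : χ = ∑ i ∈ E ∪ hT.toFinset, single _ _ i (χ.coord i - ψ i) +
      restrictedLevelHom _ _ ∅ x := by
    rw [← sub_eq_iff_eq_add]
    exact eq_sum_single _ _ fun i hi => by
      rw [coord_sub, sub_eq_zero]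
      exact (hψE i hi).symm
  rw [hdec]
  refine hUU _ (hW0 (sum_mem_of_nhds_chain (fun n => mem_of_mem_nhds (hW n)) hWW k hk _ hψW _)) _
    (hWs (htW fun i hi => ?_))
  change ψ i ∈ t i
  rw [hψT i hi]
  exact mem_of_mem_nhds (ht i)

/-- The dual of a restricted product is the restricted product of the duals. -/
def restrictedProdDual [Countable ι] (hH : ∀ i, DualRestrictionOpen (H i)) :
    DualProd H ≃ₜ+ Dual (RestrictedProd G H) :=
  { AddEquiv.ofBijective (dualProdHom (H := H)) ⟨dualProdHom_injective, dualProdHom_surjective⟩ with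
    continuous_toFun := continuous_dualProdHom
    continuous_invFun := by
      let e := AddEquiv.ofBijective (dualProdHom (H := H))
        ⟨dualProdHom_injective, dualProdHom_surjective⟩
      refine continuous_of_continuousAt_zero e.symm ?_
      rw [ContinuousAt, map_zero]
      intro U hU
      obtain ⟨C, hC, h⟩ := dualProdHom_nhds_zero hH hU
      refine mem_map.2 (mem_of_superset (mem_nhds_zero_dual hC smallArc_mem_nhds)
        fun η hη => h _ ?_)
      have : dualProdHom (e.symm η) = η := e.apply_symm_apply η
      rw [this]
      exact hη }

end RestrictedDuality

/-! ## Linear topologies -/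

section Linear

variable {G : Type*} [AddCommGroup G]

theorem nhds_linearTopologyGeneratedBy (F : Set (AddSubgroup G)) (x : G) :
    @nhds G (linearTopologyGeneratedBy F) x = ⨅ U ∈ F, 𝓟 {g | g - x ∈ U} := by
  rw [TopologicalSpace.nhds_generateFrom]
  refine le_antisymm (le_iInf₂ fun U hU => ?_) (le_iInf₂ ?_)
  · exact iInf₂_le {g | g - x ∈ U}
      ⟨by change x - x ∈ U; rw [sub_self]; exact U.zero_mem, x, U, hU, rfl⟩
  · rintro s ⟨hx, y, U, hU, rfl⟩
    refine (iInf₂_le U hU).trans (principal_mono.2 fun g hg => ?_)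
    have := U.add_mem hg hx
    rwa [sub_add_sub_cancel] at this

theorem isOpen_linear {F : Set (AddSubgroup G)} {U : AddSubgroup G} (hU : U ∈ F) :
    @IsOpen G (linearTopologyGeneratedBy F) U :=
  TopologicalSpace.isOpen_generateFrom_of_mem ⟨0, U, hU, by simp⟩

theorem isTopologicalAddGroup_linear (F : Set (AddSubgroup G)) :
    @IsTopologicalAddGroup G (linearTopologyGeneratedBy F) _ := by
  let := linearTopologyGeneratedBy F
  have hmem : ∀ U ∈ F, ∀ x : G, {g | g - x ∈ U} ∈ 𝓝 x := fun U hU x => by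
    rw [nhds_linearTopologyGeneratedBy]
    exact mem_iInf_of_mem U (mem_iInf_of_mem hU (mem_principal_self _))
  refine @IsTopologicalAddGroup.mk G _ _ ⟨?_⟩ ⟨?_⟩
  · rw [continuous_iff_continuousAt]
    rintro ⟨x, y⟩
    rw [ContinuousAt, nhds_linearTopologyGeneratedBy F (x + y)]
    simp only [tendsto_iInf, tendsto_principal]
    intro U hU
    filter_upwards [prod_mem_nhds (hmem U hU x) (hmem U hU y)] with p hp
    have := U.add_mem hp.1 hp.2
    rwa [sub_add_sub_comm] at this
  · rw [continuous_iff_continuousAt]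
    intro x
    rw [ContinuousAt, nhds_linearTopologyGeneratedBy F (-x)]
    simp only [tendsto_iInf, tendsto_principal]
    intro U hU
    filter_upwards [hmem U hU x] with p hp
    have := U.neg_mem hp
    rwa [neg_sub'] at this

theorem nonarchimedean_linear (F : Set (AddSubgroup G)) :
    @NonarchimedeanAddGroup G _ (linearTopologyGeneratedBy F) := by
  let := linearTopologyGeneratedBy F
  have := isTopologicalAddGroup_linear F
  refine ⟨fun W hW => ?_⟩
  rw [nhds_linearTopologyGeneratedBy, iInf_subtype', mem_iInf] at hW
  obtain ⟨I, hI, V, hV, rfl⟩ := hW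
  have := hI.fintype
  refine ⟨⟨⨅ i : I, i.1.1, ?_⟩, ?_⟩
  · change IsOpen ((⨅ i : I, i.1.1 : AddSubgroup G) : Set G)
    rw [AddSubgroup.coe_iInf]
    exact isOpen_iInter_of_finite fun i => isOpen_linear i.1.2
  · refine Set.subset_iInter fun i => ?_
    intro g hg
    refine hV i ?_
    change g - 0 ∈ i.1.1
    rw [sub_zero]
    exact (AddSubgroup.mem_iInf.1 hg) i

/-- A homomorphism into a linearly topologised group is continuous if the preimages of the
generating subgroups are open. -/
theorem continuous_linear {H : Type*} [AddCommGroup H] [TopologicalSpace H]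
    [IsTopologicalAddGroup H] {F : Set (AddSubgroup G)} (g : H →+ G)
    (h : ∀ U ∈ F, (U.comap g : Set H) ∈ 𝓝 0) :
    @Continuous H G _ (linearTopologyGeneratedBy F) g := by
  let := linearTopologyGeneratedBy F
  have := isTopologicalAddGroup_linear F
  refine continuous_of_continuousAt_zero g ?_
  rw [ContinuousAt, map_zero, nhds_linearTopologyGeneratedBy]
  simp only [tendsto_iInf, tendsto_principal]
  intro U hU
  filter_upwards [h U hU] with x hx
  rwa [sub_zero]

theorem exists_open_subgroup_subset [TopologicalSpace G] [NonarchimedeanAddGroup G] {W : Set G}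
    (hW : W ∈ 𝓝 0) : ∃ U : AddSubgroup G, IsOpen (U : Set G) ∧ (U : Set G) ⊆ W := by
  obtain ⟨V, hV⟩ := NonarchimedeanAddGroup.is_nonarchimedean W hW
  exact ⟨V.toAddSubgroup, V.isOpen, hV⟩

theorem isOpen_subgroup_of_mem_nhds [TopologicalSpace G] [IsTopologicalAddGroup G]
    {U : AddSubgroup G} (h : (U : Set G) ∈ 𝓝 0) : IsOpen (U : Set G) :=
  AddSubgroup.isOpen_of_mem_nhds U h

section Final

variable {ι : Type*} {H : ι → Type*} [∀ i, AddCommGroup (H i)] [∀ i, TopologicalSpace (H i)]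
  (f : ∀ i, H i →+ G)

/-- The defining subgroups are stable under finite intersections, so they already form a basis at
zero. -/
theorem mem_nhds_zero_linearFinal {W : Set G} : W ∈ @nhds G (linearFinal f) 0 ↔
    ∃ U : AddSubgroup G, (∀ i, IsOpen (U.comap (f i) : Set (H i))) ∧ (U : Set G) ⊆ W := by
  rw [nhds_linearTopologyGeneratedBy, mem_biInf_of_directed]
  · simp only [sub_zero, mem_principal]
    exact Iff.rfl
  · intro U hU V hV
    refine ⟨U ⊓ V, fun i => (hU i).inter (hV i), ?_, ?_⟩
    · exact principal_mono.2 fun g hg => hg.1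
    · exact principal_mono.2 fun g hg => hg.2
  · exact ⟨⊤, fun i => isOpen_univ⟩

theorem continuous_linearFinal [∀ i, IsTopologicalAddGroup (H i)] (i : ι) :
    @Continuous (H i) G _ (linearFinal f) (f i) :=
  continuous_linear (f i) fun U hU => (hU i).mem_nhds (U.comap (f i)).zero_mem

theorem isOpen_linearFinal [∀ i, IsTopologicalAddGroup (H i)] {U : AddSubgroup G} :
    @IsOpen G (linearFinal f) U ↔ ∀ i, IsOpen (U.comap (f i) : Set (H i)) := by
  refine ⟨fun h i => ?_, fun h => isOpen_linear h⟩
  let := linearFinal f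
  exact h.preimage (continuous_linearFinal f i)

theorem continuous_of_linearFinal [∀ i, IsTopologicalAddGroup (H i)] {Q : Type*} [AddCommGroup Q]
    [TopologicalSpace Q] [NonarchimedeanAddGroup Q] (g : G →+ Q)
    (h : ∀ i, Continuous fun x => g (f i x)) : @Continuous G Q (linearFinal f) _ g := by
  let := linearFinal f
  have := isTopologicalAddGroup_linear {U : AddSubgroup G | ∀ i, IsOpen (U.comap (f i) : Set (H i))}
  refine continuous_of_continuousAt_zero g ?_
  rw [ContinuousAt, map_zero]
  intro W hW
  obtain ⟨U, hU, hUW⟩ := exists_open_subgroup_subset hW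
  exact mem_map.2 ((mem_nhds_zero_linearFinal f).2 ⟨U.comap g, fun i => hU.preimage (h i),
    fun x hx => hUW hx⟩)

end Final

section Initial

variable {ι : Type*} {H : ι → Type*} [∀ i, AddCommGroup (H i)] [∀ i, TopologicalSpace (H i)]
  (f : ∀ i, G →+ H i)

theorem nhds_zero_linearInitial [∀ i, NonarchimedeanAddGroup (H i)] :
    @nhds G (linearInitial f) 0 = ⨅ i, comap (f i) (𝓝 0) := by
  rw [nhds_linearTopologyGeneratedBy]
  refine le_antisymm (le_iInf fun i => ?_) (le_iInf₂ ?_)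
  · rintro W ⟨V, hV, hVW⟩
    obtain ⟨U, hU, hUV⟩ := exists_open_subgroup_subset hV
    refine mem_iInf_of_mem (U.comap (f i)) (mem_iInf_of_mem ⟨i, U, hU, rfl⟩ ?_)
    refine mem_principal.2 fun g hg => hVW (hUV ?_)
    have hg : g - 0 ∈ U.comap (f i) := hg
    rwa [sub_zero] at hg
  · rintro _ ⟨i, V, hV, rfl⟩
    refine (iInf_le _ i).trans ?_
    rintro W hW
    refine ⟨V, hV.mem_nhds V.zero_mem, fun g hg => hW ?_⟩
    change g - 0 ∈ V.comap (f i)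
    rwa [sub_zero]

theorem continuous_linearInitial [∀ i, NonarchimedeanAddGroup (H i)] (i : ι) :
    @Continuous G (H i) (linearInitial f) _ (f i) := by
  let := linearInitial f
  have := isTopologicalAddGroup_linear
    {W | ∃ i, ∃ V : AddSubgroup (H i), IsOpen (V : Set (H i)) ∧ W = V.comap (f i)}
  refine continuous_of_continuousAt_zero (f i) ?_
  rw [ContinuousAt, map_zero, Tendsto, nhds_zero_linearInitial f]
  exact map_le_iff_le_comap.2 (iInf_le _ i)

end Initial

instance {ι : Type*} {H : ι → Type*} [∀ i, AddCommGroup (H i)] [∀ i, TopologicalSpace (H i)]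
    [∀ i, NonarchimedeanAddGroup (H i)] : NonarchimedeanAddGroup (∀ i, H i) where
  is_nonarchimedean W hW := by
    change W ∈ 𝓝 (0 : ∀ i, H i) at hW
    rw [nhds_pi, Filter.mem_pi] at hW
    obtain ⟨T, hT, t, ht, htW⟩ := hW
    choose U hU hUt using fun i => exists_open_subgroup_subset (ht i)
    refine ⟨⟨AddSubgroup.pi T U, ?_⟩, fun x hx => htW fun i hi => hUt i (hx i hi)⟩
    exact isOpen_set_pi hT fun i _ => hU i

end Linear

/-! ## Completeness -/

section Complete

variable {G : Type*} [AddCommGroup G] [TopologicalSpace G]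

/-- An ultrafilter on a topological group is Cauchy if it has members that are small of every
order. -/
def UltraCauchy (F : Ultrafilter G) : Prop := ∀ W ∈ 𝓝 (0 : G), ∃ g, ∀ᶠ h in F, h - g ∈ W

variable (G) in
/-- Every Cauchy ultrafilter converges. -/
def UltraComplete : Prop := ∀ F : Ultrafilter G, UltraCauchy F → ∃ g, (F : Filter G) ≤ 𝓝 g

theorem UltraCauchy.map {H : Type*} [AddCommGroup H] [TopologicalSpace H] {F : Ultrafilter G}
    (hF : UltraCauchy F) (f : G →+ H) (hf : Tendsto f (𝓝 0) (𝓝 0)) : UltraCauchy (F.map f) := by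
  intro W hW
  obtain ⟨g, hg⟩ := hF _ (hf hW)
  refine ⟨f g, ?_⟩
  change ∀ᶠ h in F, f h - f g ∈ W
  filter_upwards [hg] with h hh
  rwa [← map_sub]

theorem le_nhds_iff_sub [IsTopologicalAddGroup G] {F : Filter G} {g : G} :
    F ≤ 𝓝 g ↔ Tendsto (fun h => h - g) F (𝓝 0) := by
  rw [← nhds_translation_sub]
  exact tendsto_iff_comap.symm

theorem UltraComplete.pi {ι : Type*} {H : ι → Type*} [∀ i, AddCommGroup (H i)]
    [∀ i, TopologicalSpace (H i)] (h : ∀ i, UltraComplete (H i)) : UltraComplete (∀ i, H i) := by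
  intro F hF
  choose g hg using fun i => h i (F.map fun x => x i)
    (hF.map (Pi.evalAddMonoidHom H i) ((continuous_apply i).tendsto' _ _ rfl))
  refine ⟨g, ?_⟩
  rw [nhds_pi]
  exact le_iInf fun i => map_le_iff_le_comap.1 (hg i)

end Complete

/-! ### Restriction of characters to complete subgroups -/

section CompleteSubgroup

variable {G : Type*} [AddCommGroup G] [TopologicalSpace G] [NonarchimedeanAddGroup G]

/-- Modulo an open subgroup a compact set has finite image, which generates a finite group because
the quotient is torsion. An ultrafilter on a finite set is principal, so it is constant modulo `U`.
-/
theorem ultraCauchy_of_closure_mem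
    (htor : ∀ U : AddSubgroup G, IsOpen (U : Set G) → ∀ g, ∃ n > 0, n • g ∈ U)
    {C : Set G} (hC : IsCompact C) (F : Ultrafilter G)
    (hF : ∀ᶠ h in F, h ∈ (AddSubgroup.closure C).topologicalClosure) : UltraCauchy F := by
  intro W hW
  obtain ⟨U, hU, hUW⟩ := exists_open_subgroup_subset hW
  let π := QuotientAddGroup.mk' U
  -- the image of the compact set in the discrete quotient is finite
  obtain ⟨E, -, hE⟩ := hC.elim_nhds_subcover (fun x => {g | g - x ∈ U}) fun x _ =>
    (hU.preimage (continuous_sub_right x)).mem_nhds (by simp)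
  let S : AddSubgroup (G ⧸ U) := AddSubgroup.closure (π '' C)
  have hfin : (π '' C).Finite := by
    refine (E.finite_toSet.image π).subset ?_
    rintro _ ⟨c, hc, rfl⟩
    obtain ⟨x, hx, hcx⟩ := Set.mem_iUnion₂.1 (hE hc)
    refine ⟨x, hx, (QuotientAddGroup.eq.2 ?_)⟩
    rwa [neg_add_eq_sub]
  have hfg : AddGroup.FG S := by
    rw [AddGroup.fg_iff_addSubgroup_fg]
    exact (AddSubgroup.fg_iff _).2 ⟨_, rfl, hfin⟩
  have hSfin : Finite S := by
    refine AddCommGroup.finite_of_fg_isAddTorsion S fun s => ?_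
    obtain ⟨g, hg⟩ := QuotientAddGroup.mk'_surjective U s.1
    obtain ⟨n, hn, hng⟩ := htor U hU g
    refine isOfFinAddOrder_iff_nsmul_eq_zero.2 ⟨n, hn, Subtype.ext ?_⟩
    change n • s.1 = 0
    rw [← hg, ← map_nsmul]
    exact (QuotientAddGroup.eq_zero_iff _).2 hng
  have hSet : (S : Set (G ⧸ U)).Finite := Set.toFinite _
  have hD : ∀ᶠ h in F, π h ∈ S := by
    filter_upwards [hF] with d hd
    have hd' : d ∈ closure (AddSubgroup.closure C : Set G) := hd
    rw [mem_closure_iff_nhds] at hd'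
    obtain ⟨s, hs1, hs2⟩ := hd' {g | g - d ∈ U}
      ((hU.preimage (continuous_sub_right d)).mem_nhds (by simp))
    have h1 : π d = π s := QuotientAddGroup.eq.2 (by rwa [neg_add_eq_sub])
    rw [h1]
    have h2 : AddSubgroup.closure (π '' C) = (AddSubgroup.closure C).map π :=
      (AddMonoidHom.map_closure π C).symm
    change π s ∈ AddSubgroup.closure (π '' C)
    rw [h2]
    exact ⟨s, hs2, rfl⟩
  obtain ⟨q, -, hq⟩ := Ultrafilter.eq_pure_of_finite_mem hSet (show (S : Set (G ⧸ U)) ∈ F.map π from hD)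
  obtain ⟨g, rfl⟩ := QuotientAddGroup.mk'_surjective U q
  refine ⟨g, ?_⟩
  have h3 : ∀ᶠ h in F, π h = π g := by
    have : {π g} ∈ F.map π := by
      rw [hq]
      exact Ultrafilter.mem_pure.2 rfl
    exact this
  filter_upwards [h3] with h hh
  refine hUW ?_
  have := QuotientAddGroup.eq.1 hh.symm
  rwa [neg_add_eq_sub] at this

/-- In a linearly topologised group whose quotients by open subgroups are torsion, restriction of
characters to a complete subgroup is open onto its image. -/
theorem dualRestrictionOpen_of_complete (H : AddSubgroup G)
    (htor : ∀ U : AddSubgroup G, IsOpen (U : Set G) → ∀ g, ∃ n > 0, n • g ∈ U)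
    (hcompl : ∀ F : Ultrafilter G, (∀ᶠ h in F, h ∈ H) → UltraCauchy F →
      ∃ g ∈ H, (F : Filter G) ≤ 𝓝 g) : DualRestrictionOpen H := by
  intro C hC V hV
  set D := (AddSubgroup.closure C).topologicalClosure with hD
  have hDclosed : IsClosed (D : Set G) := AddSubgroup.isClosed_topologicalClosure _
  have hCD : C ⊆ D := AddSubgroup.subset_closure.trans (AddSubgroup.le_topologicalClosure _)
  have hlim : ∀ {F : Ultrafilter G} {g : G}, (∀ᶠ h in F, h ∈ D) → (F : Filter G) ≤ 𝓝 g → g ∈ D :=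
    fun {F g} h1 h2 => hDclosed.mem_of_tendsto (f := id) h2 h1
  refine ⟨(D ⊓ H : AddSubgroup G), ?_, fun x hx => hx.2, smallArc, smallArc_mem_nhds, ?_⟩
  -- Ultrafilters on `D ∩ H` are Cauchy because of `D`, converge in `H` by completeness, and have
  -- their limit in the closed set `D`.
  · rw [isCompact_iff_ultrafilter_le_nhds]
    intro F hF
    have hF' : ∀ᶠ h in F, h ∈ D ⊓ H := le_principal_iff.1 hF
    have hFD : ∀ᶠ h in F, h ∈ D := hF'.mono fun h hh => hh.1
    obtain ⟨g, hgH, hg⟩ := hcompl F (hF'.mono fun h hh => hh.2)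
      (ultraCauchy_of_closure_mem htor hC F hFD)
    exact ⟨g, ⟨hlim hFD hg, hgH⟩, hg⟩
  · intro χ hχ
    have hχ0 : ∀ x ∈ D ⊓ H, χ x = 0 := fun x hx =>
      eq_zero_of_subgroup_subset_smallArc (S := (D ⊓ H).map (χ : G →+ Additive Circle))
        (by rintro _ ⟨y, hy, rfl⟩; exact hχ y hy) ⟨x, hx, rfl⟩
    obtain ⟨U₀, hU₀, hU₀χ⟩ : ∃ U : AddSubgroup G, IsOpen (U : Set G) ∧ ∀ x ∈ U, χ x = 0 := by
      obtain ⟨U, hU, h⟩ := exists_open_subgroup_subset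
        ((map_continuous χ).tendsto' 0 0 (map_zero χ) smallArc_mem_nhds)
      exact ⟨U, hU, fun x hx => eq_zero_of_subgroup_subset_smallArc
        (S := U.map (χ : G →+ Additive Circle)) (by rintro _ ⟨y, hy, rfl⟩; exact h hy) ⟨x, hx, rfl⟩⟩
    -- Vanishing on `D ∩ H` spreads to `D ∩ (H + U)`. Otherwise there are pairs `(d, h)` with
    -- arbitrarily small difference and `χ d ≠ 0`; a limit of them lies in `D ∩ H`, and near it `χ`
    -- vanishes.
    obtain ⟨U, hU, hUD⟩ : ∃ U : AddSubgroup G, IsOpen (U : Set G) ∧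
        ∀ d ∈ D, d ∈ H ⊔ U → χ d = 0 := by
      by_contra! hcon
      let 𝓕 : Filter (G × G) := comap (fun p => p.1 - p.2) (𝓝 0) ⊓
        𝓟 {p | p.1 ∈ D ∧ p.2 ∈ H ∧ χ p.1 ≠ 0}
      have hne : 𝓕.NeBot := by
        rw [inf_principal_neBot_iff]
        rintro s ⟨W, hW, hWs⟩
        obtain ⟨U, hU, hUW⟩ := exists_open_subgroup_subset hW
        obtain ⟨d, hd, hdU, hdχ⟩ := hcon U hU
        obtain ⟨h, hh, u, hu, rfl⟩ := AddSubgroup.mem_sup.1 hdU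
        exact ⟨(h + u, h), hWs (hUW (by simpa using hu)), hd, hh, hdχ⟩
      let F := Ultrafilter.of 𝓕
      have hF : (F : Filter (G × G)) ≤ 𝓕 := Ultrafilter.of_le 𝓕
      have hF1 : Tendsto (fun p : G × G => p.1 - p.2) F (𝓝 0) :=
        tendsto_iff_comap.2 (hF.trans inf_le_left)
      have hF2 : ∀ᶠ p : G × G in F, p.1 ∈ D ∧ p.2 ∈ H ∧ χ p.1 ≠ 0 :=
        le_principal_iff.1 (hF.trans inf_le_right)
      have hc1 : UltraCauchy (F.map Prod.fst) :=
        ultraCauchy_of_closure_mem htor hC _ (hF2.mono fun p hp => hp.1)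
      -- The second components inherit the Cauchy property because the differences tend to zero;
      -- they lie in `H`, where completeness gives a limit.
      have hc2 : UltraCauchy (F.map Prod.snd) := by
        intro W hW
        obtain ⟨U, hU, hUW⟩ := exists_open_subgroup_subset hW
        obtain ⟨g, hg⟩ := hc1 U (hU.mem_nhds U.zero_mem)
        have hg : ∀ᶠ p : G × G in F, p.1 - g ∈ U := hg
        refine ⟨g, ?_⟩
        change ∀ᶠ p : G × G in F, p.2 - g ∈ W
        filter_upwards [hg, hF1 (hU.mem_nhds U.zero_mem)] with p h1 h2
        have := U.sub_mem h1 h2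
        rw [sub_sub_sub_cancel_left] at this
        exact hUW (by simpa using U.neg_mem (U.neg_mem this))
      obtain ⟨g, hgH, hg⟩ := hcompl (F.map Prod.snd) (hF2.mono fun p hp => hp.2.1) hc2
      have hg : Tendsto (fun p : G × G => p.2) F (𝓝 g) := hg
      have hg1 : Tendsto (fun p : G × G => p.1) F (𝓝 g) := by
        have := hF1.add hg
        simpa using this
      have hgD : g ∈ D := hDclosed.mem_of_tendsto hg1 (hF2.mono fun p hp => hp.1)
      have h3 : ∀ᶠ p : G × G in F, p.1 - g ∈ U₀ :=
        hg1 ((hU₀.preimage (continuous_sub_right g)).mem_nhds (by simp))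
      obtain ⟨p, hp1, hp2⟩ := (hF2.and h3).exists
      refine hp1.2.2 ?_
      have h4 := hU₀χ _ hp2
      rwa [map_sub, hχ0 g ⟨hgD, hgH⟩, sub_zero] at h4
    -- On `D` the character factors through the image in `G ⧸ (H ⊔ U)`, from which it extends by
    -- injectivity of the circle. The extension kills the open subgroup `U`, so it is continuous,
    -- and it agrees with `χ` on `C`.
    let f : D →+ G ⧸ (H ⊔ U) := (QuotientAddGroup.mk' (H ⊔ U)).comp D.subtype
    have hker : f.ker ≤ ((χ : G →+ Additive Circle).comp D.subtype).ker := fun d hd =>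
      hUD d.1 d.2 ((QuotientAddGroup.eq_zero_iff _).1 hd)
    obtain ⟨ψ, hψ⟩ := (Module.Baer.of_divisible (Additive Circle)).extension_property_addMonoidHom
      (QuotientAddGroup.kerLift f) (QuotientAddGroup.kerLift_injective f)
      (QuotientAddGroup.lift f.ker _ hker)
    have hψ0 : ∀ x ∈ H ⊔ U, ψ (QuotientAddGroup.mk' (H ⊔ U) x) = 0 := fun x hx => by
      have h1 : QuotientAddGroup.mk' (H ⊔ U) x = 0 := (QuotientAddGroup.eq_zero_iff x).2 hx
      rw [h1, map_zero]
    refine ⟨dualMk (ψ.comp (QuotientAddGroup.mk' (H ⊔ U))) ?_,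
      fun h hh => hψ0 h (AddSubgroup.mem_sup_left hh), fun c hc => ?_⟩
    · refine tendsto_nhds_of_eventually_eq ?_
      filter_upwards [hU.mem_nhds U.zero_mem] with x hx
      exact hψ0 x (AddSubgroup.mem_sup_right hx)
    · have h1 := DFunLike.congr_fun hψ (QuotientAddGroup.mk (⟨c, hCD hc⟩ : D))
      have h2 : ψ (QuotientAddGroup.mk' (H ⊔ U) c) = χ c := h1
      change χ c - ψ (QuotientAddGroup.mk' (H ⊔ U) c) ∈ V
      rw [h2, sub_self]
      exact mem_of_mem_nhds hV

end CompleteSubgroup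

open RestrictedProd

/-! ## Retracts, products, and isomorphisms -/

section Permanence

variable {G G' : Type*} [AddCommGroup G] [TopologicalSpace G] [AddCommGroup G']
  [TopologicalSpace G']

/-- The correction is `χ - χ ∘ π`: it annihilates `H`, and what is left is `χ ∘ π`, controlled on
`C` by `χ` on the compact set `π '' C`. -/
theorem dualRestrictionOpen_of_retract {H : AddSubgroup G} (π : G →+ G) (hπ : Continuous π)
    (hπH : ∀ g, π g ∈ H) (hπ' : ∀ h ∈ H, π h = h) : DualRestrictionOpen H := by
  intro C hC V hV
  refine ⟨π '' C, hC.image hπ, ?_, V, hV, fun χ hχ => ?_⟩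
  · rintro _ ⟨c, -, rfl⟩
    exact hπH c
  · refine ⟨χ - χ.comp ⟨π, hπ⟩, fun h hh => ?_, fun c hc => ?_⟩
    · change χ h - χ (π h) = 0
      rw [hπ' h hh, sub_self]
    · rw [sub_sub_cancel]
      exact hχ _ ⟨c, hc, rfl⟩

theorem DualRestrictionOpen.prod {H : AddSubgroup G} {H' : AddSubgroup G'}
    (h : DualRestrictionOpen H) (h' : DualRestrictionOpen H') :
    DualRestrictionOpen (H.prod H') := by
  intro C hC V hV
  obtain ⟨W, hW, hWV⟩ := exists_nhds_zero_half hV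
  obtain ⟨C₁, hC₁, hCH₁, V₁, hV₁, h₁⟩ := h (Prod.fst '' C) (hC.image continuous_fst) W hW
  obtain ⟨C₂, hC₂, hCH₂, V₂, hV₂, h₂⟩ := h' (Prod.snd '' C) (hC.image continuous_snd) W hW
  have hl : Continuous fun a : G => (a, (0 : G')) := by fun_prop
  have hr : Continuous fun b : G' => ((0 : G), b) := by fun_prop
  refine ⟨(fun a => (a, 0)) '' C₁ ∪ (fun b => (0, b)) '' C₂, (hC₁.image hl).union (hC₂.image hr),
    ?_, V₁ ∩ V₂, inter_mem hV₁ hV₂, fun χ hχ => ?_⟩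
  · rintro _ (⟨a, ha, rfl⟩ | ⟨b, hb, rfl⟩)
    · exact ⟨hCH₁ ha, H'.zero_mem⟩
    · exact ⟨H.zero_mem, hCH₂ hb⟩
  · obtain ⟨ψ₁, hψ₁, hψC₁⟩ := h₁ (χ.comp ⟨AddMonoidHom.inl G G', hl⟩)
      fun c hc => (hχ (c, 0) (Or.inl ⟨c, hc, rfl⟩)).1
    obtain ⟨ψ₂, hψ₂, hψC₂⟩ := h₂ (χ.comp ⟨AddMonoidHom.inr G G', hr⟩)
      fun c hc => (hχ (0, c) (Or.inr ⟨c, hc, rfl⟩)).2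
    refine ⟨ψ₁.comp (.fst G G') + ψ₂.comp (.snd G G'), ?_, ?_⟩
    · rintro ⟨a, b⟩ ⟨ha, hb⟩
      change ψ₁ a + ψ₂ b = 0
      rw [hψ₁ a ha, hψ₂ b hb, add_zero]
    · rintro ⟨a, b⟩ hab
      have h3 : (χ - (ψ₁.comp (.fst G G') + ψ₂.comp (.snd G G'))) (a, b) =
          (χ (a, 0) - ψ₁ a) + (χ (0, b) - ψ₂ b) := by
        have h4 : (a, b) = ((a, 0) + (0, b) : G × G') := by simp
        change χ (a, b) - (ψ₁ a + ψ₂ b) = _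
        rw [h4, map_add]
        abel
      rw [h3]
      exact hWV _ (hψC₁ a ⟨_, hab, rfl⟩) _ (hψC₂ b ⟨_, hab, rfl⟩)

end Permanence

/-! ### Duals of finite products -/

section DualOfProduct

variable (P : Type*) [AddCommGroup P] [TopologicalSpace P] {κ : Type*} [Fintype κ]
  (F : κ → Type*) [∀ k, AddCommGroup (F k)] [∀ k, TopologicalSpace (F k)]

/-- The projection to a factor, as a continuous homomorphism. -/
def projHom (k : κ) : (P × ∀ k, F k) →ₜ+ F k :=
  ⟨(Pi.evalAddMonoidHom F k).comp (AddMonoidHom.snd P _), (continuous_apply k).comp continuous_snd⟩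

/-- The inclusion of a factor, as a continuous homomorphism. -/
def singleHom [DecidableEq κ] (k : κ) : F k →ₜ+ (P × ∀ k, F k) :=
  ⟨(AddMonoidHom.inr P _).comp (AddMonoidHom.single F k),
    continuous_const.prodMk (_root_.continuous_single k)⟩

/-- Evaluation of characters at a point. -/
def dualEval {G : Type*} [AddCommGroup G] [TopologicalSpace G] (g : G) :
    Dual G →+ Additive Circle where
  toFun χ := χ g
  map_zero' := rfl
  map_add' _ _ := rfl

/-- The character of a finite product given by characters of the factors. -/
def prodDualHom : (Dual P × ∀ k, Dual (F k)) →+ Dual (P × ∀ k, F k) where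
  toFun χ := χ.1.comp (.fst P _) + ∑ k, (χ.2 k).comp (projHom P F k)
  map_zero' := by
    refine ContinuousAddMonoidHom.ext fun x => ?_
    change dualEval x (_ + ∑ k, _) = 0
    rw [map_add, map_sum]
    exact (zero_add _).trans (Finset.sum_eq_zero fun k _ => rfl)
  map_add' χ ψ := by
    refine ContinuousAddMonoidHom.ext fun x => ?_
    change dualEval x (_ + ∑ k, _) = dualEval x ((_ + ∑ k, _) + (_ + ∑ k, _))
    simp only [map_add, map_sum]
    rw [add_add_add_comm, ← Finset.sum_add_distrib]
    rfl

variable {P F} in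
theorem prodDualHom_apply (χ : Dual P × ∀ k, Dual (F k)) (x : P × ∀ k, F k) :
    prodDualHom P F χ x = χ.1 x.1 + ∑ k, χ.2 k (x.2 k) := by
  change dualEval x (_ + ∑ k, _) = _
  rw [map_add, map_sum]
  rfl

/-- The dual of a finite product is the product of the duals. -/
def prodDual : (Dual P × ∀ k, Dual (F k)) ≃ₜ+ Dual (P × ∀ k, F k) := by
  classical
  exact
  { prodDualHom P F with
    invFun := fun η => (η.comp (.inl P _), fun k => η.comp (singleHom P F k))
    left_inv := fun χ => by
      refine Prod.ext (ContinuousAddMonoidHom.ext fun x => ?_)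
        (funext fun k => ContinuousAddMonoidHom.ext fun x => ?_)
      · change prodDualHom P F χ (x, 0) = χ.1 x
        refine (prodDualHom_apply _ _).trans ?_
        change χ.1 x + ∑ k, χ.2 k 0 = χ.1 x
        simp
      · change prodDualHom P F χ (0, Pi.single k x) = χ.2 k x
        rw [prodDualHom_apply, map_zero, zero_add, Finset.sum_eq_single k]
        · change χ.2 k (Pi.single k x k) = χ.2 k x
          rw [Pi.single_eq_same]
        · intro j _ hj
          change χ.2 j (Pi.single k x j) = 0
          rw [Pi.single_eq_of_ne hj, map_zero]
        · exact fun h => absurd (Finset.mem_univ k) h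
    right_inv := fun η => by
      refine ContinuousAddMonoidHom.ext fun x => ?_
      refine (prodDualHom_apply _ x).trans ?_
      change η (x.1, 0) + ∑ k, η (0, Pi.single k (x.2 k)) = η x
      have h : x = (x.1, 0) + ∑ k, (0, Pi.single k (x.2 k)) := by
        refine Prod.ext (by simp [Prod.fst_sum]) ?_
        simp [Prod.snd_sum, Finset.univ_sum_single]
      conv_rhs => rw [h, map_add, map_sum]
    continuous_toFun := by
      have h1 : ∀ k, Continuous fun χ : Dual P × ∀ k, Dual (F k) => (χ.2 k).comp (projHom P F k) :=
        fun k => (ContinuousAddMonoidHom.continuous_comp_left _).comp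
          ((continuous_apply k).comp continuous_snd)
      exact ((ContinuousAddMonoidHom.continuous_comp_left _).comp continuous_fst).add
        (continuous_finsetSum _ fun k _ => h1 k)
    continuous_invFun :=
      (ContinuousAddMonoidHom.continuous_comp_left _).prodMk
        (continuous_pi fun k => ContinuousAddMonoidHom.continuous_comp_left _) }

theorem prodDual_apply (χ : Dual P × ∀ k, Dual (F k)) (x : P × ∀ k, F k) :
    prodDual P F χ x = χ.1 x.1 + ∑ k, χ.2 k (x.2 k) := prodDualHom_apply χ x

end DualOfProduct

/-! ### Functoriality of restricted products and the abstract duality theorem -/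

section Congr

variable {ι : Type*} {G G' : ι → Type*} [∀ i, AddCommGroup (G i)] [∀ i, TopologicalSpace (G i)]
  [∀ i, AddCommGroup (G' i)] [∀ i, TopologicalSpace (G' i)]
  {H : ∀ i, AddSubgroup (G i)} {H' : ∀ i, AddSubgroup (G' i)}

/-- The homomorphism of restricted products induced by homomorphisms of the factors. -/
def RestrictedProd.map (f : ∀ i, G i →+ G' i)
    (hf : ∀ᶠ i in cofinite, ∀ h ∈ H i, f i h ∈ H' i) :
    RestrictedProd G H →+ RestrictedProd G' H' where
  toFun a := RestrictedProd.mk G' H' (fun i => f i (a.coord i))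
    ((hf.and a.eventually_coord_mem).mono fun _ hi => hi.1 _ hi.2)
  map_zero' := RestrictedProd.ext fun _ => map_zero (f _)
  map_add' _ _ := RestrictedProd.ext fun _ => map_add (f _) _ _

theorem RestrictedProd.continuous_map (f : ∀ i, G i →+ G' i)
    (hf : ∀ᶠ i in cofinite, ∀ h ∈ H i, f i h ∈ H' i) (hc : ∀ i, Continuous (f i)) :
    Continuous (RestrictedProd.map f hf) := by
  classical
  have hfin : {i | ¬ ∀ h ∈ H i, f i h ∈ H' i}.Finite := hf
  refine continuous_of_level _ fun S => ?_
  have hmem : ∀ x : restrictedLevel G H S,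
      (fun i => f i (x.1 i)) ∈ restrictedLevel G' H' (S ∪ hfin.toFinset) := fun x i hi => by
    rw [Finset.mem_union, not_or, hfin.mem_toFinset] at hi
    have h2 : ∀ h ∈ H i, f i h ∈ H' i := not_not.1 hi.2
    exact h2 _ (x.2 i hi.1)
  have hcont : Continuous fun x : restrictedLevel G H S =>
      (⟨fun i => f i (x.1 i), hmem x⟩ : restrictedLevel G' H' (S ∪ hfin.toFinset)) :=
    Continuous.subtype_mk (continuous_pi fun i => (hc i).comp
      ((continuous_apply i).comp continuous_subtype_val)) _
  exact (continuous_restrictedLevelHom _).comp hcont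

/-- Isomorphic factors, with the same subgroups at almost all indices, have isomorphic restricted
products. -/
def restrictedProdCongr (e : ∀ i, G i ≃ₜ+ G' i)
    (he : {i | e i '' (H i : Set (G i)) ≠ H' i}.Finite) :
    RestrictedProd G H ≃ₜ+ RestrictedProd G' H' :=
  have hev : ∀ᶠ i in cofinite, e i '' (H i : Set (G i)) = H' i := by
    rw [eventually_cofinite]
    exact he
  have h1 : ∀ᶠ i in cofinite, ∀ h ∈ H i, ((e i : G i ≃+ G' i) : G i →+ G' i) h ∈ H' i :=
    hev.mono fun i hi h hh => by
      change e i h ∈ (H' i : Set (G' i))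
      rw [← hi]
      exact ⟨h, hh, rfl⟩
  have h2 : ∀ᶠ i in cofinite, ∀ h ∈ H' i, ((e i).symm : G' i →+ G i) h ∈ H i :=
    hev.mono fun i hi h hh => by
      have : h ∈ e i '' (H i : Set (G i)) := by rw [hi]; exact hh
      obtain ⟨g, hg, rfl⟩ := this
      change (e i).symm (e i g) ∈ H i
      rwa [ContinuousAddEquiv.symm_apply_apply]
  { toFun := RestrictedProd.map _ h1
    invFun := RestrictedProd.map _ h2
    left_inv := fun a => RestrictedProd.ext fun i => (e i).symm_apply_apply _
    right_inv := fun a => RestrictedProd.ext fun i => (e i).apply_symm_apply _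
    map_add' := map_add _
    continuous_toFun := RestrictedProd.continuous_map _ _ fun i => (e i).continuous_toFun
    continuous_invFun := RestrictedProd.continuous_map _ _ fun i => (e i).continuous_invFun }

/-- Isomorphic factors have isomorphic products. -/
def prodPiCongr {P P' : Type*} [AddCommGroup P] [TopologicalSpace P] [AddCommGroup P']
    [TopologicalSpace P'] (e : P ≃ₜ+ P') (f : ∀ i, G i ≃ₜ+ G' i) :
    (P × ∀ i, G i) ≃ₜ+ (P' × ∀ i, G' i) where
  toFun x := (e x.1, fun i => f i (x.2 i))
  invFun x := (e.symm x.1, fun i => (f i).symm (x.2 i))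
  left_inv _ := Prod.ext (e.symm_apply_apply _) (funext fun i => (f i).symm_apply_apply _)
  right_inv _ := Prod.ext (e.apply_symm_apply _) (funext fun i => (f i).apply_symm_apply _)
  map_add' _ _ := Prod.ext (map_add e _ _) (funext fun i => map_add (f i) _ _)
  continuous_toFun := (e.continuous_toFun.comp continuous_fst).prodMk
    (continuous_pi fun i => (f i).continuous_toFun.comp ((continuous_apply i).comp continuous_snd))
  continuous_invFun := (e.continuous_invFun.comp continuous_fst).prodMk
    (continuous_pi fun i => (f i).continuous_invFun.comp ((continuous_apply i).comp continuous_snd))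

/-- The duality theorem for a countable restricted product times a finite product. -/
theorem exists_dual_equiv_restrictedProd_prod [Countable ι] [∀ i, IsTopologicalAddGroup (G i)]
    (hH : ∀ i, DualRestrictionOpen (H i)) {κ : Type*} [Fintype κ] (F : κ → Type*)
    [∀ k, AddCommGroup (F k)] [∀ k, TopologicalSpace (F k)] :
    (∃ Ψ : (RestrictedProd (fun i => Dual (G i)) (fun i => annihilator (H i)) ×
          ∀ k, Dual (F k)) ≃ₜ+ Dual (RestrictedProd G H × ∀ k, F k),
      ∀ χ (β : RestrictedProd G H × ∀ k, F k),
        {i | χ.1.coord i (β.1.coord i) ≠ 0}.Finite ∧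
        Ψ χ β = ∑ᶠ i, χ.1.coord i (β.1.coord i) + ∑ k, χ.2 k (β.2 k)) ∧
    ((∀ k, Nonempty (F k ≃ₜ+ Dual (F k))) → ∀ θ : ∀ i, G i ≃ₜ+ Dual (G i),
      {i | θ i '' (H i : Set (G i)) ≠ annihilator (H i)}.Finite →
      Nonempty ((RestrictedProd G H × ∀ k, F k) ≃ₜ+ Dual (RestrictedProd G H × ∀ k, F k))) := by
  let Ψ := (prodPiCongr (restrictedProdDual hH) fun k => ContinuousAddEquiv.refl (Dual (F k))).trans
    (prodDual (RestrictedProd G H) F)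
  refine ⟨⟨Ψ, fun χ β => ⟨pairing_finite χ.1 β.1, ?_⟩⟩, fun hF θ hθ => ?_⟩
  · exact prodDual_apply _ _ _ β
  · exact ⟨(prodPiCongr (restrictedProdCongr θ hθ) fun k => (hF k).some).trans Ψ⟩

end Congr

/-! ## Completions of noetherian rings -/

section NoetherianCompletion

variable {P R : Type*} [CommRing P] [CommRing R]

theorem factorPow_comp_quotientMap (f : P →+* R) (J : Ideal P) (I : Ideal R) (h : J ≤ I.comap f)
    {m n : ℕ} (hmn : m ≤ n) :
    (Ideal.Quotient.factorPow I hmn).comp ((Ideal.quotientMap (I := J ^ n) (I ^ n) f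
        ((Ideal.pow_right_mono h n).trans (Ideal.le_comap_pow f n))).comp
      (AdicCompletion.evalₐ J n : AdicCompletion J P →+* _)) =
    (Ideal.quotientMap (I := J ^ m) (I ^ m) f
        ((Ideal.pow_right_mono h m).trans (Ideal.le_comap_pow f m))).comp
      (AdicCompletion.evalₐ J m : AdicCompletion J P →+* _) := by
  ext a
  obtain ⟨b, rfl⟩ := AdicCompletion.mk_surjective J P a
  simp only [RingHom.comp_apply, RingHom.coe_coe, AdicCompletion.evalₐ_mk,
    Ideal.quotientMap_mk, Ideal.Quotient.factorPow, Ideal.Quotient.factor_mk]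
  rw [← Ideal.quotientMap_mk (H := (Ideal.pow_right_mono h m).trans (Ideal.le_comap_pow f m)),
    AdicCompletion.Ideal.mk_eq_mk _ hmn, Ideal.quotientMap_mk]

/-- The map of completions induced by a ring homomorphism. -/
def completionMap (f : P →+* R) (J : Ideal P) (I : Ideal R) (h : J ≤ I.comap f) :
    AdicCompletion J P →+* AdicCompletion I R :=
  AdicCompletion.liftRingHom I
    (fun n => (Ideal.quotientMap (I := J ^ n) (I ^ n) f
        ((Ideal.pow_right_mono h n).trans (Ideal.le_comap_pow f n))).comp
      (AdicCompletion.evalₐ J n : AdicCompletion J P →+* _))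
    (factorPow_comp_quotientMap f J I h)

theorem evalₐ_completionMap (f : P →+* R) (J : Ideal P) (I : Ideal R) (h : J ≤ I.comap f) (n : ℕ)
    (a : AdicCompletion J P) :
    AdicCompletion.evalₐ I n (completionMap f J I h a) = Ideal.quotientMap (I := J ^ n) (I ^ n) f
      ((Ideal.pow_right_mono h n).trans (Ideal.le_comap_pow f n)) (AdicCompletion.evalₐ J n a) :=
  AdicCompletion.evalₐ_liftRingHom I _ (factorPow_comp_quotientMap f J I h) n a

theorem completionMap_algebraMap (f : P →+* R) (J : Ideal P) (I : Ideal R) (h : J ≤ I.comap f)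
    (a : P) : completionMap f J I h (algebraMap _ _ a) = algebraMap _ _ (f a) := by
  refine AdicCompletion.ext_evalₐ fun n => ?_
  rw [evalₐ_completionMap]
  simp

/-- With `n` generators of `I`, the completion is a quotient of the power series ring in `n`
variables over `R`, itself the completion of the polynomial ring at the ideal of the variables. -/
theorem isNoetherianRing_adicCompletion [IsNoetherianRing R] (I : Ideal R) :
    IsNoetherianRing (AdicCompletion I R) := by
  obtain ⟨n, a, ha⟩ := Submodule.fg_iff_exists_fin_generating_family.1
    ((isNoetherianRing_iff_ideal_fg R).1 inferInstance I)
  let J := MvPolynomial.idealOfVars (Fin n) R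
  let f : MvPolynomial (Fin n) R →+* R := MvPolynomial.eval a
  have hJI : J.map f = I := by
    rw [← ha]
    change (Ideal.span (Set.range MvPolynomial.X)).map f = Ideal.span (Set.range a)
    rw [Ideal.map_span, ← Set.range_comp]
    congr 2
    ext i
    simp [f]
  have hJ : J ≤ I.comap f := Ideal.map_le_iff_le_comap.1 hJI.le
  have hJfg : J.FG := MvPolynomial.idealOfVars_fg (Fin n) R
  have hIfg : I.FG := (isNoetherianRing_iff_ideal_fg R).1 inferInstance I
  let F := completionMap f J I hJ
  have hN : IsNoetherianRing (AdicCompletion J (MvPolynomial (Fin n) R)) :=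
    isNoetherianRing_of_ringEquiv (MvPowerSeries (Fin n) R)
      (MvPowerSeries.toAdicCompletionAlgEquiv (Fin n) R).toRingEquiv
  have hmap : (J.map (algebraMap _ (AdicCompletion J (MvPolynomial (Fin n) R)))).map F =
      I.map (algebraMap R (AdicCompletion I R)) := by
    have hF : F.comp (algebraMap _ _) = (algebraMap R (AdicCompletion I R)).comp f :=
      RingHom.ext fun x => completionMap_algebraMap f J I hJ x
    rw [Ideal.map_map, hF, ← Ideal.map_map, hJI]
  have h1 : IsAdicComplete (J.map (algebraMap _ (AdicCompletion J (MvPolynomial (Fin n) R))))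
      (AdicCompletion J (MvPolynomial (Fin n) R)) :=
    (IsAdicComplete.map_algebraMap_iff _ _).2 (AdicCompletion.isAdicComplete hJfg)
  have h2 : IsAdicComplete (I.map (algebraMap _ (AdicCompletion I R))) (AdicCompletion I R) :=
    (IsAdicComplete.map_algebraMap_iff _ _).2 (AdicCompletion.isAdicComplete hIfg)
  have h3 : IsHausdorff ((J.map (algebraMap _ (AdicCompletion J (MvPolynomial (Fin n) R)))).map F)
      (AdicCompletion I R) := by
    rw [hmap]
    exact h2.toIsHausdorff
  -- By completeness of the source and separatedness of the target, surjectivity may be checked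
  -- modulo the ideal of variables, where constant polynomials suffice.
  have hsurj : Function.Surjective F := by
    refine surjective_of_mk_map_comp_surjective F (I :=
      J.map (algebraMap _ (AdicCompletion J (MvPolynomial (Fin n) R)))) ?_
    intro x
    obtain ⟨x, rfl⟩ := Ideal.Quotient.mk_surjective x
    obtain ⟨r, hr⟩ := Ideal.Quotient.mk_surjective (AdicCompletion.evalOneₐ I x)
    refine ⟨algebraMap (MvPolynomial (Fin n) R) _ (MvPolynomial.C r), ?_⟩
    rw [RingHom.comp_apply, completionMap_algebraMap]
    rw [Ideal.Quotient.eq, hmap, ← AdicCompletion.ker_evalOneₐ_eq_map I hIfg, RingHom.mem_ker]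
    rw [map_sub, sub_eq_zero]
    simp only [f, MvPolynomial.eval_C]
    exact hr
  exact isNoetherianRing_of_surjective _ _ F hsurj

end NoetherianCompletion

/-! ## Fine topologies on modules over a local ring -/

section FineModules

variable (O : Type*) [CommRing O] [IsLocalRing O]

/-- The open subgroups of `O` are the subgroups that contain a power of the maximal ideal. -/
def HasAdicOpenSubgroups [TopologicalSpace O] : Prop :=
  ∀ U : AddSubgroup O, IsOpen (U : Set O) ↔ ∃ k, ∀ a ∈ IsLocalRing.maximalIdeal O ^ k, a ∈ U

variable {O} {N : Type*} [AddCommGroup N] [Module O N]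

section

variable [TopologicalSpace O] [IsTopologicalAddGroup O]

theorem isOpen_fineModuleTopology (hO : HasAdicOpenSubgroups O) {U : AddSubgroup N} :
    @IsOpen N (fineModuleTopology O N) U ↔
      ∀ x : N, ∃ k, ∀ a ∈ IsLocalRing.maximalIdeal O ^ k, a • x ∈ U := by
  rw [isOpen_linearFinal]
  exact forall_congr' fun x => hO _

omit [IsLocalRing O] in
theorem fineModuleTopology_le_nhds {W : Set N} :
    W ∈ @nhds N (fineModuleTopology O N) 0 ↔
      ∃ U : AddSubgroup N, @IsOpen N (fineModuleTopology O N) U ∧ (U : Set N) ⊆ W := by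
  rw [mem_nhds_zero_linearFinal]
  simp only [isOpen_linearFinal]

end

/-- The subgroup `𝔪 ^ j g` of the cyclic submodule generated by `g`. -/
def cyclicPow (O : Type*) [CommRing O] [IsLocalRing O] {N : Type*} [AddCommGroup N] [Module O N]
    (g : N) (j : ℕ) : Submodule O N :=
  Submodule.map (LinearMap.toSpanSingleton O N g) (IsLocalRing.maximalIdeal O ^ j)

theorem mem_cyclicPow {g x : N} {j : ℕ} :
    x ∈ cyclicPow O g j ↔ ∃ a ∈ IsLocalRing.maximalIdeal O ^ j, a • g = x := Iff.rfl

theorem cyclicPow_antitone (g : N) : Antitone (cyclicPow O g) := fun _ _ h =>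
  Submodule.map_mono (Ideal.pow_le_pow_right h)

/-- Every element is mapped to the cyclic submodule generated by `g` by a power of `𝔪`. -/
def CofiniteCyclic (O : Type*) [CommRing O] [IsLocalRing O] {N : Type*} [AddCommGroup N]
    [Module O N] (g : N) : Prop :=
  ∀ x : N, ∃ k, ∀ a ∈ IsLocalRing.maximalIdeal O ^ k, a • x ∈ cyclicPow O g 0

theorem CofiniteCyclic.exists_smul_mem {g : N} (hg : CofiniteCyclic O g) (j : ℕ) (x : N) :
    ∃ k, ∀ a ∈ IsLocalRing.maximalIdeal O ^ k, a • x ∈ cyclicPow O g j := by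
  obtain ⟨k, hk⟩ := hg x
  refine ⟨j + k, fun a ha => ?_⟩
  rw [pow_add] at ha
  induction ha using Submodule.mul_induction_on' with
  | mem_mul_mem b hb c hc =>
    obtain ⟨d, -, hd⟩ := mem_cyclicPow.1 (hk c hc)
    rw [mul_smul, ← hd, ← mul_smul]
    exact mem_cyclicPow.2 ⟨b * d, Ideal.mul_mem_right _ _ hb, rfl⟩
  | add b _ c _ hb hc =>
    rw [add_smul]
    exact add_mem hb hc

variable [TopologicalSpace O] [IsTopologicalAddGroup O] (hO : HasAdicOpenSubgroups O)

include hO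

theorem CofiniteCyclic.isOpen_cyclicPow {g : N} (hg : CofiniteCyclic O g) (j : ℕ) :
    @IsOpen N (fineModuleTopology O N) (cyclicPow O g j : Set N) :=
  (isOpen_fineModuleTopology hO (U := (cyclicPow O g j).toAddSubgroup)).2 (hg.exists_smul_mem j)

/-- Together with `CofiniteCyclic.isOpen_cyclicPow`, this shows that the subgroups `𝔪 ^ j g` form a
basis of neighbourhoods of zero. -/
theorem exists_cyclicPow_subset (g : N) {U : AddSubgroup N}
    (hU : @IsOpen N (fineModuleTopology O N) U) : ∃ k, ∀ x ∈ cyclicPow O g k, x ∈ U := by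
  obtain ⟨k, hk⟩ := (isOpen_fineModuleTopology hO).1 hU g
  exact ⟨k, fun x ⟨a, ha, hx⟩ => hx ▸ hk a ha⟩

/-- Linear maps are continuous for the fine module topologies. -/
theorem continuous_fineModuleTopology {N' : Type*} [AddCommGroup N'] [Module O N']
    (f : N →ₗ[O] N') :
    @Continuous N N' (fineModuleTopology O N) (fineModuleTopology O N') f := by
  let _ := fineModuleTopology O N
  have _ : IsTopologicalAddGroup N := isTopologicalAddGroup_linear _
  refine continuous_linear f.toAddMonoidHom fun U hU => ?_
  refine IsOpen.mem_nhds ?_ (zero_mem _)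
  refine (isOpen_fineModuleTopology hO).2 fun x => ?_
  obtain ⟨k, hk⟩ := (hO _).1 (hU (f x))
  refine ⟨k, fun a ha => ?_⟩
  change f (a • x) ∈ U
  rw [map_smul]
  exact hk a ha

/-- Approximations of a Cauchy ultrafilter modulo `𝔪 ^ j g` differ successively by `a j • g` with `a
j ∈ 𝔪 ^ j`; the series of the `a j` converges in `O`. -/
theorem CofiniteCyclic.ultraComplete [IsPrecomplete (IsLocalRing.maximalIdeal O) O] {g : N}
    (hg : CofiniteCyclic O g) : @UltraComplete N _ (fineModuleTopology O N) := by
  let _ := fineModuleTopology O N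
  have _ : IsTopologicalAddGroup N := isTopologicalAddGroup_linear _
  intro F hF
  have h1 : ∀ j, ∃ x, ∀ᶠ h in F, h - x ∈ cyclicPow O g j := fun j =>
    hF _ ((hg.isOpen_cyclicPow hO j).mem_nhds (zero_mem _))
  choose x hx using h1
  have h2 : ∀ j, ∃ a ∈ IsLocalRing.maximalIdeal O ^ j, a • g = x (j + 1) - x j := fun j => by
    obtain ⟨h, h3, h4⟩ := ((hx (j + 1)).and (hx j)).exists
    refine mem_cyclicPow.1 ?_
    have := sub_mem h4 (cyclicPow_antitone g (Nat.le_succ j) h3)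
    rwa [sub_sub_sub_cancel_left] at this
  choose a ha hag using h2
  have hs : ∀ j, x j = x 0 + (∑ i ∈ Finset.range j, a i) • g := fun j => by
    rw [Finset.sum_smul, Finset.sum_congr rfl fun i _ => hag i, Finset.sum_range_sub]
    abel
  obtain ⟨L, hL⟩ := IsPrecomplete.prec' (I := IsLocalRing.maximalIdeal O)
    (fun j => ∑ i ∈ Finset.range j, a i) fun {m n} hmn => by
      rw [SModEq.sub_mem, ← Submodule.neg_mem_iff, neg_sub, ← Finset.sum_Ico_eq_sub _ hmn,
        smul_eq_mul, Ideal.mul_top]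
      exact Submodule.sum_mem _ fun i hi => Ideal.pow_le_pow_right (Finset.mem_Ico.1 hi).1 (ha i)
  refine ⟨x 0 + L • g, le_nhds_iff_sub.2 fun W hW => mem_map.2 ?_⟩
  obtain ⟨U, hU, hUW⟩ := fineModuleTopology_le_nhds.1 hW
  obtain ⟨k, hk⟩ := exists_cyclicPow_subset hO g hU
  filter_upwards [hx k] with h hh
  refine hUW (hk _ ?_)
  change h - (x 0 + L • g) ∈ cyclicPow O g k
  have h5 : h - (x 0 + L • g) = (h - x k) + ((∑ i ∈ Finset.range k, a i) - L) • g := by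
    rw [hs k, sub_smul]
    abel
  have h6 := hL k
  rw [SModEq.sub_mem, smul_eq_mul, Ideal.mul_top] at h6
  rw [h5]
  exact add_mem hh ⟨_, h6, rfl⟩

variable [IsNoetherianRing O]

/-- Krull's intersection theorem for the cyclic module generated by `g`. -/
theorem CofiniteCyclic.eq_zero_of_forall_mem {g : N} (hg : CofiniteCyclic O g) {x : N}
    (hx : ∀ U : AddSubgroup N, @IsOpen N (fineModuleTopology O N) U → x ∈ U) : x = 0 := by
  have h1 : ∀ j, x ∈ cyclicPow O g j := fun j =>
    hx (cyclicPow O g j).toAddSubgroup (hg.isOpen_cyclicPow hO j)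
  have h2 : x ∈ Submodule.span O {g} := by
    obtain ⟨a, -, rfl⟩ := h1 0
    exact Submodule.smul_mem _ _ (Submodule.mem_span_singleton_self g)
  have h3 : (⟨x, h2⟩ : Submodule.span O {g}) = 0 := by
    refine IsHausdorff.haus' (I := IsLocalRing.maximalIdeal O) _ fun n => ?_
    rw [SModEq.zero]
    obtain ⟨a, ha, hax⟩ := h1 n
    have : (⟨x, h2⟩ : Submodule.span O {g}) =
        a • ⟨g, Submodule.mem_span_singleton_self g⟩ := Subtype.ext hax.symm
    rw [this]
    exact Submodule.smul_mem_smul ha trivial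
  exact congrArg Subtype.val h3

/-- A subgroup that is open in a submodule is induced by an open subgroup. -/
theorem CofiniteCyclic.exists_isOpen_inf_le {g : N} (hg : CofiniteCyclic O g)
    (N' : Submodule O N) (W : AddSubgroup N) (hWN : ∀ x ∈ W, x ∈ N')
    (hW : ∀ x ∈ N', ∃ k, ∀ a ∈ IsLocalRing.maximalIdeal O ^ k, a • x ∈ W) :
    ∃ V : AddSubgroup N, @IsOpen N (fineModuleTopology O N) V ∧ ∀ x ∈ V, x ∈ N' → x ∈ W := by
  -- The coefficients that move `g` into `N'`. Being finitely generated, `I₀` satisfies `𝔪 ^ K I₀ g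
  -- ⊆ W` for a single exponent `K`.
  let I₀ : Ideal O := N'.comap (LinearMap.toSpanSingleton O N g)
  obtain ⟨S, hS⟩ := (isNoetherianRing_iff_ideal_fg O).1 inferInstance I₀
  have hSmem : ∀ b ∈ S, b • g ∈ N' := fun b hb => by
    have : b ∈ I₀ := hS ▸ Submodule.subset_span hb
    exact this
  have h1 : ∀ b : S, ∃ k, ∀ a ∈ IsLocalRing.maximalIdeal O ^ k, a • (b.1 • g) ∈ W :=
    fun b => hW _ (hSmem b b.2)
  choose k hk using h1
  let K := Finset.univ.sup k
  have h2 : ∀ c ∈ IsLocalRing.maximalIdeal O ^ K * I₀, c • g ∈ W := by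
    intro c hc
    induction hc using Submodule.mul_induction_on' with
    | mem_mul_mem a ha d hd =>
      have hd' : d ∈ Ideal.span (S : Set O) := by
        rw [hS]
        exact hd
      clear hd
      induction hd' using Submodule.span_induction generalizing a with
      | mem b hb =>
        rw [mul_smul]
        exact hk ⟨b, hb⟩ a (Ideal.pow_le_pow_right (Finset.le_sup (Finset.mem_univ _)) ha)
      | zero => simp
      | add b c _ _ hb hc =>
        rw [mul_add, add_smul]
        exact add_mem (hb a ha) (hc a ha)
      | smul r b _ hb =>
        rw [smul_eq_mul, ← mul_assoc]
        exact hb _ (Ideal.mul_mem_right _ _ ha)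
    | add a _ b _ ha hb =>
      rw [add_smul]
      exact add_mem ha hb
  -- Artin–Rees: `𝔪 ^ (K + k₀) ∩ I₀ ⊆ 𝔪 ^ K I₀`. Hence enlarging `W` by `𝔪 ^ (K + k₀) g` makes it
  -- open without adding elements of `N'`.
  obtain ⟨k₀, hk₀⟩ := Ideal.exists_pow_inf_eq_pow_smul (IsLocalRing.maximalIdeal O) I₀
  refine ⟨W ⊔ (cyclicPow O g (K + k₀)).toAddSubgroup, ?_, ?_⟩
  · let _ := fineModuleTopology O N
    have _ : IsTopologicalAddGroup N := isTopologicalAddGroup_linear _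
    refine AddSubgroup.isOpen_mono le_sup_right ?_
    exact hg.isOpen_cyclicPow hO _
  · intro x hx hxN
    obtain ⟨w, hw, y, hy, rfl⟩ := AddSubgroup.mem_sup.1 hx
    refine add_mem hw ?_
    obtain ⟨c, hc, rfl⟩ := mem_cyclicPow.1 hy
    have hcI : c ∈ I₀ := by
      have := sub_mem hxN (hWN w hw)
      rwa [add_sub_cancel_left] at this
    refine h2 c ?_
    have h3 : c ∈ IsLocalRing.maximalIdeal O ^ (K + k₀) • (⊤ : Submodule O O) ⊓ I₀ :=
      ⟨by rwa [smul_eq_mul, Ideal.mul_top], hcI⟩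
    rw [hk₀ _ (Nat.le_add_left _ _), Nat.add_sub_cancel] at h3
    exact Submodule.smul_mono le_rfl inf_le_right h3

end FineModules

/-! ## The completion of a localisation at a branch -/

section BranchCompletion

/-- The fine topologies are transitive. -/
theorem fineModuleTopology_trans {O B N : Type*} [CommRing O] [TopologicalSpace O]
    [IsTopologicalAddGroup O] [CommRing B] [Algebra O B] [AddCommGroup N] [Module O N] [Module B N]
    [IsScalarTower O B N] :
    @fineModuleTopology B N _ (fineModuleTopology O B) _ _ = fineModuleTopology O N := by
  let _ := fineModuleTopology O B
  have _ : IsTopologicalAddGroup B := isTopologicalAddGroup_linear _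
  unfold fineModuleTopology linearFinal
  congr 1
  ext U
  have key : ∀ x : N, IsOpen (U.comap (LinearMap.toSpanSingleton B N x).toAddMonoidHom : Set B) ↔
      ∀ b : B, IsOpen (U.comap (LinearMap.toSpanSingleton O N (b • x)).toAddMonoidHom : Set O) := by
    intro x
    refine (isOpen_linearFinal (f := fun b : B => (LinearMap.toSpanSingleton O B b).toAddMonoidHom)
      (U := U.comap (LinearMap.toSpanSingleton B N x).toAddMonoidHom)).trans ?_
    refine forall_congr' fun b => ?_
    have : ∀ a : O, (a • b) • x = a • b • x := fun a => smul_assoc a b x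
    refine iff_of_eq (congrArg IsOpen (Set.ext fun a => ?_))
    change (a • b) • x ∈ U ↔ a • b • x ∈ U
    rw [this]
  refine ⟨fun h x => ?_, fun h x => (key x).2 fun b => h _⟩
  have := (key x).1 (h x) 1
  rwa [one_smul] at this

variable {O : Type*} [CommRing O] (z : Ideal O) [z.IsPrime]

/-- The completion of the localisation of `O` at the prime `z`. -/
def BranchCompletion : Type _ :=
  AdicCompletion (IsLocalRing.maximalIdeal (Localization.AtPrime z)) (Localization.AtPrime z)

instance : CommRing (BranchCompletion z) := inferInstanceAs (CommRing
  (AdicCompletion (IsLocalRing.maximalIdeal (Localization.AtPrime z)) (Localization.AtPrime z)))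

/-- The quotient of the localisation at `z` by a power of its maximal ideal. -/
def BranchQuotient (n : ℕ) : Type _ :=
  Localization.AtPrime z ⧸ IsLocalRing.maximalIdeal (Localization.AtPrime z) ^ n

instance (n : ℕ) : CommRing (BranchQuotient z n) := inferInstanceAs (CommRing
  (Localization.AtPrime z ⧸ IsLocalRing.maximalIdeal (Localization.AtPrime z) ^ n))

instance (n : ℕ) : Algebra O (BranchQuotient z n) := inferInstanceAs (Algebra O
  (Localization.AtPrime z ⧸ IsLocalRing.maximalIdeal (Localization.AtPrime z) ^ n))

/-- The quotient map from the localisation. -/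
def toBranchQuotient (n : ℕ) : Localization.AtPrime z →+* BranchQuotient z n :=
  Ideal.Quotient.mk _

/-- The map from the completion to a quotient of the localisation. -/
def branchEval (n : ℕ) : BranchCompletion z →+* BranchQuotient z n :=
  (AdicCompletion.evalₐ (IsLocalRing.maximalIdeal (Localization.AtPrime z)) n).toRingHom

/-- The map from the localisation to its completion. -/
def toBranchCompletion : Localization.AtPrime z →+* BranchCompletion z :=
  algebraMap (Localization.AtPrime z)
    (AdicCompletion (IsLocalRing.maximalIdeal (Localization.AtPrime z)) (Localization.AtPrime z))

theorem branchEval_toBranchCompletion (n : ℕ) (b : Localization.AtPrime z) :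
    branchEval z n (toBranchCompletion z b) = toBranchQuotient z n b :=
  AdicCompletion.evalₐ_of _ n b

theorem toBranchQuotient_surjective (n : ℕ) : Function.Surjective (toBranchQuotient z n) :=
  Ideal.Quotient.mk_surjective

theorem toBranchQuotient_eq_zero {n : ℕ} {b : Localization.AtPrime z} :
    toBranchQuotient z n b = 0 ↔ b ∈ IsLocalRing.maximalIdeal (Localization.AtPrime z) ^ n :=
  Ideal.Quotient.eq_zero_iff_mem

theorem algebraMap_branchQuotient (n : ℕ) (a : O) :
    algebraMap O (BranchQuotient z n) a =
      toBranchQuotient z n (algebraMap O (Localization.AtPrime z) a) := rfl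

theorem branchEval_ext {a b : BranchCompletion z} (h : ∀ n, branchEval z n a = branchEval z n b) :
    a = b := AdicCompletion.ext_evalₐ h

/-- The transition maps between the quotients. -/
def branchTransition {m n : ℕ} (h : m ≤ n) : BranchQuotient z n →ₐ[O] BranchQuotient z m :=
  { Ideal.Quotient.factorPow (IsLocalRing.maximalIdeal (Localization.AtPrime z)) h with
    commutes' := fun _ => rfl }

theorem branchTransition_toBranchQuotient {m n : ℕ} (h : m ≤ n) (b : Localization.AtPrime z) :
    branchTransition z h (toBranchQuotient z n b) = toBranchQuotient z m b := rfl

theorem branchTransition_branchEval {m n : ℕ} (h : m ≤ n) (b : BranchCompletion z) :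
    branchTransition z h (branchEval z n b) = branchEval z m b := by
  obtain ⟨b, rfl⟩ := AdicCompletion.mk_surjective
    (IsLocalRing.maximalIdeal (Localization.AtPrime z)) (Localization.AtPrime z) b
  change Ideal.Quotient.factorPow _ h (AdicCompletion.evalₐ _ n _) = AdicCompletion.evalₐ _ m _
  simp only [AdicCompletion.evalₐ_mk, Ideal.Quotient.factorPow, Ideal.Quotient.factor_mk]
  exact AdicCompletion.Ideal.mk_eq_mk _ h _

/-- Compatible elements of the quotients come from the completion. -/
theorem exists_branchEval_eq (g : ∀ n, BranchQuotient z n)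
    (hg : ∀ m n (h : m ≤ n), branchTransition z h (g n) = g m) :
    ∃ b : BranchCompletion z, ∀ n, branchEval z n b = g n := by
  choose x hx using fun n => toBranchQuotient_surjective z n (g n)
  let s : AdicCompletion.AdicCauchySequence
      (IsLocalRing.maximalIdeal (Localization.AtPrime z)) (Localization.AtPrime z) :=
    ⟨x, fun {m n} hmn => by
      rw [SModEq.sub_mem, smul_eq_mul, Ideal.mul_top, ← toBranchQuotient_eq_zero, map_sub, hx,
        ← branchTransition_toBranchQuotient z hmn, hx, hg, sub_self]⟩
  refine ⟨AdicCompletion.mk _ _ s, fun n => ?_⟩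
  rw [← hx]
  exact AdicCompletion.evalₐ_mk _ n s

variable [TopologicalSpace O]

instance branchTopology : TopologicalSpace (BranchCompletion z) :=
  letI : TopologicalSpace (Localization.AtPrime z) := fineModuleTopology O (Localization.AtPrime z)
  completionTopology (Localization.AtPrime z) (IsLocalRing.maximalIdeal (Localization.AtPrime z))

instance (n : ℕ) : TopologicalSpace (BranchQuotient z n) :=
  fineModuleTopology O (BranchQuotient z n)

instance (n : ℕ) : NonarchimedeanAddGroup (BranchQuotient z n) :=
  nonarchimedean_linear _

variable [IsTopologicalAddGroup O]

/-- Transitivity of fine topologies removes the localisation as an intermediate step: the quotients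
carry the fine topology over `O` itself. -/
theorem branchTopology_eq : branchTopology z =
    linearInitial fun n => (branchEval z n : BranchCompletion z →+ BranchQuotient z n) := by
  let T (n : ℕ) : TopologicalSpace (BranchQuotient z n) :=
    @fineModuleTopology (Localization.AtPrime z)
      (Localization.AtPrime z ⧸ IsLocalRing.maximalIdeal (Localization.AtPrime z) ^ n) _
      (fineModuleTopology O (Localization.AtPrime z)) _ _
  have hT : T = fun n => fineModuleTopology O (BranchQuotient z n) :=
    funext fun n => fineModuleTopology_trans (O := O) (B := Localization.AtPrime z)
      (N := Localization.AtPrime z ⧸ IsLocalRing.maximalIdeal (Localization.AtPrime z) ^ n)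
  change @linearInitial ℕ (BranchQuotient z) _ T (BranchCompletion z) _ _ = _
  rw [hT]
  rfl

instance : NonarchimedeanAddGroup (BranchCompletion z) := nonarchimedean_linear _

end BranchCompletion

/-! ### Completeness and topology of the branch completion -/

section BranchTopology

variable {O : Type*} [CommRing O] [IsLocalRing O]

/-- Modulo every power of `z`, the elements outside `z` divide a power of the maximal ideal. -/
def IsBranch (z : Ideal O) : Prop :=
  ∀ c ∉ z, ∀ n, ∃ k, IsLocalRing.maximalIdeal O ^ k ≤ Ideal.span {c} ⊔ z ^ n

variable {z : Ideal O} [z.IsPrime]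

omit [IsLocalRing O] in
theorem algebraMap_branchQuotient_eq_zero {n : ℕ} {a : O} (ha : a ∈ z ^ n) :
    algebraMap O (BranchQuotient z n) a = 0 := by
  rw [algebraMap_branchQuotient, toBranchQuotient_eq_zero,
    ← Localization.AtPrime.map_eq_maximalIdeal, ← Ideal.map_pow]
  exact Ideal.mem_map_of_mem _ ha

/-- A denominator `c ∉ z` is cleared, modulo `z ^ n`, by a power of the maximal ideal. -/
theorem IsBranch.cofiniteCyclic (hz : IsBranch z) (n : ℕ) :
    CofiniteCyclic O (1 : BranchQuotient z n) := by
  intro x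
  obtain ⟨b, rfl⟩ := toBranchQuotient_surjective z n x
  obtain ⟨⟨r, c⟩, hrc⟩ := IsLocalization.surj z.primeCompl b
  obtain ⟨k, hk⟩ := hz c c.2 n
  refine ⟨k, fun a ha => ?_⟩
  obtain ⟨d, hd, e, he, rfl⟩ := Submodule.mem_sup.1 (hk ha)
  obtain ⟨d, rfl⟩ := Ideal.mem_span_singleton'.1 hd
  -- Here `x = r / c` and `a = d c + e` with `e ∈ z ^ n` acting as zero, so that `a x = d r`.
  refine mem_cyclicPow.2 ⟨d * r, by simp, ?_⟩
  rw [add_smul, Algebra.smul_def e, algebraMap_branchQuotient_eq_zero he, zero_mul, add_zero,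
    Algebra.smul_def, Algebra.smul_def, mul_one, map_mul, map_mul, mul_assoc]
  congr 1
  rw [algebraMap_branchQuotient, algebraMap_branchQuotient, ← map_mul, mul_comm, hrc]

variable [TopologicalSpace O] [IsTopologicalAddGroup O]

section

variable (hO : HasAdicOpenSubgroups O)

include hO

theorem continuous_branchTransition {m n : ℕ} (h : m ≤ n) :
    Continuous (branchTransition z h) :=
  continuous_fineModuleTopology hO (branchTransition z h).toLinearMap

theorem continuous_mul_left_branchQuotient {n : ℕ} (g : BranchQuotient z n) :
    Continuous fun x => g * x :=
  continuous_fineModuleTopology hO (LinearMap.mulLeft O g)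

omit [IsLocalRing O] hO in
variable (z) in
theorem continuous_branchEval (n : ℕ) : Continuous (branchEval z n) := by
  rw [branchTopology_eq z]
  exact continuous_linearInitial
    (f := fun n => (branchEval z n : BranchCompletion z →+ BranchQuotient z n)) n

omit [IsLocalRing O] hO in
theorem nhds_zero_branchCompletion :
    𝓝 (0 : BranchCompletion z) = ⨅ n, comap (branchEval z n) (𝓝 0) := by
  rw [branchTopology_eq z]
  exact nhds_zero_linearInitial
    (f := fun n => (branchEval z n : BranchCompletion z →+ BranchQuotient z n))

theorem mem_nhds_zero_branchCompletion {W : Set (BranchCompletion z)} : W ∈ 𝓝 0 ↔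
    ∃ n, ∃ V : AddSubgroup (BranchQuotient z n), IsOpen (V : Set (BranchQuotient z n)) ∧
      ∀ b, branchEval z n b ∈ V → b ∈ W := by
  rw [nhds_zero_branchCompletion, mem_iInf_of_directed]
  · refine exists_congr fun n => ⟨fun h => ?_, fun ⟨V, hV, h⟩ => ?_⟩
    · obtain ⟨W', hW', h'⟩ := h
      obtain ⟨V, hV, hVW⟩ := exists_open_subgroup_subset hW'
      exact ⟨V, hV, fun b hb => h' (hVW hb)⟩
    · exact ⟨V, hV.mem_nhds (zero_mem _), h⟩
  · refine Antitone.directed_ge fun m n h => ?_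
    have h1 : (branchEval z m : BranchCompletion z → _) =
        branchTransition z h ∘ branchEval z n := funext fun b =>
      (branchTransition_branchEval z h b).symm
    rw [h1, ← comap_comap]
    refine comap_mono ?_
    have := (continuous_branchTransition (z := z) hO h).tendsto 0
    rw [map_zero] at this
    exact this.le_comap

theorem continuous_mul_left_branchCompletion (t : BranchCompletion z) :
    Continuous fun b => t * b := by
  refine continuous_of_continuousAt_zero (AddMonoidHom.mulLeft t) ?_
  rw [ContinuousAt, map_zero, nhds_zero_branchCompletion (z := z), tendsto_iInf]
  intro n
  rw [tendsto_comap_iff]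
  have h1 : (branchEval z n ∘ AddMonoidHom.mulLeft t : BranchCompletion z → _) =
      (fun x => branchEval z n t * x) ∘ branchEval z n := funext fun b => map_mul _ t b
  rw [h1]
  have h2 := ((continuous_mul_left_branchQuotient hO (branchEval z n t)).comp
    (continuous_branchEval z n)).tendsto 0
  rw [← nhds_zero_branchCompletion (z := z)]
  simpa using h2

/-- If `c` lies in the maximal ideal, then every element is mapped to a given open subgroup by a
power of `c`. -/
theorem exists_pow_smul_mem_branchCompletion {c : O} (hc : c ∈ IsLocalRing.maximalIdeal O)
    {W : Set (BranchCompletion z)} (hW : W ∈ 𝓝 0) (b : BranchCompletion z) :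
    ∃ k, ∀ k' ≥ k, toBranchCompletion z (algebraMap _ _ (c ^ k')) * b ∈ W := by
  obtain ⟨n, V, hV, hVW⟩ := (mem_nhds_zero_branchCompletion hO).1 hW
  obtain ⟨k, hk⟩ := (isOpen_fineModuleTopology hO).1 hV (branchEval z n b)
  refine ⟨k, fun k' hk' => hVW _ ?_⟩
  rw [map_mul, branchEval_toBranchCompletion, ← algebraMap_branchQuotient, ← Algebra.smul_def]
  exact hk _ (Ideal.pow_le_pow_right hk' (Ideal.pow_mem_pow hc k'))

variable [IsNoetherianRing O]

theorem IsBranch.t2Space_branchQuotient (hz : IsBranch z) (n : ℕ) : T2Space (BranchQuotient z n) := by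
  refine IsTopologicalAddGroup.t2Space_of_zero_sep fun x hx => ?_
  by_contra! h
  refine hx ((hz.cofiniteCyclic n).eq_zero_of_forall_mem hO fun U hU => ?_)
  exact h U (IsOpen.mem_nhds hU (zero_mem _))

/-- Limits exist in every quotient by completeness there, and are compatible because the quotients
are Hausdorff; a compatible system is an element of the completion. -/
theorem IsBranch.ultraComplete [IsPrecomplete (IsLocalRing.maximalIdeal O) O] (hz : IsBranch z) :
    UltraComplete (BranchCompletion z) := by
  intro F hF
  have h1 : ∀ n, ∃ g, Tendsto (branchEval z n) F (𝓝 g) := fun n => by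
    refine (hz.cofiniteCyclic n).ultraComplete hO (F.map (branchEval z n)) ?_
    have h2 := (continuous_branchEval z n).tendsto 0
    rw [map_zero] at h2
    exact hF.map (branchEval z n : BranchCompletion z →+ BranchQuotient z n) h2
  choose g hg using h1
  obtain ⟨b, hb⟩ := exists_branchEval_eq z g fun m n h => by
    have := hz.t2Space_branchQuotient hO m
    refine tendsto_nhds_unique ?_ (hg m)
    have h3 := ((continuous_branchTransition (z := z) hO h).tendsto (g n)).comp (hg n)
    refine h3.congr fun b => ?_
    exact branchTransition_branchEval z h b
  refine ⟨b, le_nhds_iff_sub.2 ?_⟩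
  rw [nhds_zero_branchCompletion, tendsto_iInf]
  intro n
  rw [tendsto_comap_iff]
  have h4 := (hg n).sub_const (g n)
  rw [sub_self] at h4
  refine h4.congr fun x => ?_
  rw [Function.comp_apply, map_sub, hb]

end

end BranchTopology

/-- For a finitely generated ideal the kernel of evaluation modulo `I ^ s` is generated by `I ^ s`,
here by `t ^ s`. -/
theorem exists_eq_mul_of_evalₐ_eq_zero {A : Type*} [CommRing A] {I : Ideal A} {t : A}
    (hI : I = Ideal.span {t}) {s : ℕ} (b : AdicCompletion I A)
    (h : AdicCompletion.evalₐ I s b = 0) : ∃ c, b = algebraMap A (AdicCompletion I A) t ^ s * c := by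
  have hfg : I.FG := ⟨{t}, by rw [hI, Finset.coe_singleton]⟩
  have h1 : b ∈ (AdicCompletion.eval I A s).ker := by
    rw [LinearMap.mem_ker, ← AdicCompletion.factor_evalₐ_eq_eval _ b (Ideal.mul_top _).symm.le]
    exact (congrArg _ h).trans (map_zero _)
  have hIs : I ^ s = Ideal.span {t ^ s} := by
    conv_lhs => rw [hI]
    exact Ideal.span_singleton_pow t s
  rw [← AdicCompletion.pow_smul_top_eq_ker_eval hfg, hIs,
    Submodule.ideal_span_singleton_smul] at h1
  obtain ⟨c, -, hc⟩ := (Submodule.mem_smul_pointwise_iff_exists _ _ _).1 h1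
  exact ⟨c, by rw [← hc, Algebra.smul_def, map_pow]⟩

/-! ### Multiplication by a uniformizer in the branch completion -/

section BranchUniformizer

variable {O : Type*} [CommRing O] {z : Ideal O} [z.IsPrime]

/-- The map from `O` to the completion at the branch `z`. -/
def ofBranch (z : Ideal O) [z.IsPrime] : O →+* BranchCompletion z :=
  (toBranchCompletion z).comp (algebraMap O (Localization.AtPrime z))

theorem branchEval_ofBranch (n : ℕ) (a : O) :
    branchEval z n (ofBranch z a) = algebraMap O (BranchQuotient z n) a :=
  branchEval_toBranchCompletion z n _

variable {t : O} (ht : ∀ b : Localization.AtPrime z, algebraMap O _ t * b = 0 → b = 0)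

include ht

/-- Since `𝔪 ^ (e + n) ⊆ t 𝔪 ^ n` and `t` can be cancelled, division by `t` costs at most `e` steps
in the filtration. In general `t` generates only an ideal containing a power of `𝔪`, whence the
shift. -/
theorem branchTransition_eq_zero_of_mul {e n : ℕ}
    (he : IsLocalRing.maximalIdeal (Localization.AtPrime z) ^ e ≤ Ideal.span {algebraMap O _ t})
    {x : BranchQuotient z (e + n)} (hx : algebraMap O _ t * x = 0) :
    branchTransition z (Nat.le_add_left n e) x = 0 := by
  obtain ⟨b, rfl⟩ := toBranchQuotient_surjective z _ x
  rw [algebraMap_branchQuotient, ← map_mul, toBranchQuotient_eq_zero, pow_add] at hx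
  rw [branchTransition_toBranchQuotient, toBranchQuotient_eq_zero]
  obtain ⟨c, hc, hcb⟩ := Ideal.mem_span_singleton_mul.1 (Ideal.mul_mono_left he hx)
  have h0 : c - b = 0 := ht _ (by rw [mul_sub, hcb, sub_self])
  rwa [← sub_eq_zero.1 h0]

theorem ofBranch_mul_injective
    (he : ∃ e, IsLocalRing.maximalIdeal (Localization.AtPrime z) ^ e ≤
      Ideal.span {algebraMap O _ t}) {b : BranchCompletion z} (hb : ofBranch z t * b = 0) :
    b = 0 := by
  obtain ⟨e, he⟩ := he
  refine branchEval_ext z fun n => ?_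
  rw [map_zero, ← branchTransition_branchEval z (Nat.le_add_left n e)]
  refine branchTransition_eq_zero_of_mul ht he ?_
  rw [← branchEval_ofBranch, ← map_mul, hb, map_zero]

/-- In the quotient of index `e + n`, the submodule of multiples of `t` carries the induced topology
by Artin–Rees; passing to index `n` removes the kernel of multiplication. -/
theorem exists_nhds_of_ofBranch_mul [IsLocalRing O] [TopologicalSpace O] [IsTopologicalAddGroup O]
    [IsNoetherianRing O] (hO : HasAdicOpenSubgroups O) (hz : IsBranch z)
    (he : ∃ e, IsLocalRing.maximalIdeal (Localization.AtPrime z) ^ e ≤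
      Ideal.span {algebraMap O _ t}) {W : Set (BranchCompletion z)} (hW : W ∈ 𝓝 0) :
    ∃ W' ∈ 𝓝 (0 : BranchCompletion z), ∀ b, ofBranch z t * b ∈ W' → b ∈ W := by
  obtain ⟨e, he⟩ := he
  obtain ⟨n, V, hV, hVW⟩ := (mem_nhds_zero_branchCompletion hO).1 hW
  let τ := branchTransition z (Nat.le_add_left n e)
  let μ : BranchQuotient z (e + n) →ₗ[O] BranchQuotient z (e + n) := t • LinearMap.id
  have hμ : ∀ x, μ x = algebraMap O _ t * x := fun x => Algebra.smul_def t x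
  -- The multiples by `t` of the elements whose image at index `n` lies in `V`.
  let W₀ : AddSubgroup (BranchQuotient z (e + n)) :=
    (V.comap (τ : BranchQuotient z (e + n) →+ BranchQuotient z n)).map μ.toAddMonoidHom
  obtain ⟨V', hV', h⟩ := (hz.cofiniteCyclic (e + n)).exists_isOpen_inf_le hO (LinearMap.range μ) W₀
    (by
      rintro _ ⟨x, -, rfl⟩
      exact ⟨x, rfl⟩)
    (by
      rintro _ ⟨x, rfl⟩
      obtain ⟨k, hk⟩ := (isOpen_fineModuleTopology hO).1 hV (τ x)
      refine ⟨k, fun a ha => ?_⟩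
      rw [← map_smul]
      refine ⟨a • x, ?_, rfl⟩
      change τ (a • x) ∈ V
      rw [map_smul]
      exact hk a ha)
  refine ⟨{b | branchEval z (e + n) b ∈ V'},
    (mem_nhds_zero_branchCompletion hO).2 ⟨_, V', hV', fun b hb => hb⟩, fun b hb => hVW b ?_⟩
  have hb' : branchEval z (e + n) (ofBranch z t * b) ∈ V' := hb
  rw [map_mul, branchEval_ofBranch, ← hμ] at hb'
  obtain ⟨x, hx, hxb⟩ := h _ hb' ⟨_, rfl⟩
  have hx' : τ x ∈ V := hx
  have h0 : μ (x - branchEval z (e + n) b) = 0 := by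
    rw [map_sub, sub_eq_zero]
    exact hxb
  rw [hμ] at h0
  have h1 := branchTransition_eq_zero_of_mul ht he h0
  rw [map_sub, sub_eq_zero, branchTransition_branchEval] at h1
  rwa [← h1]

omit ht in
/-- If `z` is generated by `t`, the kernels of the evaluation maps are generated by the powers
of `t`. -/
theorem branchEval_eq_zero_iff (hzt : z = Ideal.span {t}) {s : ℕ} {b : BranchCompletion z} :
    branchEval z s b = 0 ↔ ∃ c, b = ofBranch z t ^ s * c := by
  have hm : IsLocalRing.maximalIdeal (Localization.AtPrime z) = Ideal.span {algebraMap O _ t} := by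
    rw [← Localization.AtPrime.map_eq_maximalIdeal]
    refine (congrArg (Ideal.map (algebraMap O (Localization.AtPrime z))) hzt).trans ?_
    rw [Ideal.map_span, Set.image_singleton]
  constructor
  · exact exists_eq_mul_of_evalₐ_eq_zero hm b
  · rintro ⟨c, rfl⟩
    rw [map_mul, ← map_pow, branchEval_ofBranch, algebraMap_branchQuotient_eq_zero, zero_mul]
    rw [hzt]
    exact Ideal.pow_mem_pow (Ideal.mem_span_singleton_self t) s

/-- Reducing modulo the maximal ideal of the branch shows `a ∈ z = (t)`; then a factor `t` is
cancelled from all terms. -/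
theorem exists_of_ofBranch_mul_eq (hzt : z = Ideal.span {t})
    (he : ∃ e, IsLocalRing.maximalIdeal (Localization.AtPrime z) ^ e ≤
      Ideal.span {algebraMap O _ t}) {s : ℕ} {b c : BranchCompletion z} {a : O}
    (h : ofBranch z t * b = ofBranch z a + ofBranch z t ^ (s + 1) * c) :
    ∃ a' : O, b = ofBranch z a' + ofBranch z t ^ s * c := by
  have h1 : a ∈ z := by
    have h2 := congrArg (branchEval z 1) h
    have ht0 : algebraMap O (BranchQuotient z 1) t = 0 := by
      refine algebraMap_branchQuotient_eq_zero ?_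
      rw [pow_one, hzt]
      exact Ideal.mem_span_singleton_self t
    simp only [map_mul, map_add, map_pow, branchEval_ofBranch, ht0, zero_mul, pow_succ, mul_zero,
      add_zero] at h2
    rw [eq_comm, algebraMap_branchQuotient, toBranchQuotient_eq_zero, pow_one] at h2
    exact (IsLocalization.AtPrime.to_map_mem_maximal_iff (Localization.AtPrime z) z a).1 h2
  rw [hzt] at h1
  obtain ⟨a', rfl⟩ := Ideal.mem_span_singleton'.1 h1
  refine ⟨a', sub_eq_zero.1 (ofBranch_mul_injective ht he ?_)⟩
  rw [mul_sub, h, map_mul]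
  ring

omit ht in
-- The cyclic module generated by `1` is open in the quotient of index `s`, and the kernel of
-- evaluation there consists of the multiples of `t ^ s`.
theorem isOpen_range_ofBranch_add [IsLocalRing O] [TopologicalSpace O] [IsTopologicalAddGroup O]
    (hO : HasAdicOpenSubgroups O) (hz : IsBranch z) (hzt : z = Ideal.span {t}) (s : ℕ) :
    ∃ W ∈ 𝓝 (0 : BranchCompletion z), ∀ b ∈ W, ∃ a c, b = ofBranch z a + ofBranch z t ^ s * c := by
  refine ⟨{b | branchEval z s b ∈ cyclicPow O 1 0}, (mem_nhds_zero_branchCompletion hO).2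
    ⟨s, (cyclicPow O 1 0).toAddSubgroup, (hz.cofiniteCyclic s).isOpen_cyclicPow hO 0,
      fun b hb => hb⟩, fun b hb => ?_⟩
  obtain ⟨a, -, ha⟩ := mem_cyclicPow.1 hb
  have h1 : branchEval z s (b - ofBranch z a) = 0 := by
    rw [map_sub, branchEval_ofBranch, ← ha, Algebra.smul_def, mul_one, sub_self]
  obtain ⟨c, hc⟩ := (branchEval_eq_zero_iff hzt).1 h1
  exact ⟨a, c, by rw [← hc]; ring⟩

end BranchUniformizer

/-! ## Branches in the completion of a local ring -/

section LocalCompletion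

variable (R : Type*) [CommRing R] [IsLocalRing R]

/-- The completion of a local ring. -/
abbrev LocalCompletion : Type _ := AdicCompletion (IsLocalRing.maximalIdeal R) R

/-- The topology of the completion of a local ring. -/
@[reducible] def localCompletionTopology : TopologicalSpace (LocalCompletion R) :=
  letI : TopologicalSpace R := (IsLocalRing.maximalIdeal R).adicTopology
  completionTopology R (IsLocalRing.maximalIdeal R)

theorem isTopologicalAddGroup_localCompletion :
    @IsTopologicalAddGroup _ (localCompletionTopology R) _ :=
  isTopologicalAddGroup_linear _

variable [IsNoetherianRing R]

instance : IsNoetherianRing (LocalCompletion R) := isNoetherianRing_adicCompletion _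

theorem ker_evalₐ_maximalIdeal {n : ℕ} {a : LocalCompletion R} :
    AdicCompletion.evalₐ (IsLocalRing.maximalIdeal R) n a = 0 ↔
      a ∈ IsLocalRing.maximalIdeal (LocalCompletion R) ^ n := by
  rw [AdicCompletion.maximalIdeal_eq_map, ← Ideal.map_pow]
  constructor
  · intro h
    have h1 : a ∈ (AdicCompletion.eval (IsLocalRing.maximalIdeal R) R n).ker := by
      rw [LinearMap.mem_ker, ← AdicCompletion.factor_evalₐ_eq_eval _ a (Ideal.mul_top _).symm.le, h,
        map_zero]
    rw [← AdicCompletion.pow_smul_top_eq_ker_eval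
      (IsLocalRing.maximalIdeal R).fg_of_isNoetherianRing] at h1
    rw [Ideal.smul_top_eq_map] at h1
    exact h1
  · intro h
    have h1 : (IsLocalRing.maximalIdeal R ^ n).map (algebraMap R (LocalCompletion R)) ≤
        RingHom.ker (AdicCompletion.evalₐ (IsLocalRing.maximalIdeal R) n) := by
      rw [Ideal.map_le_iff_le_comap]
      intro r hr
      rw [Ideal.mem_comap, RingHom.mem_ker]
      exact (AdicCompletion.evalₐ_of _ n r).trans (Ideal.Quotient.eq_zero_iff_mem.2 hr)
    exact h1 h

/-- The fine topology on `R ⧸ 𝔪 ^ r` is discrete, being killed by `𝔪 ^ r`; so the linear limit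
topology is the adic topology of the maximal ideal of the completion. -/
theorem hasAdicOpenSubgroups_localCompletion :
    @HasAdicOpenSubgroups (LocalCompletion R) _ _ (localCompletionTopology R) := by
  let _ : TopologicalSpace R := (IsLocalRing.maximalIdeal R).adicTopology
  have _ : NonarchimedeanRing R := (IsLocalRing.maximalIdeal R).nonarchimedean
  let _ := localCompletionTopology R
  have _ : IsTopologicalAddGroup (LocalCompletion R) := isTopologicalAddGroup_localCompletion R
  let T (r : ℕ) : TopologicalSpace (R ⧸ IsLocalRing.maximalIdeal R ^ r) := fineModuleTopology R _
  have hT : ∀ r, NonarchimedeanAddGroup (R ⧸ IsLocalRing.maximalIdeal R ^ r) :=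
    fun r => nonarchimedean_linear _
  have hd : ∀ r, 𝓝 (0 : R ⧸ IsLocalRing.maximalIdeal R ^ r) = 𝓟 {0} := by
    intro r
    refine le_antisymm ?_ (principal_le_iff.2 fun V hV => by simpa using mem_of_mem_nhds hV)
    rw [le_principal_iff, mem_nhds_zero_linearFinal]
    refine ⟨⊥, fun x => isOpen_subgroup_of_mem_nhds ?_, subset_rfl⟩
    refine ((IsLocalRing.maximalIdeal R).hasBasis_nhds_zero_adic.mem_iff).2 ⟨r, trivial, ?_⟩
    intro a ha
    obtain ⟨x, rfl⟩ := Ideal.Quotient.mk_surjective x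
    change a • Ideal.Quotient.mk _ x = 0
    rw [Algebra.smul_def]
    change Ideal.Quotient.mk _ a * _ = _
    rw [Ideal.Quotient.eq_zero_iff_mem.2 ha, zero_mul]
  have h0 : 𝓝 (0 : LocalCompletion R) =
      ⨅ r, 𝓟 ((IsLocalRing.maximalIdeal (LocalCompletion R) ^ r : Ideal _) : Set _) := by
    refine (nhds_zero_linearInitial (f := fun r : ℕ =>
      ((AdicCompletion.evalₐ (IsLocalRing.maximalIdeal R) r :
        LocalCompletion R →+* R ⧸ IsLocalRing.maximalIdeal R ^ r) :
        LocalCompletion R →+ R ⧸ IsLocalRing.maximalIdeal R ^ r))).trans ?_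
    refine iInf_congr fun r => ?_
    rw [hd, comap_principal]
    congr 1
    ext a
    exact ker_evalₐ_maximalIdeal R
  intro U
  constructor
  · intro hU
    have h1 := hU.mem_nhds (zero_mem U)
    rw [h0, mem_iInf_of_directed] at h1
    · obtain ⟨k, hk⟩ := h1
      exact ⟨k, fun a ha => hk ha⟩
    · refine Antitone.directed_ge fun m n h => ?_
      exact principal_mono.2 (Ideal.pow_le_pow_right h)
  · rintro ⟨k, hk⟩
    refine isOpen_subgroup_of_mem_nhds ?_
    rw [h0]
    exact mem_iInf_of_mem k hk

end LocalCompletion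

/-! ### Primes of the completion over a given prime -/

section Branches

variable {R : Type*} [CommRing R] [IsLocalRing R] [IsNoetherianRing R] {p : Ideal R} [p.IsPrime]

theorem maximalIdeal_le_of_maximalIdeal_le_comap {q : Ideal (LocalCompletion R)}
    (h : IsLocalRing.maximalIdeal R ≤ q.comap (algebraMap R (LocalCompletion R))) :
    IsLocalRing.maximalIdeal (LocalCompletion R) ≤ q := by
  rw [AdicCompletion.maximalIdeal_eq_map]
  exact Ideal.map_le_iff_le_comap.2 h

/-- If there are no primes between `p` and the maximal ideal, then there are no primes between a
branch of `p` and the maximal ideal of the completion. -/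
theorem eq_or_eq_maximalIdeal_of_le (hpm : p ≠ IsLocalRing.maximalIdeal R)
    (hp : ∀ q : Ideal R, q.IsPrime → p ≤ q → q = p ∨ q = IsLocalRing.maximalIdeal R)
    {z : Ideal (LocalCompletion R)} [z.IsPrime]
    (hz : z.comap (algebraMap R (LocalCompletion R)) = p) (q : Ideal (LocalCompletion R))
    (hq : q.IsPrime) (hzq : z ≤ q) :
    q = z ∨ q = IsLocalRing.maximalIdeal (LocalCompletion R) := by
  by_contra! hcon
  obtain ⟨hne, hqm⟩ := hcon
  have hqp : q.comap (algebraMap R (LocalCompletion R)) = p := by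
    refine (hp _ inferInstance (hz ▸ Ideal.comap_mono hzq)).resolve_right fun h => hqm ?_
    exact le_antisymm (IsLocalRing.le_maximalIdeal hq.ne_top)
      (maximalIdeal_le_of_maximalIdeal_le_comap h.ge)
  obtain ⟨g, hgm, hgp⟩ := SetLike.exists_of_lt
    (lt_of_le_of_ne (IsLocalRing.le_maximalIdeal (Ideal.IsPrime.ne_top inferInstance)) hpm)
  let M := IsLocalRing.maximalIdeal (LocalCompletion R)
  have hzM : z ≤ M := IsLocalRing.le_maximalIdeal (Ideal.IsPrime.ne_top inferInstance)
  have hqM : q < M := lt_of_le_of_ne (IsLocalRing.le_maximalIdeal hq.ne_top) hqm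
  have hgM : algebraMap R (LocalCompletion R) g ∈ M := by
    rw [show M = _ from AdicCompletion.maximalIdeal_eq_map]
    exact Ideal.mem_map_of_mem _ hgm
  -- A prime containing `z` and `g` contracts to a prime containing `p` and `g ∉ p`, hence to the
  -- maximal ideal of `R`, and therefore contains `M`.
  have hmin : M ∈ (z ⊔ Ideal.span {algebraMap R (LocalCompletion R) g}).minimalPrimes := by
    refine ⟨⟨inferInstance, sup_le hzM ((Ideal.span_singleton_le_iff_mem _).2 hgM)⟩, ?_⟩
    rintro Q ⟨hQ, hQ'⟩ -
    refine maximalIdeal_le_of_maximalIdeal_le_comap (Eq.ge ?_)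
    refine (hp _ inferInstance (hz ▸ Ideal.comap_mono (le_sup_left.trans hQ'))).resolve_left ?_
    intro h
    refine hgp (h ▸ ?_)
    exact hQ' (Ideal.mem_sup_right (Ideal.mem_span_singleton_self _))
  have hM1 := Ideal.map_height_le_one_of_mem_minimalPrimes hmin
  let f := Ideal.Quotient.mk z
  have hsurj : Function.Surjective f := Ideal.Quotient.mk_surjective
  have hker : ∀ {I : Ideal (LocalCompletion R)}, z ≤ I → (I.map f).comap f = I := fun {I} hI => by
    rw [Ideal.comap_map_of_surjective f hsurj, ← RingHom.ker_eq_comap_bot, Ideal.mk_ker]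
    exact sup_eq_left.2 hI
  have hq' : (q.map f).IsPrime := Ideal.map_isPrime_of_surjective hsurj (by rwa [Ideal.mk_ker])
  have hM' : (M.map f).IsPrime := Ideal.map_isPrime_of_surjective hsurj (by rwa [Ideal.mk_ker])
  have h1 : q.map f < M.map f := by
    refine lt_of_le_of_ne (Ideal.map_mono hqM.le) fun h => hqM.ne ?_
    rw [← hker hzq, h, hker hzM]
  have h2 : ⊥ < q.map f := by
    refine bot_lt_iff_ne_bot.2 fun h => hne ?_
    rw [← hker hzq, h, ← RingHom.ker_eq_comap_bot, Ideal.mk_ker]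
  -- Modulo `z` the maximal ideal has height at most one by Krull's principal ideal theorem, which
  -- excludes the chain `0 < q < M`. No dimension theory of the completion is needed.
  have h3 := Ideal.height_add_one_le_of_lt_of_isPrime h1
  have h4 := Ideal.height_add_one_le_of_lt_of_isPrime h2
  have h5 : (1 + 1 : ℕ∞) ≤ 1 :=
    (add_le_add_left (le_add_self.trans h4) 1).trans (h3.trans hM1)
  exact absurd h5 (by decide)

/-- A prime containing `c` and `z ^ n` contains `z` strictly, hence is maximal; in a noetherian ring
a power of the radical lies in the ideal. -/
theorem isBranch_of_comap_eq (hpm : p ≠ IsLocalRing.maximalIdeal R)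
    (hp : ∀ q : Ideal R, q.IsPrime → p ≤ q → q = p ∨ q = IsLocalRing.maximalIdeal R)
    {z : Ideal (LocalCompletion R)} [z.IsPrime]
    (hz : z.comap (algebraMap R (LocalCompletion R)) = p) : IsBranch z := by
  intro c hc n
  refine Ideal.exists_pow_le_of_le_radical_of_fg ?_ (Ideal.fg_of_isNoetherianRing _)
  rw [Ideal.radical_eq_sInf]
  refine le_sInf fun q ⟨hq, hq'⟩ => ?_
  have hzq : z ≤ q := by
    intro a ha
    exact hq'.mem_of_pow_mem n (hq (Ideal.mem_sup_right (Ideal.pow_mem_pow ha n)))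
  refine ((eq_or_eq_maximalIdeal_of_le hpm hp hz q hq' hzq).resolve_left ?_).ge
  rintro rfl
  exact hc (hq (Ideal.mem_sup_left (Ideal.mem_span_singleton_self c)))

/-- A generator of the maximal ideal of `R` localised at `p` generates an ideal that contains a
power of the maximal ideal in the localisation of the completion at a branch. -/
theorem exists_maximalIdeal_pow_le_span (hpm : p ≠ IsLocalRing.maximalIdeal R)
    (hp : ∀ q : Ideal R, q.IsPrime → p ≤ q → q = p ∨ q = IsLocalRing.maximalIdeal R)
    {z : Ideal (LocalCompletion R)} [z.IsPrime]
    (hz : z.comap (algebraMap R (LocalCompletion R)) = p) {t : R}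
    (ht : ∀ a ∈ p, ∃ s ∉ p, t ∣ s * a) :
    ∃ e, IsLocalRing.maximalIdeal (Localization.AtPrime z) ^ e ≤
      Ideal.span {algebraMap _ _ (algebraMap R (LocalCompletion R) t)} := by
  have : IsNoetherianRing (Localization.AtPrime z) :=
    IsLocalization.isNoetherianRing z.primeCompl _ inferInstance
  refine Ideal.exists_pow_le_of_le_radical_of_fg ?_ (Ideal.fg_of_isNoetherianRing _)
  rw [Ideal.radical_eq_sInf]
  refine le_sInf fun Q ⟨hQ, hQ'⟩ => ?_
  have htQ : t ∈ (Q.comap (algebraMap _ _)).comap (algebraMap R (LocalCompletion R)) :=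
    hQ (Ideal.mem_span_singleton_self _)
  have hQz : Q.comap (algebraMap (LocalCompletion R) _) ≤ z := by
    intro a ha
    refine (IsLocalization.AtPrime.to_map_mem_maximal_iff (Localization.AtPrime z) z a).1 ?_
    exact IsLocalRing.le_maximalIdeal hQ'.ne_top ha
  -- Containing `t`, the prime `Q` contracts to a prime containing all of `p`, and to no more
  -- because it lies below `z`.
  have hQp : (Q.comap (algebraMap _ _)).comap (algebraMap R (LocalCompletion R)) = p := by
    refine le_antisymm (hz ▸ Ideal.comap_mono hQz) fun a ha => ?_
    obtain ⟨s, hs, b, hb⟩ := ht a ha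
    have h1 := Ideal.mul_mem_right b _ htQ
    rw [← hb] at h1
    refine (Ideal.IsPrime.mem_or_mem inferInstance h1).resolve_left fun h2 => hs ?_
    rw [← hz]
    exact hQz h2
  -- The contraction of `Q` is thus itself a branch of `p`, and nothing lies strictly between it and
  -- the maximal ideal, so `z` must equal it.
  have hzQ : z = Q.comap (algebraMap (LocalCompletion R) _) := by
    refine (eq_or_eq_maximalIdeal_of_le hpm hp hQp z inferInstance hQz).resolve_right fun h => ?_
    refine hpm (hz.symm.trans ?_)
    rw [h]
    have hl : IsLocalHom (algebraMap R (LocalCompletion R)) := inferInstance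
    exact ((IsLocalRing.local_hom_TFAE (algebraMap R (LocalCompletion R))).out 0 4).1 hl
  rw [← Localization.AtPrime.map_eq_maximalIdeal, Ideal.map_le_iff_le_comap]
  exact hzQ.le

/-- A nonzero element of the domain `R` stays regular under the flat extensions to the completion
and to its localisation. -/
theorem localization_mul_eq_zero [IsDomain R] {z : Ideal (LocalCompletion R)} [z.IsPrime] {t : R}
    (ht : t ≠ 0) (b : Localization.AtPrime z)
    (hb : algebraMap _ _ (algebraMap R (LocalCompletion R) t) * b = 0) : b = 0 := by
  have : Module.Flat (LocalCompletion R) (Localization.AtPrime z) :=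
    IsLocalization.flat _ z.primeCompl
  have h1 : IsSMulRegular R t := IsSMulRegular.of_ne_zero ht
  have h2 := (IsSMulRegular.of_flat (S := LocalCompletion R) h1).of_flat
    (S := Localization.AtPrime z)
  refine h2 ?_
  simpa using hb

omit [IsLocalRing R] [IsNoetherianRing R] in
theorem span_pair_pow_le (t π : R) (n : ℕ) :
    Ideal.span {t, π} ^ n ≤ Ideal.span {t} ⊔ Ideal.span {π ^ n} := by
  induction n with
  | zero => simp
  | succ n ih =>
    rw [pow_succ]
    refine (Ideal.mul_mono ih (Ideal.span_insert _ _).le).trans ?_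
    have h1 : Ideal.span {π ^ n} * Ideal.span {π} = Ideal.span {π ^ (n + 1)} := by
      rw [Ideal.span_singleton_mul_span_singleton, pow_succ]
    rw [Ideal.sup_mul, Ideal.mul_sup (Ideal.span {π ^ n}), h1]
    refine sup_le ?_ (sup_le ?_ ?_)
    · exact le_trans Ideal.mul_le_left le_sup_left
    · exact le_trans Ideal.mul_le_right le_sup_left
    · exact le_sup_right

/-- Modulo `t` every nonzero element of the completion is a unit times a power of `π`, and `π ∉ z`;
so `z` contains nothing beyond the multiples of `t`. -/
theorem branch_eq_span {t π : R} (hpt : p = Ideal.span {t})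
    (hm : IsLocalRing.maximalIdeal R = Ideal.span {t, π}) (hpm : p ≠ IsLocalRing.maximalIdeal R)
    {z : Ideal (LocalCompletion R)} [z.IsPrime]
    (hz : z.comap (algebraMap R (LocalCompletion R)) = p) :
    z = Ideal.span {algebraMap R (LocalCompletion R) t} := by
  let M := IsLocalRing.maximalIdeal (LocalCompletion R)
  let T := Ideal.span {algebraMap R (LocalCompletion R) t}
  have hTz : T ≤ z := by
    rw [Ideal.span_singleton_le_iff_mem, ← Ideal.mem_comap, hz, hpt]
    exact Ideal.mem_span_singleton_self t
  have hM : M = Ideal.span {algebraMap R (LocalCompletion R) t, algebraMap R _ π} := by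
    refine AdicCompletion.maximalIdeal_eq_map.trans ?_
    refine (congrArg (Ideal.map (algebraMap R (LocalCompletion R))) hm).trans ?_
    rw [Ideal.map_span, Set.image_pair]
  have hpow : ∀ n, M ^ n ≤ T ⊔ Ideal.span {algebraMap R _ π ^ n} := by
    intro n
    rw [hM]
    exact span_pair_pow_le _ _ n
  have hπ : algebraMap R (LocalCompletion R) π ∉ z := by
    intro h
    rw [← Ideal.mem_comap, hz] at h
    refine hpm (le_antisymm (IsLocalRing.le_maximalIdeal (Ideal.IsPrime.ne_top inferInstance)) ?_)
    rw [hm, Ideal.span_le]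
    rintro x (rfl | rfl)
    · rw [hpt]
      exact Ideal.mem_span_singleton_self _
    · exact h
  refine le_antisymm (fun a ha => ?_) hTz
  by_contra hat
  -- Krull's intersection theorem in the quotient by `t`; the least such `n` measures the order of
  -- `a` along `π`.
  have hex : ∃ n, a ∉ T ⊔ M ^ n := by
    by_contra! hall
    refine hat (Ideal.Quotient.eq_zero_iff_mem.1 ?_)
    refine IsHausdorff.haus' (I := M) _ fun n => ?_
    rw [SModEq.zero]
    obtain ⟨b, hb, c, hc, rfl⟩ := Submodule.mem_sup.1 (hall n)
    rw [map_add, Ideal.Quotient.eq_zero_iff_mem.2 hb, zero_add]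
    have : Ideal.Quotient.mk T c = c • 1 := by
      rw [Algebra.smul_def, mul_one]
      rfl
    rw [this]
    exact Submodule.smul_mem_smul hc trivial
  classical
  obtain ⟨n, hn⟩ : ∃ n, Nat.find hex = n + 1 := by
    refine Nat.exists_eq_succ_of_ne_zero fun h => ?_
    have := Nat.find_spec hex
    rw [h, pow_zero, Ideal.one_eq_top] at this
    exact this (by simp)
  have h1 : a ∉ T ⊔ M ^ (n + 1) := hn ▸ Nat.find_spec hex
  have h2 : a ∈ T ⊔ M ^ n := not_not.1 (Nat.find_min hex (by omega))
  have h3 : a ∈ T ⊔ Ideal.span {algebraMap R _ π ^ n} :=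
    sup_le le_sup_left (hpow n) h2
  obtain ⟨b, hb, c, hc, rfl⟩ := Submodule.mem_sup.1 h3
  obtain ⟨d, rfl⟩ := Ideal.mem_span_singleton'.1 hc
  -- Otherwise `a` would lie one step deeper in the filtration, against the choice of `n`. So `d` is
  -- a unit and `π ^ n ∈ z`.
  have hd : d ∉ M := by
    intro hd
    refine h1 (add_mem (Ideal.mem_sup_left hb) (Ideal.mem_sup_right ?_))
    rw [pow_succ']
    refine Ideal.mul_mem_mul hd (Ideal.pow_mem_pow ?_ n)
    rw [hM]
    exact Ideal.subset_span (by simp)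
  have hdu : IsUnit d := by
    by_contra h
    exact hd h
  have h4 : d * algebraMap R (LocalCompletion R) π ^ n ∈ z := by
    have := sub_mem ha (hTz hb)
    rwa [add_sub_cancel_left] at this
  rcases Ideal.IsPrime.mem_or_mem inferInstance h4 with h5 | h5
  · exact Ideal.IsPrime.ne_top inferInstance (Ideal.eq_top_of_isUnit_mem _ h5 hdu)
  · exact hπ (Ideal.IsPrime.mem_of_pow_mem inferInstance _ h5)

end Branches

/-! ## Adeles along a curve -/

section CurveAdeles

variable {X : Scheme.{0}} {y : Curve X}

instance {x : X} {y : X} {h : y ⤳ x} (z : Branch h) : NonarchimedeanAddGroup (BranchRing z) :=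
  nonarchimedean_linear _

instance (s : ℕ) : NonarchimedeanAddGroup (IntegralLevel y s) := nonarchimedean_linear _

instance : NonarchimedeanAddGroup (IntegralAdele y) := nonarchimedean_linear _

instance (t : CompletedLocalRing X y.1) : NonarchimedeanAddGroup (CurveAdele t) :=
  nonarchimedean_linear _

/-- The image of `t` in the ring `𝒪_{x,y}`. -/
def flagUniformizer (t : CompletedLocalRing X y.1) (x : y.Point) : FlagRing x :=
  fun z => genericToBranchRing z t

/-- The properties of the rings `𝒪_{x,y}`, topological and for almost all `x`, that determine
the topology of the adeles along `y`. -/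
structure FlagConditions (t : CompletedLocalRing X y.1) : Prop where
  ultraComplete : ∀ x : y.Point, UltraComplete (FlagRing x)
  exists_nsmul_mem : ∀ (x : y.Point) (W : Set (FlagRing x)), W ∈ 𝓝 0 →
    ∀ b : FlagRing x, ∃ n : ℕ, n > 0 ∧ n • b ∈ W
  continuous_mul : ∀ x : y.Point, Continuous fun b => flagUniformizer t x * b
  eq_zero_of_mul : ∀ (x : y.Point) (z : Branch x.2.2) (b : BranchRing z),
    genericToBranchRing z t * b = 0 → b = 0
  exists_nhds_of_mul : ∀ (x : y.Point) (W : Set (FlagRing x)), W ∈ 𝓝 0 →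
    ∃ W' ∈ 𝓝 (0 : FlagRing x), ∀ b, flagUniformizer t x * b ∈ W' → b ∈ W
  eventually_isOpen : ∀ s, ∀ᶠ x : y.Point in cofinite, IsOpen (flagSubgroup s x : Set (FlagRing x))
  eventually_mul_mem : ∀ s, ∀ᶠ x : y.Point in cofinite, ∀ b ∈ flagSubgroup s x,
    flagUniformizer t x * b ∈ flagSubgroup s x
  eventually_mem_of_mul : ∀ s, ∀ᶠ x : y.Point in cofinite, ∀ b,
    flagUniformizer t x * b ∈ flagSubgroup (s + 1) x → b ∈ flagSubgroup s x

theorem flagSubgroup_antitone (x : y.Point) : Antitone fun s => flagSubgroup s x := by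
  intro s s' h
  refine sup_le_sup_left ?_ _
  exact fun a ha => Ideal.pow_le_pow_right h ha

theorem IntegralAdele.ext {a b : IntegralAdele y}
    (h : ∀ x, IntegralAdele.coord y a x = IntegralAdele.coord y b x) : a = b :=
  Subtype.ext (funext h)

theorem IntegralAdele.eventually_mem (a : IntegralAdele y) (s : ℕ) :
    ∀ᶠ x in cofinite, IntegralAdele.coord y a x ∈ flagSubgroup s x :=
  (AddSubgroup.mem_iInf.1 a.2 s :)

/-- An element of `𝔸_y^{(0)}` given by its coordinates. -/
def IntegralAdele.mk (a : ∀ x : y.Point, FlagRing x)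
    (h : ∀ s, ∀ᶠ x in cofinite, a x ∈ flagSubgroup s x) : IntegralAdele y :=
  ⟨a, AddSubgroup.mem_iInf.2 h⟩

theorem IntegralAdele.coord_mk (a : ∀ x : y.Point, FlagRing x)
    (h : ∀ s, ∀ᶠ x in cofinite, a x ∈ flagSubgroup s x) (x : y.Point) :
    IntegralAdele.coord y (IntegralAdele.mk a h) x = a x := rfl

theorem nhds_zero_integralAdele :
    𝓝 (0 : IntegralAdele y) = ⨅ s, comap (IntegralAdele.toLevel y s) (𝓝 0) :=
  nhds_zero_linearInitial (f := IntegralAdele.toLevel y)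

/-- The neighbourhoods of zero in `𝔸_y^{(0)}{s}`. -/
theorem exists_of_mem_nhds_integralLevel {s : ℕ} {V : Set (IntegralLevel y s)} (hV : V ∈ 𝓝 0)
    (S : Finset y.Point) : ∃ (T : Finset y.Point) (W : ∀ x : y.Point, AddSubgroup (FlagRing x)),
      (∀ x, IsOpen (W x : Set (FlagRing x))) ∧ ∀ b : IntegralLevel y s,
        (∀ x ∉ S, RestrictedProd.coord b x ∈ flagSubgroup s x) →
        (∀ x ∈ T, RestrictedProd.coord b x ∈ W x) → b ∈ V := by
  obtain ⟨U, hU, hUV⟩ := (mem_nhds_zero_linearFinal _).1 hV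
  have h1 := (hU S).mem_nhds (zero_mem _)
  rw [nhds_subtype_eq_comap] at h1
  obtain ⟨A, hA, hAU⟩ := h1
  rw [ZeroMemClass.coe_zero, nhds_pi, Filter.mem_pi] at hA
  obtain ⟨I, hI, W, hW, hIW⟩ := hA
  choose W' hW' hWW' using fun x => exists_open_subgroup_subset (hW x)
  refine ⟨hI.toFinset, W', hW', fun b hb hbW => hUV ?_⟩
  exact hAU (show (⟨RestrictedProd.coord b, hb⟩ : restrictedLevel _ _ S) ∈ Subtype.val ⁻¹' A from
    hIW fun x hx => hWW' x (hbW x (hI.mem_toFinset.2 hx)))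

/-- Openness of the subgroups outside `S` is essential: on a larger level `S'` the coordinates in
`S' \ S` are otherwise unconstrained. -/
theorem mem_nhds_integralLevel {s : ℕ} {S : Finset y.Point}
    (hS : ∀ x ∉ S, IsOpen (flagSubgroup s x : Set (FlagRing x))) (T : Finset y.Point)
    {W : ∀ x : y.Point, AddSubgroup (FlagRing x)} (hW : ∀ x, IsOpen (W x : Set (FlagRing x))) :
    {b : IntegralLevel y s | (∀ x ∉ S, RestrictedProd.coord b x ∈ flagSubgroup s x) ∧
      ∀ x ∈ T, RestrictedProd.coord b x ∈ W x} ∈ 𝓝 0 := by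
  classical
  let U : AddSubgroup (IntegralLevel y s) :=
    { carrier := {b | (∀ x ∉ S, RestrictedProd.coord b x ∈ flagSubgroup s x) ∧
        ∀ x ∈ T, RestrictedProd.coord b x ∈ W x}
      zero_mem' := ⟨fun x _ => zero_mem _, fun x _ => zero_mem _⟩
      add_mem' := fun ha hb => ⟨fun x hx => add_mem (ha.1 x hx) (hb.1 x hx),
        fun x hx => add_mem (ha.2 x hx) (hb.2 x hx)⟩
      neg_mem' := fun ha => ⟨fun x hx => neg_mem (ha.1 x hx), fun x hx => neg_mem (ha.2 x hx)⟩ }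
  refine (mem_nhds_zero_linearFinal _).2 ⟨U, fun S' => ?_, subset_rfl⟩
  refine isOpen_subgroup_of_mem_nhds ?_
  have h1 : ∀ x ∈ S' \ S, ∀ᶠ b : restrictedLevel (FlagRing (y := y)) (flagSubgroup s) S' in 𝓝 0,
      b.1 x ∈ flagSubgroup s x := fun x hx =>
    ((continuous_apply x).comp continuous_subtype_val).continuousAt
      ((hS x (Finset.mem_sdiff.1 hx).2).mem_nhds (zero_mem _))
  have h2 : ∀ x ∈ T, ∀ᶠ b : restrictedLevel (FlagRing (y := y)) (flagSubgroup s) S' in 𝓝 0,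
      b.1 x ∈ W x := fun x _ =>
    ((continuous_apply x).comp continuous_subtype_val).continuousAt
      ((hW x).mem_nhds (zero_mem _))
  filter_upwards [(Finset.eventually_all _).2 h1, (Finset.eventually_all _).2 h2] with b hb1 hb2
  refine ⟨fun x hx => ?_, hb2⟩
  by_cases hxS : x ∈ S'
  · exact hb1 x (Finset.mem_sdiff.2 ⟨hxS, hx⟩)
  · exact b.2 x hxS

theorem tendsto_integralLevel {s s' : ℕ} (h : s ≤ s') :
    comap (IntegralAdele.toLevel y s') (𝓝 0) ≤ comap (IntegralAdele.toLevel y s) (𝓝 0) := by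
  have h1 : restrictedSubgroup (FlagRing (y := y)) (flagSubgroup s') ≤
      restrictedSubgroup (FlagRing (y := y)) (flagSubgroup s) := fun a ha =>
    Eventually.mono (f := cofinite) ha fun x hx => flagSubgroup_antitone x h hx
  let i : IntegralLevel y s' →+ IntegralLevel y s := AddSubgroup.inclusion h1
  have hi : Continuous i := by
    refine continuous_of_linearFinal _ i fun S => ?_
    let j : restrictedLevel (FlagRing (y := y)) (flagSubgroup s') S →
        restrictedLevel (FlagRing (y := y)) (flagSubgroup s) S :=
      fun b => ⟨b.1, fun x hx => flagSubgroup_antitone x h (b.2 x hx)⟩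
    have hj : Continuous j := continuous_subtype_val.subtype_mk _
    let f (S : Finset y.Point) : restrictedLevel (FlagRing (y := y)) (flagSubgroup s) S →+
        IntegralLevel y s := restrictedLevelHom (FlagRing (y := y)) (flagSubgroup s) S
    exact (continuous_linearFinal (f := f) S).comp hj
  have h2 := hi.tendsto 0
  rw [map_zero] at h2
  have h3 : (IntegralAdele.toLevel y s : IntegralAdele y → _) = i ∘ IntegralAdele.toLevel y s' :=
    rfl
  rw [h3, ← comap_comap]
  exact comap_mono h2.le_comap

/-- The neighbourhoods of zero in `𝔸_y^{(0)}`. -/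
theorem exists_of_mem_nhds_integralAdele {V : Set (IntegralAdele y)} (hV : V ∈ 𝓝 0) :
    ∃ s, ∀ S : Finset y.Point,
      ∃ (T : Finset y.Point) (W : ∀ x : y.Point, AddSubgroup (FlagRing x)),
      (∀ x, IsOpen (W x : Set (FlagRing x))) ∧ ∀ b : IntegralAdele y,
        (∀ x ∉ S, IntegralAdele.coord y b x ∈ flagSubgroup s x) →
        (∀ x ∈ T, IntegralAdele.coord y b x ∈ W x) → b ∈ V := by
  rw [nhds_zero_integralAdele, mem_iInf_of_directed
    (Antitone.directed_ge fun _ _ h => tendsto_integralLevel h)] at hV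
  obtain ⟨s, V', hV', hVV'⟩ := hV
  refine ⟨s, fun S => ?_⟩
  obtain ⟨T, W, hW, h⟩ := exists_of_mem_nhds_integralLevel hV' S
  exact ⟨T, W, hW, fun b h1 h2 => hVV' (h (IntegralAdele.toLevel y s b) h1 h2)⟩

theorem mem_nhds_integralAdele {s : ℕ} {S : Finset y.Point}
    (hS : ∀ x ∉ S, IsOpen (flagSubgroup s x : Set (FlagRing x))) (T : Finset y.Point)
    {W : ∀ x : y.Point, Set (FlagRing x)} (hW : ∀ x, W x ∈ 𝓝 0) :
    {b : IntegralAdele y | (∀ x ∉ S, IntegralAdele.coord y b x ∈ flagSubgroup s x) ∧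
      ∀ x ∈ T, IntegralAdele.coord y b x ∈ W x} ∈ 𝓝 0 := by
  choose W' hW' hWW' using fun x => exists_open_subgroup_subset (hW x)
  rw [nhds_zero_integralAdele]
  refine mem_iInf_of_mem s ⟨_, mem_nhds_integralLevel hS T hW', fun b hb => ?_⟩
  exact ⟨hb.1, fun x hx => hWW' x (hb.2 x hx)⟩

theorem continuous_coord (x : y.Point) (hs : ∃ s, ∀ᶠ x : y.Point in cofinite,
    IsOpen (flagSubgroup s x : Set (FlagRing x))) :
    Continuous fun b : IntegralAdele y => IntegralAdele.coord y b x := by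
  obtain ⟨s, hs⟩ := hs
  let f : IntegralAdele y →+ FlagRing x :=
    (Pi.evalAddMonoidHom (fun x : y.Point => FlagRing x) x).comp (IntegralAdele.coord y)
  refine continuous_of_continuousAt_zero f ?_
  intro W hW
  rw [map_zero] at hW
  have hfin : {x : y.Point | ¬ IsOpen (flagSubgroup s x : Set (FlagRing x))}.Finite := hs
  obtain ⟨W', hW', hWW'⟩ := exists_open_subgroup_subset hW
  classical
  let Wf : ∀ x' : y.Point, Set (FlagRing x') := Function.update (fun _ => Set.univ) x W
  refine mem_map.2 (mem_of_superset (mem_nhds_integralAdele (s := s) (S := insert x hfin.toFinset) (W := Wf)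
    (fun x' hx' => ?_) {x} fun x' => ?_) fun b hb => ?_)
  · by_contra h
    exact hx' (Finset.mem_insert_of_mem (hfin.mem_toFinset.2 h))
  · by_cases h : x' = x
    · subst h
      simpa [Wf] using hW
    · simp [Wf, h]
  · have := hb.2 x (Finset.mem_singleton_self x)
    change IntegralAdele.coord y b x ∈ W
    simpa [Wf] using this

end CurveAdeles

/-! ### Topology of the adeles along a curve from local conditions -/

section CurveAdeles

variable {X : Scheme.{0}} {y : Curve X} {t : CompletedLocalRing X y.1} (ht : FlagConditions t)

include ht

theorem FlagConditions.exists_finset (s : ℕ) : ∃ S : Finset y.Point, ∀ x ∉ S,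
    IsOpen (flagSubgroup s x : Set (FlagRing x)) ∧
    IsOpen (flagSubgroup (s + 1) x : Set (FlagRing x)) ∧
    (∀ b ∈ flagSubgroup s x, flagUniformizer t x * b ∈ flagSubgroup s x) ∧
    ∀ b, flagUniformizer t x * b ∈ flagSubgroup (s + 1) x → b ∈ flagSubgroup s x := by
  have h := (ht.eventually_isOpen s).and ((ht.eventually_isOpen (s + 1)).and
    ((ht.eventually_mul_mem s).and (ht.eventually_mem_of_mul s)))
  rw [eventually_cofinite] at h
  exact ⟨h.toFinset, fun x hx => not_not.1 fun hn => hx (h.mem_toFinset.2 hn)⟩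

/-- Multiplication by `t` on `𝔸_y^{(0)}`. -/
def FlagConditions.mul : IntegralAdele y →+ IntegralAdele y where
  toFun b := IntegralAdele.mk (fun x => flagUniformizer t x * IntegralAdele.coord y b x)
    fun s => ((ht.eventually_mul_mem s).and (b.eventually_mem s)).mono fun _ h => h.1 _ h.2
  map_zero' := IntegralAdele.ext fun x => by
    rw [IntegralAdele.coord_mk, map_zero]
    exact mul_zero _
  map_add' a b := IntegralAdele.ext fun x => by
    rw [IntegralAdele.coord_mk, map_add, map_add]
    exact mul_add _ _ _

theorem FlagConditions.tendsto_mul : Tendsto ht.mul (𝓝 0) (𝓝 0) := by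
  intro V hV
  obtain ⟨s, hs⟩ := exists_of_mem_nhds_integralAdele hV
  obtain ⟨S, hS⟩ := ht.exists_finset s
  obtain ⟨T, W, hW, h⟩ := hs S
  have h1 : ∀ x, (fun b => flagUniformizer t x * b) ⁻¹' (W x) ∈ 𝓝 (0 : FlagRing x) := fun x => by
    refine (ht.continuous_mul x).continuousAt ?_
    rw [mul_zero]
    exact (hW x).mem_nhds (zero_mem _)
  refine mem_map.2 (mem_of_superset (mem_nhds_integralAdele (fun x hx => (hS x hx).1) T h1) ?_)
  intro b hb
  exact h _ (fun x hx => (hS x hx).2.2.1 _ (hb.1 x hx)) hb.2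

/-- Multiplication by `t` is an embedding for the topology. Dividing by `t` loses one power of the
radical, so the neighbourhood is taken at level `s + 1`. -/
theorem FlagConditions.exists_nhds_mul {V : Set (IntegralAdele y)} (hV : V ∈ 𝓝 0) :
    ∃ V' ∈ 𝓝 (0 : IntegralAdele y), ∀ b, ht.mul b ∈ V' → b ∈ V := by
  obtain ⟨s, hs⟩ := exists_of_mem_nhds_integralAdele hV
  obtain ⟨S, hS⟩ := ht.exists_finset s
  obtain ⟨T, W, hW, h⟩ := hs S
  choose W' hW' hWW' using fun x => ht.exists_nhds_of_mul x _ ((hW x).mem_nhds (zero_mem _))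
  exact ⟨_, mem_nhds_integralAdele (fun x hx => (hS x hx).2.1) T hW', fun b hb =>
    h _ (fun x hx => (hS x hx).2.2.2 _ (hb.1 x hx)) fun x hx => hWW' x _ (hb.2 x hx)⟩

theorem FlagConditions.continuous_coord (x : y.Point) :
    Continuous fun b : IntegralAdele y => IntegralAdele.coord y b x :=
  ArithAdele.continuous_coord x ⟨0, ht.eventually_isOpen 0⟩

/-- The coordinates converge separately. Comparison with one fixed approximation `a` for each `s`,
outside a finite set of points, puts the family of limits back into `𝔸_y^{(0)}`. -/
theorem FlagConditions.ultraComplete_integralAdele : UltraComplete (IntegralAdele y) := by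
  intro F hF
  have h1 : ∀ x : y.Point, ∃ g, Tendsto (fun b => IntegralAdele.coord y b x) F (𝓝 g) := fun x => by
    let f : IntegralAdele y →+ FlagRing x :=
      (Pi.evalAddMonoidHom (fun x : y.Point => FlagRing x) x).comp (IntegralAdele.coord y)
    have h2 : Tendsto f (𝓝 0) (𝓝 0) := by
      have := (ht.continuous_coord x).tendsto 0
      rwa [map_zero] at this
    exact ht.ultraComplete x (F.map f) (hF.map f h2)
  choose g hg using h1
  have h3 : ∀ s, ∃ S : Finset y.Point, ∃ a : IntegralAdele y, ∀ x ∉ S,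
      IsOpen (flagSubgroup s x : Set (FlagRing x)) ∧
      (∀ᶠ b in F, ∀ x ∉ S, IntegralAdele.coord y b x - IntegralAdele.coord y a x ∈
        flagSubgroup s x) ∧ g x - IntegralAdele.coord y a x ∈ flagSubgroup s x := by
    intro s
    obtain ⟨S, hS⟩ := ht.exists_finset s
    obtain ⟨a, ha⟩ := hF _ (mem_nhds_integralAdele (fun x hx => (hS x hx).1) ∅
      (W := fun _ => Set.univ) fun _ => univ_mem)
    refine ⟨S, a, fun x hx => ⟨(hS x hx).1, ha.mono fun b hb => hb.1, ?_⟩⟩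
    -- An open subgroup is closed, so the congruence with `a` passes to the limit.
    have hcl : IsClosed (flagSubgroup s x : Set (FlagRing x)) :=
      AddSubgroup.isClosed_of_isOpen _ (hS x hx).1
    exact hcl.mem_of_tendsto ((hg x).sub_const _) (ha.mono fun b hb => hb.1 x hx)
  let b : IntegralAdele y := IntegralAdele.mk g fun s => by
    obtain ⟨S, a, h⟩ := h3 s
    have hS : ∀ᶠ x in cofinite, x ∉ S := S.finite_toSet.compl_mem_cofinite
    filter_upwards [hS, a.eventually_mem s] with x hx ha
    have := add_mem (h x hx).2.2 ha
    rwa [sub_add_cancel] at this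
  refine ⟨b, le_nhds_iff_sub.2 fun V hV => mem_map.2 ?_⟩
  obtain ⟨s, hs⟩ := exists_of_mem_nhds_integralAdele hV
  obtain ⟨S, a, h⟩ := h3 s
  obtain ⟨T, W, hW, hTW⟩ := hs S
  have h4 : ∀ x ∈ T, ∀ᶠ c in (F : Filter (IntegralAdele y)),
      IntegralAdele.coord y c x - g x ∈ W x := fun x _ => by
    have := (hg x).sub_const (g x)
    rw [sub_self] at this
    exact this ((hW x).mem_nhds (zero_mem _))
  have h5 : ∀ᶠ c in (F : Filter (IntegralAdele y)), ∀ x ∉ S,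
      IntegralAdele.coord y c x - IntegralAdele.coord y a x ∈ flagSubgroup s x := by
    -- The statement about `F` in `h` is available only at some point outside `S`; if there is none
    -- the claim is vacuous.
    by_cases hne : ∃ x, x ∉ S
    · obtain ⟨x, hx⟩ := hne
      exact (h x hx).2.1
    · push Not at hne
      exact Eventually.of_forall fun c x hx => absurd (hne x) hx
  filter_upwards [(Finset.eventually_all _).2 h4, h5] with c hc1 hc2
  refine hTW _ (fun x hx => ?_) fun x hx => ?_
  · have := sub_mem (hc2 x hx) (h x hx).2.2
    rw [sub_sub_sub_cancel_right] at this
    rw [map_sub]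
    exact this
  · rw [map_sub]
    exact hc1 x hx

/-- The image of `t` in `K_{x,z}` as a unit. -/
def FlagConditions.unit {x : y.Point} (z : Branch x.2.2) : (BranchField z)ˣ :=
  (IsLocalization.map_units (BranchField z) (⟨genericToBranchRing z t,
    mem_nonZeroDivisors_iff_right.2 fun b hb => ht.eq_zero_of_mul x z b (mul_comm b _ ▸ hb)⟩ :
      nonZeroDivisors (BranchRing z))).unit

theorem FlagConditions.uniformizerPow_eq {x : y.Point} (z : Branch x.2.2) (r : ℤ) :
    uniformizerPow t r z = ((ht.unit z ^ r : (BranchField z)ˣ) : BranchField z) := by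
  have h1 : algebraMap (BranchRing z) (BranchField z) (genericToBranchRing z t) = ht.unit z := rfl
  unfold uniformizerPow
  rw [h1, Ring.inverse_unit]
  split_ifs with h
  · conv_rhs => rw [← Int.toNat_of_nonneg h]
    rw [zpow_natCast, Units.val_pow_eq_pow_val]
  · have h2 : r = -((-r).toNat : ℤ) := by omega
    conv_rhs => rw [h2]
    rw [zpow_neg, zpow_natCast, ← inv_pow, Units.val_pow_eq_pow_val]

theorem FlagConditions.twist_mul (r : ℤ) (b : IntegralAdele y) :
    CurveAdele.twist t r (ht.mul b) = CurveAdele.twist t (r + 1) b := by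
  refine Subtype.ext (funext fun x => funext fun z => ?_)
  change uniformizerPow t r z * algebraMap (BranchRing z) (BranchField z)
    (genericToBranchRing z t * IntegralAdele.coord y b x z) = uniformizerPow t (r + 1) z *
    algebraMap (BranchRing z) (BranchField z) (IntegralAdele.coord y b x z)
  rw [ht.uniformizerPow_eq, ht.uniformizerPow_eq, map_mul, ← mul_assoc, zpow_add_one, Units.val_mul]
  rfl

theorem FlagConditions.twist_mul_iterate (r : ℤ) (n : ℕ) (b : IntegralAdele y) :
    CurveAdele.twist t r (ht.mul^[n] b) = CurveAdele.twist t (r + n) b := by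
  induction n generalizing r with
  | zero => simp
  | succ n ih =>
    rw [Function.iterate_succ_apply', ht.twist_mul, ih, add_assoc, add_comm (1 : ℤ), Nat.cast_succ]

theorem FlagConditions.twist_injective (r : ℤ) : Function.Injective (CurveAdele.twist t r) := by
  intro a b hab
  refine IntegralAdele.ext fun x => funext fun z => ?_
  have h1 : uniformizerPow t r z * algebraMap (BranchRing z) (BranchField z)
      (IntegralAdele.coord y a x z) = uniformizerPow t r z *
      algebraMap (BranchRing z) (BranchField z) (IntegralAdele.coord y b x z) :=
    congrFun (congrFun (congrArg Subtype.val hab) x) z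
  rw [ht.uniformizerPow_eq, Units.mul_right_inj] at h1
  exact IsFractionRing.injective (BranchRing z) (BranchField z) h1

theorem FlagConditions.exists_twist_eq (β : CurveAdele t) : ∃ r b, CurveAdele.twist t r b = β := by
  have hmono : ∀ r (n : ℕ), adeleFiltration t (r + n) ≤ adeleFiltration t r := by
    rintro r n _ ⟨b, rfl⟩
    exact ⟨ht.mul^[n] b, congrArg Subtype.val (ht.twist_mul_iterate r n b)⟩
  have hdir : Directed (· ≤ ·) (adeleFiltration t) := fun r r' => by
    refine ⟨min r r', ?_, ?_⟩
    · have := hmono (min r r') (r - min r r').toNat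
      rwa [Int.toNat_of_nonneg (by omega), add_sub_cancel] at this
    · have := hmono (min r r') (r' - min r r').toNat
      rwa [Int.toNat_of_nonneg (by omega), add_sub_cancel] at this
  obtain ⟨r, b, hb⟩ := (AddSubgroup.mem_iSup_of_directed hdir).1 β.2
  exact ⟨r, b, Subtype.ext hb⟩

omit ht in
theorem continuous_twist (r : ℤ) : Continuous (CurveAdele.twist t r) :=
  continuous_linearFinal (f := CurveAdele.twist t) r

theorem FlagConditions.continuous_mul_iterate (n : ℕ) : Continuous ht.mul^[n] := by
  refine Continuous.iterate ?_ n
  refine continuous_of_continuousAt_zero ht.mul ?_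
  rw [ContinuousAt, map_zero]
  exact ht.tendsto_mul

/-- An open subgroup of `𝔸_y^{(0)}` is induced by an open subgroup of `𝔸_y`. -/
theorem FlagConditions.exists_open_subgroup (V : AddSubgroup (IntegralAdele y))
    (hV : IsOpen (V : Set (IntegralAdele y))) : ∃ U : AddSubgroup (CurveAdele t),
      IsOpen (U : Set (CurveAdele t)) ∧ ∀ b, CurveAdele.twist t 0 b ∈ U → b ∈ V := by
  -- Since `t` acts as an embedding, any open subgroup is exactly the preimage under multiplication
  -- by `t` of another open subgroup.
  have step : ∀ V : {V : AddSubgroup (IntegralAdele y) // IsOpen (V : Set (IntegralAdele y))},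
      ∃ V' : {V : AddSubgroup (IntegralAdele y) // IsOpen (V : Set (IntegralAdele y))},
        ∀ b, ht.mul b ∈ V'.1 ↔ b ∈ V.1 := by
    rintro ⟨V, hV⟩
    obtain ⟨A, hA, hAV⟩ := ht.exists_nhds_mul (hV.mem_nhds (zero_mem _))
    obtain ⟨V', hV', hVA⟩ := exists_open_subgroup_subset hA
    -- If `t b = v + t w` with `v ∈ V'` and `w ∈ V`, then `t (b - w) ∈ A`, so `b - w ∈ V` and `b ∈
    -- V`.
    refine ⟨⟨V' ⊔ V.map ht.mul, AddSubgroup.isOpen_mono le_sup_left hV'⟩, fun b =>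
      ⟨fun hb => ?_, fun hb => AddSubgroup.mem_sup_right ⟨b, hb, rfl⟩⟩⟩
    obtain ⟨v, hv, _, ⟨w, hw, rfl⟩, hvw⟩ := AddSubgroup.mem_sup.1 hb
    have h1 : ht.mul (b - w) ∈ A := by
      rw [map_sub, ← hvw, add_sub_cancel_right]
      exact hVA hv
    have := add_mem (hAV _ h1) hw
    rwa [sub_add_cancel] at this
  choose next hnext using step
  let Vs (k : ℕ) := next^[k] ⟨V, hV⟩
  have hVs : ∀ k b, ht.mul b ∈ (Vs (k + 1)).1 ↔ b ∈ (Vs k).1 := fun k b => by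
    change _ ∈ (next^[k + 1] _).1 ↔ _
    rw [Function.iterate_succ_apply']
    exact hnext _ b
  have hVs' : ∀ n k b, ht.mul^[n] b ∈ (Vs (k + n)).1 ↔ b ∈ (Vs k).1 := fun n => by
    induction n with
    | zero => exact fun k b => Iff.rfl
    | succ n ih =>
      intro k b
      rw [Function.iterate_succ_apply', ← ih k b]
      exact hVs (k + n) _
  -- The subgroups `t ^ (-k) V_k` increase with `k`, and their union meets `𝔸_y^{(0)}` in `V`.
  let Us (k : ℕ) : AddSubgroup (CurveAdele t) := (Vs k).1.map (CurveAdele.twist t (-k))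
  have hmono : Monotone Us := monotone_nat_of_le_succ fun k => by
    rintro _ ⟨b, hb, rfl⟩
    refine ⟨ht.mul b, (hVs k b).2 hb, ?_⟩
    rw [ht.twist_mul, Nat.cast_succ, neg_add, neg_add_cancel_right]
  have hmem : ∀ β, β ∈ ⨆ k, Us k ↔ ∃ k, β ∈ Us k := fun β =>
    AddSubgroup.mem_iSup_of_directed hmono.directed_le
  refine ⟨⨆ k, Us k, ?_, fun b hb => ?_⟩
  · refine (isOpen_linearFinal (f := CurveAdele.twist t)).2 fun r => ?_
    refine isOpen_subgroup_of_mem_nhds ?_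
    -- With `k = max (-r) 0` one has `t ^ r b = t ^ (-k) (t ^ (max r 0) b)`, which covers both signs
    -- of `r` at once.
    have h1 : ht.mul^[r.toNat] ⁻¹' (Vs (-r).toNat).1 ∈ 𝓝 0 :=
      (ht.continuous_mul_iterate _).continuousAt (by
        rw [iterate_map_zero]
        exact (Vs (-r).toNat).2.mem_nhds (zero_mem _))
    filter_upwards [h1] with b hb
    refine (hmem _).2 ⟨(-r).toNat, _, hb, ?_⟩
    rw [ht.twist_mul_iterate]
    congr 2
    omega
  · obtain ⟨k, v, hv, hvb⟩ := (hmem _).1 hb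
    have h1 : CurveAdele.twist t 0 b = CurveAdele.twist t (-k) (ht.mul^[k] b) := by
      rw [ht.twist_mul_iterate, neg_add_cancel]
    rw [h1] at hvb
    have h2 := ht.twist_injective _ hvb
    have hv' : ht.mul^[k] b ∈ (Vs (0 + k)).1 := by
      rw [← h2, zero_add]
      exact hv
    exact (hVs' k 0 b).1 hv'

/-- An element lies in its own integral conditions at almost all points, so only finitely many
coordinates need a multiple; the product of these integers serves all of them. -/
theorem FlagConditions.exists_nsmul_mem_curveAdele (U : AddSubgroup (CurveAdele t))
    (hU : IsOpen (U : Set (CurveAdele t))) (β : CurveAdele t) : ∃ n > 0, n • β ∈ U := by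
  obtain ⟨r, b, rfl⟩ := ht.exists_twist_eq β
  have h1 : (CurveAdele.twist t r) ⁻¹' U ∈ 𝓝 0 :=
    (continuous_twist r).continuousAt (by rw [map_zero]; exact hU.mem_nhds (zero_mem _))
  obtain ⟨s, hs⟩ := exists_of_mem_nhds_integralAdele h1
  have h2 := b.eventually_mem s
  rw [eventually_cofinite] at h2
  obtain ⟨T, W, hW, h⟩ := hs h2.toFinset
  choose n hn hnW using fun x => ht.exists_nsmul_mem x (W x) ((hW x).mem_nhds (zero_mem _))
    (IntegralAdele.coord y b x)
  refine ⟨∏ x ∈ T, n x, Finset.prod_pos fun x _ => hn x, ?_⟩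
  rw [← map_nsmul]
  refine h _ (fun x hx => ?_) fun x hx => ?_
  · rw [map_nsmul]
    exact nsmul_mem (not_not.1 fun hn => hx (h2.mem_toFinset.2 hn)) _
  · obtain ⟨k, hk⟩ := Finset.dvd_prod_of_mem n hx
    rw [map_nsmul, hk, mul_comm, mul_smul]
    exact nsmul_mem (hnW x) k

/-- The subgroup `𝔸_y^{(0)}` of `𝔸_y` has the restriction property for compact sets of
characters. -/
theorem FlagConditions.dualRestrictionOpen : DualRestrictionOpen (CurveAdele.twist t 0).range := by
  refine dualRestrictionOpen_of_complete _ ht.exists_nsmul_mem_curveAdele fun F hF hFc => ?_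
  have hrange : Set.range (CurveAdele.twist t 0) ∈ F := hF
  let F' := F.comap (ht.twist_injective 0) hrange
  have hmap : F'.map (CurveAdele.twist t 0) = F :=
    Ultrafilter.coe_injective (Filter.map_comap_of_mem hrange)
  -- The Cauchy property descends to `𝔸_y^{(0)}` because its topology is induced from `𝔸_y`.
  have hF' : UltraCauchy F' := by
    intro V hV
    obtain ⟨V', hV', hVV'⟩ := exists_open_subgroup_subset hV
    obtain ⟨U, hU, hUV⟩ := ht.exists_open_subgroup V' hV'
    obtain ⟨γ, hγ⟩ := hFc U (hU.mem_nhds (zero_mem _))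
    rw [← hmap] at hγ
    have hγ' : ∀ᶠ b in F', CurveAdele.twist t 0 b - γ ∈ U := hγ
    obtain ⟨a, ha⟩ := hγ'.exists
    refine ⟨a, hγ'.mono fun b hb => hVV' (hUV _ ?_)⟩
    have := sub_mem hb ha
    rwa [sub_sub_sub_cancel_right, ← map_sub] at this
  obtain ⟨b, hb⟩ := ht.ultraComplete_integralAdele F' hF'
  refine ⟨_, ⟨b, rfl⟩, ?_⟩
  rw [← hmap]
  exact ((continuous_twist 0).tendsto b).comp hb

end CurveAdeles

/-! ## The rings of a flag -/

section Uniformizer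

variable {R : Type*} [CommRing R] [IsLocalRing R] [IsNoetherianRing R]

theorem algebraMap_mem_maximalIdeal_pow {a : R} {n : ℕ} :
    algebraMap R (LocalCompletion R) a ∈ IsLocalRing.maximalIdeal (LocalCompletion R) ^ n ↔
      a ∈ IsLocalRing.maximalIdeal R ^ n := by
  rw [← ker_evalₐ_maximalIdeal]
  refine (iff_of_eq (congrArg (· = 0) (AdicCompletion.evalₐ_of _ n a))).trans ?_
  exact Ideal.Quotient.eq_zero_iff_mem

theorem exists_sub_mem_maximalIdeal_pow (a : LocalCompletion R) (n : ℕ) :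
    ∃ r : R, a - algebraMap R (LocalCompletion R) r ∈
      IsLocalRing.maximalIdeal (LocalCompletion R) ^ n := by
  obtain ⟨r, hr⟩ := Ideal.Quotient.mk_surjective
    (AdicCompletion.evalₐ (IsLocalRing.maximalIdeal R) n a)
  refine ⟨r, (ker_evalₐ_maximalIdeal R).1 ?_⟩
  rw [map_sub, ← hr, sub_eq_zero]
  exact (AdicCompletion.evalₐ_of _ n r).symm

/-- A generator of the maximal ideal of the completion is a unit times a generator of the maximal
ideal. -/
theorem exists_uniformizer_eq_mul {t : LocalCompletion R} (ht : Ideal.span {t} =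
    (IsLocalRing.maximalIdeal R).map (algebraMap R (LocalCompletion R))) :
    ∃ (t₁ : R) (u : (LocalCompletion R)ˣ), IsLocalRing.maximalIdeal R = Ideal.span {t₁} ∧
      t = algebraMap R (LocalCompletion R) t₁ * u := by
  have ht' : IsLocalRing.maximalIdeal (LocalCompletion R) = Ideal.span {t} :=
    AdicCompletion.maximalIdeal_eq_map.trans ht.symm
  -- Approximation modulo the square of the maximal ideal suffices: Nakayama's lemma then makes `t₁`
  -- a generator downstairs.
  obtain ⟨t₁, ht₁⟩ := exists_sub_mem_maximalIdeal_pow t 2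
  have htM : t ∈ IsLocalRing.maximalIdeal (LocalCompletion R) :=
    ht' ▸ Ideal.mem_span_singleton_self t
  have ht₁M : algebraMap R (LocalCompletion R) t₁ ∈
      IsLocalRing.maximalIdeal (LocalCompletion R) := by
    have := sub_mem htM (Ideal.pow_le_self two_ne_zero ht₁)
    rwa [sub_sub_cancel] at this
  have ht₁m : t₁ ∈ IsLocalRing.maximalIdeal R := by
    have := (algebraMap_mem_maximalIdeal_pow (a := t₁) (n := 1)).1 (by rwa [pow_one])
    rwa [pow_one] at this
  have hm : IsLocalRing.maximalIdeal R = Ideal.span {t₁} := by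
    refine le_antisymm ?_ ((Ideal.span_singleton_le_iff_mem _).2 ht₁m)
    refine Submodule.le_of_le_smul_of_le_jacobson_bot (I := IsLocalRing.maximalIdeal R)
      (Ideal.fg_of_isNoetherianRing _) (IsLocalRing.maximalIdeal_le_jacobson _) fun a ha => ?_
    have haM : algebraMap R (LocalCompletion R) a ∈
        IsLocalRing.maximalIdeal (LocalCompletion R) := by
      rw [← pow_one (IsLocalRing.maximalIdeal (LocalCompletion R))]
      exact algebraMap_mem_maximalIdeal_pow.2 (by rwa [pow_one])
    rw [ht'] at haM
    obtain ⟨c, hc⟩ := Ideal.mem_span_singleton'.1 haM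
    -- Approximating the coefficient as well gives `a ≡ c₀ t₁` modulo the square of the maximal
    -- ideal, which is the input of Nakayama's lemma.
    obtain ⟨c₀, hc₀⟩ := exists_sub_mem_maximalIdeal_pow c 1
    have h2 : a - c₀ * t₁ ∈ IsLocalRing.maximalIdeal R ^ 2 := by
      rw [← algebraMap_mem_maximalIdeal_pow, map_sub, ← hc, map_mul]
      have : c * t - algebraMap R (LocalCompletion R) c₀ * algebraMap R _ t₁ =
          c * (t - algebraMap R _ t₁) + (c - algebraMap R _ c₀) * algebraMap R _ t₁ := by ring
      rw [this]
      refine add_mem (Ideal.mul_mem_left _ _ ht₁) ?_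
      rw [pow_two]
      rw [pow_one] at hc₀
      exact Ideal.mul_mem_mul hc₀ ht₁M
    have h3 : a = c₀ * t₁ + (a - c₀ * t₁) := by ring
    rw [h3]
    refine Submodule.add_mem_sup (Ideal.mul_mem_left _ _ (Ideal.mem_span_singleton_self t₁)) ?_
    rw [smul_eq_mul, ← pow_two]
    exact h2
  have hM : IsLocalRing.maximalIdeal (LocalCompletion R) =
      Ideal.span {algebraMap R (LocalCompletion R) t₁} := by
    refine AdicCompletion.maximalIdeal_eq_map.trans ?_
    refine (congrArg (Ideal.map (algebraMap R (LocalCompletion R))) hm).trans ?_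
    rw [Ideal.map_span, Set.image_singleton]
  have h4 := ht₁
  -- Now `t - t₁ = c t₁²`, so the unit is `1 + c t₁`.
  rw [hM, Ideal.span_singleton_pow] at h4
  obtain ⟨c, hc⟩ := Ideal.mem_span_singleton'.1 h4
  have hu : IsUnit (1 + c * algebraMap R (LocalCompletion R) t₁) := by
    by_contra hn
    have h5 : (1 + c * algebraMap R (LocalCompletion R) t₁) ∈
      IsLocalRing.maximalIdeal (LocalCompletion R) := hn
    have h6 := sub_mem h5 (Ideal.mul_mem_left _ c ht₁M)
    rw [add_sub_cancel_right] at h6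
    exact (Ideal.ne_top_iff_one _).1 (IsLocalRing.maximalIdeal.isMaximal _).ne_top h6
  refine ⟨t₁, hu.unit, hm, ?_⟩
  rw [IsUnit.unit_spec]
  linear_combination -hc

end Uniformizer

/-! ### The local rings of a flag on the surface -/

section Flags

variable {X : Scheme.{0}} {x y : X} {h : y ⤳ x}

theorem genericToBranchRing_algebraMap (z : Branch h) (a : X.presheaf.stalk x) :
    genericToBranchRing z (algebraMap (X.presheaf.stalk y) (CompletedLocalRing X y)
      ((X.presheaf.stalkSpecializes h).hom a)) =
      toBranchRing z (algebraMap (X.presheaf.stalk x) (CompletedLocalRing X x) a) := by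
  refine (completionMap_algebraMap (genericToBranchLocalization z) _ _ (maximalIdeal_le_comap z)
    _).trans ?_
  refine congrArg (algebraMap _ _) ?_
  let := (X.presheaf.stalkSpecializes h).hom.toAlgebra
  have : IsLocalization.AtPrime (X.presheaf.stalk y) (flagPrime h) :=
    isLocalization_stalkSpecializes h
  exact IsLocalization.lift_eq _ a

variable (h) in
/-- The flags on an arithmetic surface: the local ring at `x` is a domain, there are no
primes between the prime of `y` and the maximal ideal, and the residue characteristic at `x` is
positive. -/
structure IsFlag : Prop where
  isDomain : IsDomain (X.presheaf.stalk x)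
  flagPrime_ne : flagPrime h ≠ IsLocalRing.maximalIdeal (X.presheaf.stalk x)
  eq_or_eq : ∀ q : Ideal (X.presheaf.stalk x), q.IsPrime → flagPrime h ≤ q →
    q = flagPrime h ∨ q = IsLocalRing.maximalIdeal (X.presheaf.stalk x)
  exists_natCast_mem : ∃ n : ℕ, 0 < n ∧
    (n : X.presheaf.stalk x) ∈ IsLocalRing.maximalIdeal (X.presheaf.stalk x)

variable [IsNoetherianRing (X.presheaf.stalk x)] (hf : IsFlag h)
include hf

theorem IsFlag.isBranch (z : Branch h) : IsBranch z.1.asIdeal :=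
  isBranch_of_comap_eq hf.flagPrime_ne hf.eq_or_eq z.2

theorem IsFlag.ultraComplete (z : Branch h) : UltraComplete (BranchRing z) := by
  let _ := completedLocalRingTopology X x
  have := isTopologicalAddGroup_localCompletion (X.presheaf.stalk x)
  -- `BranchRing z` unfolds to `BranchCompletion z.1.asIdeal`, so the results on branch completions
  -- apply directly.
  exact IsBranch.ultraComplete (z := z.1.asIdeal) (hasAdicOpenSubgroups_localCompletion _)
    (hf.isBranch z)

omit hf in
theorem continuous_mul_branchRing (z : Branch h) (t : BranchRing z) : Continuous fun b => t * b := by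
  let _ := completedLocalRingTopology X x
  have := isTopologicalAddGroup_localCompletion (X.presheaf.stalk x)
  exact continuous_mul_left_branchCompletion (z := z.1.asIdeal)
    (hasAdicOpenSubgroups_localCompletion _) t

omit hf in
theorem exists_nsmul_mem_branchRing (z : Branch h) {n : ℕ}
    (hn : (n : X.presheaf.stalk x) ∈ IsLocalRing.maximalIdeal (X.presheaf.stalk x))
    {W : Set (BranchRing z)} (hW : W ∈ 𝓝 0) (b : BranchRing z) :
    ∃ k, ∀ k' ≥ k, (n ^ k') • b ∈ W := by
  let _ := completedLocalRingTopology X x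
  have := isTopologicalAddGroup_localCompletion (X.presheaf.stalk x)
  have hn' : (n : CompletedLocalRing X x) ∈ IsLocalRing.maximalIdeal (CompletedLocalRing X x) := by
    have h1 := (algebraMap_mem_maximalIdeal_pow (n := 1)
      (a := (n : X.presheaf.stalk x))).2 (by rwa [pow_one])
    rwa [pow_one, map_natCast] at h1
  obtain ⟨k, hk⟩ := exists_pow_smul_mem_branchCompletion (z := z.1.asIdeal)
    (hasAdicOpenSubgroups_localCompletion _) hn' hW b
  refine ⟨k, fun k' hk' => ?_⟩
  have h2 := hk k' hk'
  rw [← Nat.cast_pow, map_natCast, map_natCast] at h2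
  rw [nsmul_eq_mul]
  exact h2

variable {t₀ : X.presheaf.stalk x} (ht₀ : IsLocalRing.maximalIdeal (X.presheaf.stalk y) =
  Ideal.span {(X.presheaf.stalkSpecializes h).hom t₀}) (h0 : t₀ ≠ 0)

omit hf [IsNoetherianRing (X.presheaf.stalk x)] in
include ht₀ in
-- The divisibility holds in the local ring at `y`, a localisation of the one at `x`, and
-- denominators are cleared.
theorem dvd_of_mem_flagPrime (a : X.presheaf.stalk x) (ha : a ∈ flagPrime h) :
    ∃ s ∉ flagPrime h, t₀ ∣ s * a := by
  let := (X.presheaf.stalkSpecializes h).hom.toAlgebra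
  have : IsLocalization.AtPrime (X.presheaf.stalk y) (flagPrime h) :=
    isLocalization_stalkSpecializes h
  have ha' : (X.presheaf.stalkSpecializes h).hom a ∈ IsLocalRing.maximalIdeal _ := ha
  rw [ht₀] at ha'
  obtain ⟨b, hb⟩ := Ideal.mem_span_singleton'.1 ha'
  obtain ⟨⟨r, s⟩, hrs⟩ := IsLocalization.surj (flagPrime h).primeCompl b
  have h1 : algebraMap (X.presheaf.stalk x) (X.presheaf.stalk y) (s * a) =
      algebraMap (X.presheaf.stalk x) (X.presheaf.stalk y) (r * t₀) := by
    rw [map_mul, map_mul, ← hrs]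
    change _ * (X.presheaf.stalkSpecializes h).hom a = _ * (X.presheaf.stalkSpecializes h).hom t₀
    rw [← hb]
    ring
  obtain ⟨c, hc⟩ := (IsLocalization.eq_iff_exists (flagPrime h).primeCompl _).1 h1
  refine ⟨c * s, (flagPrime h).primeCompl.mul_mem c.2 s.2, c * r, ?_⟩
  rw [mul_assoc, hc]
  ring

include ht₀ in
theorem IsFlag.exists_pow_le (z : Branch h) :
    ∃ e, IsLocalRing.maximalIdeal (BranchLocalization z) ^ e ≤
      Ideal.span {algebraMap _ _ (algebraMap (X.presheaf.stalk x) (CompletedLocalRing X x) t₀)} :=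
  exists_maximalIdeal_pow_le_span hf.flagPrime_ne hf.eq_or_eq z.2 (dvd_of_mem_flagPrime ht₀)

include h0 in
theorem IsFlag.eq_zero_of_mul (z : Branch h) (b : BranchLocalization z)
    (hb : algebraMap _ _ (algebraMap (X.presheaf.stalk x) (CompletedLocalRing X x) t₀) * b = 0) :
    b = 0 :=
  have := hf.isDomain
  localization_mul_eq_zero h0 b hb

include ht₀ h0

theorem IsFlag.toBranchRing_mul_injective (z : Branch h) (b : BranchRing z)
    (hb : toBranchRing z (algebraMap _ _ t₀) * b = 0) : b = 0 :=
  ofBranch_mul_injective (hf.eq_zero_of_mul h0 z) (hf.exists_pow_le ht₀ z) hb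

theorem IsFlag.exists_nhds_of_toBranchRing_mul (z : Branch h) {W : Set (BranchRing z)}
    (hW : W ∈ 𝓝 0) :
    ∃ W' ∈ 𝓝 (0 : BranchRing z), ∀ b, toBranchRing z (algebraMap _ _ t₀) * b ∈ W' → b ∈ W := by
  let _ := completedLocalRingTopology X x
  have := isTopologicalAddGroup_localCompletion (X.presheaf.stalk x)
  exact exists_nhds_of_ofBranch_mul (z := z.1.asIdeal) (hf.eq_zero_of_mul h0 z)
    (hasAdicOpenSubgroups_localCompletion _) (hf.isBranch z) (hf.exists_pow_le ht₀ z) hW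

end Flags

section FlagRings

variable {X : Scheme.{0}} {y : Curve X} {t : CompletedLocalRing X y.1}
  {t₁ : X.presheaf.stalk y.1} {u : (CompletedLocalRing X y.1)ˣ}
  (ht₁ : IsLocalRing.maximalIdeal (X.presheaf.stalk y.1) = Ideal.span {t₁}) (h0 : t₁ ≠ 0)
  (htu : t = algebraMap (X.presheaf.stalk y.1) (CompletedLocalRing X y.1) t₁ * u)

include ht₁ h0 htu in
-- At every point, `t₁ = t₀ / s` with `s` a unit at `y`; the unit `v` is `u` divided by `s`. At
-- special points `t₀` need not generate the prime of the curve.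
theorem exists_stalk_uniformizer (x : y.Point) : ∃ t₀ : X.presheaf.stalk x.1,
    IsLocalRing.maximalIdeal (X.presheaf.stalk y.1) =
      Ideal.span {(X.presheaf.stalkSpecializes x.2.2).hom t₀} ∧ t₀ ≠ 0 ∧
    ∃ v : (CompletedLocalRing X y.1)ˣ, ∀ z : Branch x.2.2,
      genericToBranchRing z t = toBranchRing z (algebraMap _ _ t₀) * genericToBranchRing z v := by
  let := (X.presheaf.stalkSpecializes x.2.2).hom.toAlgebra
  have : IsLocalization.AtPrime (X.presheaf.stalk y.1) (flagPrime x.2.2) :=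
    isLocalization_stalkSpecializes x.2.2
  obtain ⟨⟨t₀, s⟩, hts⟩ := IsLocalization.surj (flagPrime x.2.2).primeCompl t₁
  have hs : IsUnit (algebraMap (X.presheaf.stalk x.1) (X.presheaf.stalk y.1) s) :=
    IsLocalization.map_units _ s
  have hts' : t₁ * hs.unit = (X.presheaf.stalkSpecializes x.2.2).hom t₀ := hts
  refine ⟨t₀, ?_, ?_, (hs.unit⁻¹).map (algebraMap (X.presheaf.stalk y.1)
    (CompletedLocalRing X y.1)).toMonoidHom * u, fun z => ?_⟩
  · rw [← hts', ht₁]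
    exact (Ideal.span_singleton_mul_right_unit hs.unit.isUnit _).symm
  · rintro rfl
    rw [map_zero] at hts'
    exact h0 ((Units.mul_left_eq_zero _).1 hts')
  · rw [← genericToBranchRing_algebraMap, ← hts', ← map_mul]
    congr 1
    have h1 : algebraMap (X.presheaf.stalk y.1) (CompletedLocalRing X y.1) (hs.unit : _) *
        ((hs.unit⁻¹).map (algebraMap (X.presheaf.stalk y.1)
          (CompletedLocalRing X y.1)).toMonoidHom : (CompletedLocalRing X y.1)ˣ) = 1 := by
      change algebraMap _ _ _ * algebraMap _ _ _ = _
      rw [← map_mul, Units.mul_inv, map_one]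
    rw [htu, Units.val_mul, map_mul]
    linear_combination (-(algebraMap (X.presheaf.stalk y.1) (CompletedLocalRing X y.1) t₁ * u)) * h1

variable (x : y.Point) [IsNoetherianRing (X.presheaf.stalk x.1)]

theorem IsFlag.ultraComplete_flagRing (hf : IsFlag x.2.2) : UltraComplete (FlagRing x) :=
  UltraComplete.pi hf.ultraComplete

theorem IsFlag.exists_nsmul_mem (hf : IsFlag x.2.2) (W : Set (FlagRing x)) (hW : W ∈ 𝓝 0)
    (b : FlagRing x) : ∃ n : ℕ, n > 0 ∧ n • b ∈ W := by
  obtain ⟨n, hn, hnm⟩ := hf.exists_natCast_mem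
  rw [nhds_pi, Filter.mem_pi] at hW
  obtain ⟨I, hI, V, hV, hIV⟩ := hW
  choose k hk using fun z => exists_nsmul_mem_branchRing z hnm (hV z) (b z)
  refine ⟨n ^ hI.toFinset.sup k, pow_pos hn _, hIV fun z hz => ?_⟩
  exact hk z _ (Finset.le_sup (hI.mem_toFinset.2 hz))

theorem continuous_flagUniformizer_mul (t : CompletedLocalRing X y.1) :
    Continuous fun b => flagUniformizer t x * b :=
  continuous_pi fun z => (continuous_mul_branchRing z (genericToBranchRing z t)).comp
    (continuous_apply z)

include ht₁ h0 htu

theorem IsFlag.eq_zero_of_uniformizer_mul (hf : IsFlag x.2.2) (z : Branch x.2.2)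
    (b : BranchRing z) (hb : genericToBranchRing z t * b = 0) : b = 0 := by
  obtain ⟨t₀, ht₀, h0', v, hv⟩ := exists_stalk_uniformizer ht₁ h0 htu x
  rw [hv, mul_assoc] at hb
  have h1 := hf.toBranchRing_mul_injective ht₀ h0' z _ hb
  exact (v.isUnit.map (genericToBranchRing z)).mul_right_eq_zero.1 h1

theorem IsFlag.exists_nhds_of_flagUniformizer_mul (hf : IsFlag x.2.2) (W : Set (FlagRing x))
    (hW : W ∈ 𝓝 0) : ∃ W' ∈ 𝓝 (0 : FlagRing x), ∀ b, flagUniformizer t x * b ∈ W' → b ∈ W := by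
  obtain ⟨t₀, ht₀, h0', v, hv⟩ := exists_stalk_uniformizer ht₁ h0 htu x
  rw [nhds_pi, Filter.mem_pi] at hW
  obtain ⟨I, hI, V, hV, hIV⟩ := hW
  have h1 : ∀ z, {c | genericToBranchRing z (v⁻¹ : _ˣ) * c ∈ V z} ∈ 𝓝 (0 : BranchRing z) :=
    fun z => (continuous_mul_branchRing z _).continuousAt (by rw [mul_zero]; exact hV z)
  choose V' hV' hVV' using fun z => hf.exists_nhds_of_toBranchRing_mul ht₀ h0' z (h1 z)
  refine ⟨I.pi V', set_pi_mem_nhds hI fun z _ => hV' z, fun b hb => hIV fun z hz => ?_⟩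
  have h2 : toBranchRing z (algebraMap _ _ t₀) * (genericToBranchRing z v * b z) ∈ V' z := by
    rw [← mul_assoc, ← hv]
    exact hb z hz
  have h3 : genericToBranchRing z (v⁻¹ : _ˣ) * (genericToBranchRing z v * b z) ∈ V z :=
    hVV' z _ h2
  rwa [← mul_assoc, ← map_mul, Units.inv_mul, map_one, one_mul] at h3

end FlagRings

/-! ### Points at which the curve is regular -/

section GoodPoints

variable {X : Scheme.{0}} {y : Curve X} {x : y.Point} [IsNoetherianRing (X.presheaf.stalk x.1)]

instance (z : Branch x.2.2) : IsNoetherianRing (BranchLocalization z) :=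
  IsLocalization.isNoetherianRing z.1.asIdeal.primeCompl _ inferInstance

theorem isUnit_branchRing_iff (z : Branch x.2.2) (b : BranchRing z) :
    IsUnit b ↔ branchEval z.1.asIdeal 1 b ≠ 0 := by
  have h1 : (branchEval z.1.asIdeal 1 b = 0) ↔
      b ∈ IsLocalRing.maximalIdeal (LocalCompletion (BranchLocalization z)) ^ 1 :=
    ker_evalₐ_maximalIdeal (BranchLocalization z)
  rw [Ne, h1, pow_one]
  exact not_not.symm

variable (hf : IsFlag x.2.2) {t₀ π : X.presheaf.stalk x.1}
  (hp : flagPrime x.2.2 = Ideal.span {t₀})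
  (hm : IsLocalRing.maximalIdeal (X.presheaf.stalk x.1) = Ideal.span {t₀, π})

include hf hp hm

theorem branch_eq (z : Branch x.2.2) : z.1.asIdeal = Ideal.span {algebraMap _ _ t₀} :=
  branch_eq_span hp hm hf.flagPrime_ne z.2

theorem subsingleton_branch : Subsingleton (Branch x.2.2) :=
  ⟨fun z z' => Subtype.ext (PrimeSpectrum.ext
    ((branch_eq hf hp hm z).trans (branch_eq hf hp hm z').symm))⟩

/-- The image of `t₀` in `𝒪_{x,y}` lies in the Jacobson radical. -/
theorem toFlagRing_mem_jacobson :
    (fun z => toBranchRing z (algebraMap _ _ t₀) : FlagRing x) ∈ (⊥ : Ideal (FlagRing x)).jacobson := by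
  rw [Ideal.mem_jacobson_bot]
  intro b
  rw [Pi.isUnit_iff]
  intro z
  rw [isUnit_branchRing_iff]
  have h1 : branchEval z.1.asIdeal 1 (toBranchRing z (algebraMap _ _ t₀)) = 0 :=
    (branchEval_eq_zero_iff (branch_eq hf hp hm z)).2 ⟨1, by rw [pow_one, mul_one]; rfl⟩
  have h2 : branchEval z.1.asIdeal 1 (show BranchRing z from
      toBranchRing z (algebraMap _ _ t₀) * b z + 1) = 1 := by
    have key : ∀ τ β : BranchCompletion z.1.asIdeal, branchEval z.1.asIdeal 1 τ = 0 →
        branchEval z.1.asIdeal 1 (τ * β + 1) = 1 := by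
      intro τ β hτ
      rw [map_add, map_mul, hτ, zero_mul, zero_add, map_one]
    exact key _ _ h1
  intro h3
  have h4 : (1 : BranchQuotient z.1.asIdeal 1) = 0 := h2.symm.trans h3
  rw [← map_one (toBranchQuotient z.1.asIdeal 1), toBranchQuotient_eq_zero, pow_one] at h4
  exact (Ideal.ne_top_iff_one _).1 (IsLocalRing.maximalIdeal.isMaximal _).ne_top h4

/-- If `b z` were a unit, `1 - (b z)⁻¹ b z = 0` would have to be a unit; so `b z` vanishes modulo
the branch, which is generated by `t₀`. -/
theorem exists_of_mem_jacobson {b : FlagRing x} (hb : b ∈ (⊥ : Ideal (FlagRing x)).jacobson)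
    (z : Branch x.2.2) : ∃ c, b z = toBranchRing z (algebraMap _ _ t₀) * c := by
  classical
  by_contra hcon
  have h1 : IsUnit (b z) := by
    rw [isUnit_branchRing_iff]
    intro h2
    obtain ⟨c, hc⟩ := (branchEval_eq_zero_iff (branch_eq hf hp hm z)).1 h2
    exact hcon ⟨c, by rw [hc, pow_one]; rfl⟩
  rw [Ideal.mem_jacobson_bot] at hb
  have h2 := Pi.isUnit_iff.1 (hb (Pi.single z (-(h1.unit⁻¹ : (BranchRing z)ˣ)))) z
  rw [Pi.add_apply, Pi.mul_apply, Pi.single_eq_same, mul_neg, IsUnit.mul_val_inv, Pi.one_apply,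
    neg_add_cancel, isUnit_branchRing_iff] at h2
  exact h2 (map_zero _)

/-- The radical is generated by `t₀`. The element of `𝒪_x` may be chosen for each branch separately
because there is at most one branch. -/
theorem mem_flagSubgroup_iff (s : ℕ) (b : FlagRing x) : b ∈ flagSubgroup s x ↔
    ∀ z, ∃ a c, b z = toBranchRing z a + toBranchRing z (algebraMap _ _ t₀) ^ s * c := by
  have hsub := subsingleton_branch hf hp hm
  let T : FlagRing x := fun z => toBranchRing z (algebraMap _ _ t₀)
  have hJ : (⊥ : Ideal (FlagRing x)).jacobson = Ideal.span {T} := by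
    refine le_antisymm (fun b hb => ?_) ((Ideal.span_singleton_le_iff_mem _).2
      (toFlagRing_mem_jacobson hf hp hm))
    choose c hc using exists_of_mem_jacobson hf hp hm hb
    exact Ideal.mem_span_singleton'.2 ⟨c, funext fun z => by
      rw [hc z]
      exact mul_comm _ _⟩
  unfold flagSubgroup
  rw [hJ, Ideal.span_singleton_pow]
  constructor
  · intro hb z
    obtain ⟨_, ⟨a, rfl⟩, d, hd, rfl⟩ := AddSubgroup.mem_sup.1 hb
    obtain ⟨c, rfl⟩ := Ideal.mem_span_singleton'.1 hd
    exact ⟨a, c z, by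
      change toBranchRing z a + c z * T z ^ s = _
      rw [mul_comm]⟩
  · intro hb
    choose a c hac using hb
    rcases isEmpty_or_nonempty (Branch x.2.2) with hE | ⟨⟨z₀⟩⟩
    · have : b = 0 := funext fun z => hE.elim z
      rw [this]
      exact zero_mem _
    · refine AddSubgroup.mem_sup.2 ⟨_, ⟨a z₀, rfl⟩, T ^ s * c,
        Ideal.mul_mem_right _ _ (Ideal.mem_span_singleton_self _), funext fun z => ?_⟩
      rw [Subsingleton.elim z₀ z]
      exact (hac z).symm

theorem isOpen_flagSubgroup (s : ℕ) : IsOpen (flagSubgroup s x : Set (FlagRing x)) := by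
  have hsub := subsingleton_branch hf hp hm
  let _ := completedLocalRingTopology X x.1
  have := isTopologicalAddGroup_localCompletion (X.presheaf.stalk x.1)
  choose W hW hWs using fun z : Branch x.2.2 => isOpen_range_ofBranch_add (z := z.1.asIdeal)
    (hasAdicOpenSubgroups_localCompletion _) (hf.isBranch z) (branch_eq hf hp hm z) s
  refine isOpen_subgroup_of_mem_nhds (mem_of_superset
    (set_pi_mem_nhds (Set.finite_univ (α := Branch x.2.2)) fun z _ => hW z) fun b hb => ?_)
  exact (mem_flagSubgroup_iff hf hp hm s b).2 fun z => hWs z _ (hb z trivial)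

variable {t₁ : X.presheaf.stalk y.1}
  (ht₁ : IsLocalRing.maximalIdeal (X.presheaf.stalk y.1) = Ideal.span {t₁}) (h0 : t₁ ≠ 0)
  (ht₀ : (X.presheaf.stalkSpecializes x.2.2).hom t₀ = t₁)

include ht₁ ht₀

omit [IsNoetherianRing (X.presheaf.stalk x.1)] hf hp hm in
theorem genericToBranchRing_of_mem_pow [IsNoetherianRing (X.presheaf.stalk y.1)]
    {s : ℕ} {a : CompletedLocalRing X y.1}
    (ha : a ∈ IsLocalRing.maximalIdeal (CompletedLocalRing X y.1) ^ s) (z : Branch x.2.2) :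
    ∃ d, genericToBranchRing z a = toBranchRing z (algebraMap _ _ t₀) ^ s * d := by
  have hM : IsLocalRing.maximalIdeal (CompletedLocalRing X y.1) =
      Ideal.span {algebraMap (X.presheaf.stalk y.1) (CompletedLocalRing X y.1) t₁} := by
    refine AdicCompletion.maximalIdeal_eq_map.trans ?_
    refine (congrArg (Ideal.map (algebraMap _ (CompletedLocalRing X y.1))) ht₁).trans ?_
    rw [Ideal.map_span, Set.image_singleton]
  rw [hM, Ideal.span_singleton_pow] at ha
  obtain ⟨c, rfl⟩ := Ideal.mem_span_singleton'.1 ha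
  refine ⟨genericToBranchRing z c, ?_⟩
  rw [map_mul, map_pow, ← ht₀, genericToBranchRing_algebraMap, mul_comm]

variable {t : CompletedLocalRing X y.1} {u : CompletedLocalRing X y.1}
  (htu : t = algebraMap (X.presheaf.stalk y.1) (CompletedLocalRing X y.1) t₁ * u)
  {w w' : X.presheaf.stalk x.1} {s : ℕ} [IsNoetherianRing (X.presheaf.stalk y.1)]
  (hu : u - algebraMap (X.presheaf.stalk y.1) (CompletedLocalRing X y.1)
    ((X.presheaf.stalkSpecializes x.2.2).hom w) ∈
      IsLocalRing.maximalIdeal (CompletedLocalRing X y.1) ^ s)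

include htu hu

omit [IsNoetherianRing (X.presheaf.stalk x.1)] hf hp hm in
-- The unit `u` lives only in the completion at `y`; replacing it by an element `w` of the local
-- ring at `x` costs a multiple of `t₀ ^ s`.
theorem exists_flagUniformizer_eq (z : Branch x.2.2) : ∃ d, flagUniformizer t x z =
    toBranchRing z (algebraMap _ _ t₀) *
      (toBranchRing z (algebraMap _ _ w) + toBranchRing z (algebraMap _ _ t₀) ^ s * d) := by
  obtain ⟨d, hd⟩ := genericToBranchRing_of_mem_pow ht₁ ht₀ hu z
  refine ⟨d, ?_⟩
  rw [← hd, map_sub, genericToBranchRing_algebraMap, add_sub_cancel,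
    ← genericToBranchRing_algebraMap, ht₀, ← map_mul, ← htu]
  rfl

theorem flagUniformizer_mul_mem {b : FlagRing x} (hb : b ∈ flagSubgroup s x) :
    flagUniformizer t x * b ∈ flagSubgroup s x := by
  rw [mem_flagSubgroup_iff hf hp hm] at hb ⊢
  intro z
  obtain ⟨a, c, hac⟩ := hb z
  obtain ⟨d, hd⟩ := exists_flagUniformizer_eq ht₁ ht₀ htu hu z
  refine ⟨algebraMap _ _ (t₀ * w) * a, toBranchRing z (algebraMap _ _ t₀) *
    (toBranchRing z (algebraMap _ _ w) * c + d * b z), ?_⟩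
  rw [Pi.mul_apply, hd, map_mul, map_mul, map_mul]
  linear_combination (toBranchRing z (algebraMap _ _ t₀) * toBranchRing z (algebraMap _ _ w)) * hac

include h0 in
-- Up to the unit `w`, membership at level `s + 1` is an equation divisible by `t₀`; cancelling `t₀`
-- lowers the level by one.
theorem mem_of_flagUniformizer_mul_mem (hw : w' * w = 1) {b : FlagRing x}
    (hb : flagUniformizer t x * b ∈ flagSubgroup (s + 1) x) : b ∈ flagSubgroup s x := by
  rw [mem_flagSubgroup_iff hf hp hm] at hb ⊢
  intro z
  obtain ⟨a, c, hac⟩ := hb z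
  obtain ⟨d, hd⟩ := exists_flagUniformizer_eq ht₁ ht₀ htu hu z
  have h0' : t₀ ≠ 0 := by
    rintro rfl
    exact h0 (by rw [← ht₀, map_zero])
  have ht₀' : IsLocalRing.maximalIdeal (X.presheaf.stalk y.1) =
      Ideal.span {(X.presheaf.stalkSpecializes x.2.2).hom t₀} := by rw [ht₀, ht₁]
  have h1 : toBranchRing z (algebraMap _ _ t₀) * (toBranchRing z (algebraMap _ _ w) * b z) =
      toBranchRing z a + toBranchRing z (algebraMap _ _ t₀) ^ (s + 1) * (c - d * b z) := by
    rw [Pi.mul_apply, hd] at hac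
    linear_combination hac
  obtain ⟨a', ha'⟩ := exists_of_ofBranch_mul_eq (z := z.1.asIdeal) (hf.eq_zero_of_mul h0' z)
    (branch_eq hf hp hm z) (hf.exists_pow_le ht₀' z) h1
  have ha'' : toBranchRing z (algebraMap _ _ w) * b z = toBranchRing z a' +
    toBranchRing z (algebraMap _ _ t₀) ^ s * (c - d * b z) := ha'
  have hw' : toBranchRing z (algebraMap _ _ w') * toBranchRing z (algebraMap _ _ w) = 1 := by
    rw [← map_mul, ← map_mul, hw, map_one, map_one]
  refine ⟨algebraMap _ _ w' * a', toBranchRing z (algebraMap _ _ w') * (c - d * b z), ?_⟩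
  rw [map_mul]
  linear_combination toBranchRing z (algebraMap _ _ w') * ha'' - b z * hw'

end GoodPoints

/-! ### From properties of the curve to the local conditions -/

section FlagConditions

variable {X : Scheme.{0}}

/-- The properties, at all and at almost all of its closed points, of a curve on an arithmetic
surface. -/
structure IsFlagCurve (y : Curve X) : Prop where
  isFlag : ∀ x : y.Point, IsFlag x.2.2
  maximalIdeal_ne_bot : IsLocalRing.maximalIdeal (X.presheaf.stalk y.1) ≠ ⊥
  eventually_mem_range : ∀ a : X.presheaf.stalk y.1, ∀ᶠ x : y.Point in cofinite,
    ∃ b, (X.presheaf.stalkSpecializes x.2.2).hom b = a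
  eventually_flagPrime_le : ∃ F : Finset (X.presheaf.stalk y.1),
    (∀ a ∈ F, a ∈ IsLocalRing.maximalIdeal (X.presheaf.stalk y.1)) ∧
    ∀ᶠ x : y.Point in cofinite, flagPrime x.2.2 ≤
      Ideal.span {b | (X.presheaf.stalkSpecializes x.2.2).hom b ∈ F}
  eventually_maximalIdeal_eq : ∀ᶠ x : y.Point in cofinite, ∃ π : X.presheaf.stalk x.1,
    IsLocalRing.maximalIdeal (X.presheaf.stalk x.1) = flagPrime x.2.2 ⊔ Ideal.span {π}

variable {y : Curve X}

theorem stalkSpecializes_injective (x : y.Point) [IsDomain (X.presheaf.stalk x.1)] :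
    Function.Injective (X.presheaf.stalkSpecializes x.2.2).hom := by
  let := (X.presheaf.stalkSpecializes x.2.2).hom.toAlgebra
  have : IsLocalization.AtPrime (X.presheaf.stalk y.1) (flagPrime x.2.2) :=
    isLocalization_stalkSpecializes x.2.2
  exact IsLocalization.injective (X.presheaf.stalk y.1)
    (Ideal.primeCompl_le_nonZeroDivisors (flagPrime x.2.2))

/-- Finitely many generators of the prime are multiples of `t₁` at `y`; their coefficients are
regular at almost all `x`, where `t₁` therefore divides all of them. -/
theorem IsFlagCurve.eventually_flagPrime_eq (hy : IsFlagCurve y) {t₁ : X.presheaf.stalk y.1}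
    (ht₁ : IsLocalRing.maximalIdeal (X.presheaf.stalk y.1) = Ideal.span {t₁}) :
    ∀ᶠ x : y.Point in cofinite, ∃ t₀ : X.presheaf.stalk x.1,
      (X.presheaf.stalkSpecializes x.2.2).hom t₀ = t₁ ∧ flagPrime x.2.2 = Ideal.span {t₀} := by
  obtain ⟨F, hF, hle⟩ := hy.eventually_flagPrime_le
  have h1 : ∀ a ∈ F, ∃ b, b * t₁ = a := fun a ha =>
    Ideal.mem_span_singleton'.1 (ht₁ ▸ hF a ha)
  choose! g hg using h1
  have h2 : ∀ᶠ x : y.Point in cofinite, ∀ a ∈ F,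
      ∃ b, (X.presheaf.stalkSpecializes x.2.2).hom b = g a :=
    (Filter.eventually_all_finset F).2 fun a _ => hy.eventually_mem_range (g a)
  filter_upwards [hle, h2, hy.eventually_mem_range t₁] with x hx h2x h3x
  obtain ⟨t₀, ht₀⟩ := h3x
  have := (hy.isFlag x).isDomain
  refine ⟨t₀, ht₀, le_antisymm (hx.trans (Ideal.span_le.2 fun b hb => ?_))
    ((Ideal.span_singleton_le_iff_mem _).2 ?_)⟩
  · obtain ⟨c, hc⟩ := h2x _ hb
    refine Ideal.mem_span_singleton'.2 ⟨c, stalkSpecializes_injective x ?_⟩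
    rw [map_mul, hc, ht₀, hg _ hb]
  · change (X.presheaf.stalkSpecializes x.2.2).hom t₀ ∈ IsLocalRing.maximalIdeal _
    rw [ht₀, ht₁]
    exact Ideal.mem_span_singleton_self _

variable [∀ x : X, IsNoetherianRing (X.presheaf.stalk x)]

theorem exists_stalk_units_approx (u : (CompletedLocalRing X y.1)ˣ) (s : ℕ) :
    ∃ w : (X.presheaf.stalk y.1)ˣ, (u : CompletedLocalRing X y.1) -
      algebraMap (X.presheaf.stalk y.1) (CompletedLocalRing X y.1) w ∈
        IsLocalRing.maximalIdeal (CompletedLocalRing X y.1) ^ s := by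
  -- The exponent `s + 1` guarantees congruence modulo the maximal ideal even for `s = 0`, so `w` is
  -- a unit.
  obtain ⟨w, hw⟩ := exists_sub_mem_maximalIdeal_pow (R := X.presheaf.stalk y.1) u (s + 1)
  have hu : IsUnit w := by
    by_contra hn
    have h1 : w ∈ IsLocalRing.maximalIdeal (X.presheaf.stalk y.1) ^ 1 := by rwa [pow_one]
    have h2 := add_mem (Ideal.pow_le_pow_right (Nat.le_add_left 1 s) hw)
      (algebraMap_mem_maximalIdeal_pow.2 h1)
    rw [sub_add_cancel, pow_one] at h2
    exact h2 u.isUnit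
  exact ⟨hu.unit, Ideal.pow_le_pow_right (Nat.le_succ s) hw⟩

theorem IsFlagCurve.flagConditions (hy : IsFlagCurve y) {t : CompletedLocalRing X y.1}
    (ht : Ideal.span {t} = (IsLocalRing.maximalIdeal (X.presheaf.stalk y.1)).map
      (algebraMap (X.presheaf.stalk y.1) (CompletedLocalRing X y.1))) : FlagConditions t := by
  obtain ⟨t₁, u, ht₁, htu⟩ := exists_uniformizer_eq_mul ht
  have h0 : t₁ ≠ 0 := by
    rintro rfl
    refine hy.maximalIdeal_ne_bot (ht₁.trans ?_)
    simp
  have good : ∀ᶠ x : y.Point in cofinite, ∃ t₀ π : X.presheaf.stalk x.1,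
      (X.presheaf.stalkSpecializes x.2.2).hom t₀ = t₁ ∧ flagPrime x.2.2 = Ideal.span {t₀} ∧
      IsLocalRing.maximalIdeal (X.presheaf.stalk x.1) = Ideal.span {t₀, π} := by
    filter_upwards [hy.eventually_flagPrime_eq ht₁, hy.eventually_maximalIdeal_eq]
      with x ⟨t₀, ht₀, hp⟩ ⟨π, hπ⟩
    exact ⟨t₀, π, ht₀, hp, by rw [hπ, hp, ← Ideal.span_union, Set.singleton_union]⟩
  -- Both `w` and its inverse come from the local ring at almost all `x`. The exceptional set
  -- depends on `s`, as the conditions allow.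
  have approx : ∀ s, ∀ᶠ x : y.Point in cofinite, ∃ w w' : X.presheaf.stalk x.1, w' * w = 1 ∧
      (u : CompletedLocalRing X y.1) - algebraMap (X.presheaf.stalk y.1) (CompletedLocalRing X y.1)
        ((X.presheaf.stalkSpecializes x.2.2).hom w) ∈
          IsLocalRing.maximalIdeal (CompletedLocalRing X y.1) ^ s := by
    intro s
    obtain ⟨w, hw⟩ := exists_stalk_units_approx u s
    filter_upwards [hy.eventually_mem_range w, hy.eventually_mem_range (w⁻¹ : _ˣ)]
      with x ⟨b, hb⟩ ⟨b', hb'⟩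
    have := (hy.isFlag x).isDomain
    refine ⟨b, b', stalkSpecializes_injective x ?_, by rw [hb]; exact hw⟩
    rw [map_mul, hb, hb', map_one, Units.inv_mul]
  refine ⟨fun x => (hy.isFlag x).ultraComplete_flagRing x, fun x => (hy.isFlag x).exists_nsmul_mem x,
    fun x => continuous_flagUniformizer_mul x t,
    fun x z b hb => (hy.isFlag x).eq_zero_of_uniformizer_mul ht₁ h0 htu x z b hb,
    fun x => (hy.isFlag x).exists_nhds_of_flagUniformizer_mul ht₁ h0 htu x, fun s => ?_, fun s => ?_,
    fun s => ?_⟩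
  · filter_upwards [good] with x ⟨t₀, π, ht₀, hp, hm⟩
    exact isOpen_flagSubgroup (hy.isFlag x) hp hm s
  · filter_upwards [good, approx s] with x ⟨t₀, π, ht₀, hp, hm⟩ ⟨w, w', hw, hu⟩ b hb
    exact flagUniformizer_mul_mem (hy.isFlag x) hp hm ht₁ ht₀ htu hu hb
  · filter_upwards [good, approx s] with x ⟨t₀, π, ht₀, hp, hm⟩ ⟨w, w', hw, hu⟩ b hb
    exact mem_of_flagUniformizer_mul_mem (hy.isFlag x) hp hm ht₁ h0 ht₀ htu hu hw hb

end FlagConditions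

/-! ### The projection of Laurent series onto power series -/

section Laurent

/-- The non-negative part of a Laurent series. -/
def laurentProj : ℂ⸨X⸩ →+ ℂ⟦X⟧ where
  toFun f := PowerSeries.mk fun n => f.coeff n
  map_zero' := by ext; simp
  map_add' f g := by ext; simp

theorem laurentProj_coe (f : ℂ⟦X⟧) : laurentProj (HahnSeries.ofPowerSeries ℤ ℂ f) = f := by
  ext n
  exact (PowerSeries.coeff_mk n fun n => (HahnSeries.ofPowerSeries ℤ ℂ f).coeff n).trans
    (LaurentSeries.coeff_coe_powerSeries f n)

open scoped PowerSeries.WithPiTopology in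
-- Each coefficient of `f • m` is either zero or a coefficient of `f` times the power series part of
-- `m`, after a shift by the order of `m`; hence it is continuous in `f`.
theorem continuous_laurentProj : @Continuous _ _ laurentTopology _ laurentProj := by
  have := PowerSeries.WithPiTopology.instIsTopologicalRing ℂ
  refine continuous_of_finest _ laurentProj fun m => ?_
  have hc : ∀ n : ℤ, Continuous fun f : ℂ⟦X⟧ => (f • m).coeff n := by
    intro n
    have h1 : ∀ f : ℂ⟦X⟧, (f • m).coeff n =
        (HahnSeries.ofPowerSeries ℤ ℂ (f * m.powerSeriesPart)).coeff (n - m.order) := by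
      intro f
      have h2 : f • m = HahnSeries.single m.order 1 *
          HahnSeries.ofPowerSeries ℤ ℂ (f * m.powerSeriesPart) := by
        rw [map_mul, mul_left_comm, LaurentSeries.single_order_mul_powerSeriesPart, Algebra.smul_def]
        rfl
      rw [h2, HahnSeries.coeff_single_mul, one_mul]
    simp only [h1]
    by_cases hn : n - m.order < 0
    · simp only [PowerSeries.coeff_coe, if_pos hn]
      exact continuous_const
    · simp only [PowerSeries.coeff_coe, if_neg hn]
      exact (PowerSeries.WithPiTopology.continuous_coeff ℂ _).comp
        (continuous_id.mul continuous_const)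
  refine continuous_iff_continuousAt.2 fun f =>
    (PowerSeries.WithPiTopology.tendsto_iff_coeff_tendsto ℂ _ _ _).2 fun d => ?_
  have h3 : ∀ g : ℂ⟦X⟧, PowerSeries.coeff d (laurentProj (g • m)) = (g • m).coeff (d : ℤ) :=
    fun g => PowerSeries.coeff_mk d fun n => (g • m).coeff (n : ℤ)
  have h4 := (hc d).tendsto f
  simp only [← h3] at h4
  exact h4

open scoped PowerSeries.WithPiTopology in
theorem continuous_ofPowerSeries :
    @Continuous _ _ _ laurentTopology (HahnSeries.ofPowerSeries ℤ ℂ) := by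
  have h := @continuous_finest ℂ⸨X⸩ (fun _ => ℂ⟦X⟧) _ _ ℂ⸨X⸩ _
    (fun m : ℂ⸨X⸩ => (LinearMap.toSpanSingleton ℂ⟦X⟧ ℂ⸨X⸩ m).toAddMonoidHom) 1
  refine (congrArg (fun g => @Continuous _ _ _ laurentTopology g) (funext fun f => ?_)).mp h
  change f • (1 : ℂ⸨X⸩) = _
  rw [Algebra.smul_def, mul_one]
  rfl

end Laurent

/-! ### The points at infinity and the completed curves -/

section Infinity

variable {K : Type} [Field K] {X : Scheme.{0}}
  {φ : X ⟶ Spec (.of (NumberField.RingOfIntegers K))} {c : Choices φ}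

theorem mem_archIntegers_iff {σ : NumberField.InfinitePlace K} (p : FibrePoint c σ)
    (a : ArchField p) : a ∈ archIntegers p ↔
      ∃ f, laurentEquiv p a = HahnSeries.ofPowerSeries ℤ ℂ f := by
  have h : ∀ b, laurentEquiv p (algebraMap (CompletedLocalRing (archFibre φ (c.embedding σ)) p.1)
      (FractionRing (CompletedLocalRing (archFibre φ (c.embedding σ)) p.1)) b) =
        HahnSeries.ofPowerSeries ℤ ℂ (c.parametrization σ p b) := fun b =>
    IsFractionRing.ringEquivOfRingEquiv_algebraMap
      (K := FractionRing (CompletedLocalRing (archFibre φ (c.embedding σ)) p.1)) _ b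
  constructor
  · rintro ⟨b, rfl⟩
    exact ⟨_, h b⟩
  · rintro ⟨f, hf⟩
    refine ⟨(c.parametrization σ p).symm f, (laurentEquiv p).injective ?_⟩
    refine (h _).trans ?_
    rw [hf]
    exact congrArg _ ((c.parametrization σ p).apply_symm_apply f)

instance {σ : NumberField.InfinitePlace K} (p : FibrePoint c σ) :
    IsTopologicalAddGroup (ArchField p) :=
  letI : TopologicalSpace ℂ⸨X⸩ := laurentTopology
  letI := PowerSeries.WithPiTopology.instTopologicalSpace ℂ
  haveI : IsTopologicalAddGroup ℂ⸨X⸩ := isTopologicalAddGroup_finest _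
  topologicalAddGroup_induced (laurentEquiv p)

/-- The projection of `K_{p,σ}` onto `𝒪_{p,σ}` given by the parametrization. -/
def archProjection {σ : NumberField.InfinitePlace K} (p : FibrePoint c σ) :
    ArchField p →+ ArchField p :=
  ((laurentEquiv p).symm.toAddMonoidHom.comp
    (HahnSeries.ofPowerSeries ℤ ℂ).toAddMonoidHom).comp
      (laurentProj.comp (laurentEquiv p).toAddMonoidHom)

theorem laurentEquiv_archProjection {σ : NumberField.InfinitePlace K} (p : FibrePoint c σ)
    (a : ArchField p) : laurentEquiv p (archProjection p a) =
      HahnSeries.ofPowerSeries ℤ ℂ (laurentProj (laurentEquiv p a)) :=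
  (laurentEquiv p).apply_symm_apply _

theorem continuous_archProjection {σ : NumberField.InfinitePlace K} (p : FibrePoint c σ) :
    Continuous (archProjection p) := by
  let _ := laurentTopology
  let _ := PowerSeries.WithPiTopology.instTopologicalSpace ℂ
  refine continuous_induced_rng.2 ?_
  have h : (laurentEquiv p : ArchField p → ℂ⸨X⸩) ∘ archProjection p =
      fun a => HahnSeries.ofPowerSeries ℤ ℂ (laurentProj (laurentEquiv p a)) :=
    funext fun a => laurentEquiv_archProjection p a
  rw [h]
  exact continuous_ofPowerSeries.comp (continuous_laurentProj.comp continuous_induced_dom)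

/-- Dropping the polar parts is a continuous retraction onto the integral subgroup. -/
theorem dualRestrictionOpen_archIntegers (y : Curve X) :
    DualRestrictionOpen (AddSubgroup.pi Set.univ fun p : PointAtInfinity c y =>
      archIntegers p.1.2) := by
  refine dualRestrictionOpen_of_retract
    (AddMonoidHom.pi fun p : PointAtInfinity c y =>
      (archProjection p.1.2).comp (Pi.evalAddMonoidHom _ p)) ?_ ?_ ?_
  · exact continuous_pi fun p => (continuous_archProjection p.1.2).comp (continuous_apply p)
  · intro g p _
    exact (mem_archIntegers_iff _ _).2 ⟨_, laurentEquiv_archProjection _ _⟩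
  · intro g hg
    funext p
    obtain ⟨f, hf⟩ := (mem_archIntegers_iff _ _).1 (hg p trivial)
    refine (laurentEquiv p.1.2).injective ((laurentEquiv_archProjection p.1.2 (g p)).trans ?_)
    rw [hf, laurentProj_coe]

theorem dualRestrictionOpen_completedIntegral [∀ x : X, IsNoetherianRing (X.presheaf.stalk x)]
    {y : Curve X} (hy : IsFlagCurve y) : DualRestrictionOpen (completedIntegral c y) :=
  (hy.flagConditions (c.span_uniformizer y)).dualRestrictionOpen.prod
    (dualRestrictionOpen_archIntegers y)

end Infinity

/-- The duality theorem, for curves with the properties of the curves on an arithmetic surface. -/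
theorem exists_dual_equiv_completedAdele {K : Type} [Field K] [NumberField K] {X : Scheme.{0}}
    {φ : X ⟶ Spec (.of (NumberField.RingOfIntegers K))} (c : Choices φ) [Countable (Curve X)]
    [∀ x : X, IsNoetherianRing (X.presheaf.stalk x)] (hX : ∀ y : Curve X, IsFlagCurve y) :
    (∃ Ψ : (RestrictedProd (fun y : Curve X => Dual (CompletedCurveAdele c y))
          (fun y => annihilator (completedIntegral c y)) ×
        ∀ σ : NumberField.InfinitePlace K, Dual (FibreAdele c σ)) ≃ₜ+ Dual (CompletedAdele c),
      ∀ χ (β : CompletedAdele c),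
        {y : Curve X | χ.1.coord y (β.1.coord y) ≠ 0}.Finite ∧
        Ψ χ β = ∑ᶠ y : Curve X, χ.1.coord y (β.1.coord y) + ∑ σ, χ.2 σ (β.2 σ)) ∧
    ((∀ σ : NumberField.InfinitePlace K, Nonempty (FibreAdele c σ ≃ₜ+ Dual (FibreAdele c σ))) →
      ∀ θ : ∀ y : Curve X, CompletedCurveAdele c y ≃ₜ+ Dual (CompletedCurveAdele c y),
        {y : Curve X | θ y '' (completedIntegral c y) ≠ annihilator (completedIntegral c y)}.Finite →
        Nonempty (CompletedAdele c ≃ₜ+ Dual (CompletedAdele c))) :=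
  exists_dual_equiv_restrictedProd_prod
    (fun y => dualRestrictionOpen_completedIntegral (hX y)) (FibreAdele c)

/-! ## Generic regularity of curves of finite type over the integers -/

section Dedekind

variable {B L : Type*} [CommRing B] [IsDomain B] [Field L] [Algebra B L] [IsFractionRing B L]
  {C : Type*} [CommRing C] [IsDedekindDomain C] [Algebra C L] [IsFractionRing C L]

omit [IsDomain B] in
/-- If the localisation of `B` at `Q` contains a Dedekind domain `C` with the same fraction field,
its maximal ideal is principal. -/
theorem exists_generator_of_dedekind (Q : Ideal B) [Q.IsPrime] (hQ : Q ≠ ⊥)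
    (h : ∀ c : C, ∃ d ∉ Q, ∃ r, algebraMap B L r = algebraMap B L d * algebraMap C L c) :
    ∃ π ∈ Q, ∀ a ∈ Q, ∃ s ∉ Q, ∃ e, s * a = e * π := by
  classical
  have hinj : Function.Injective (algebraMap B L) := IsFractionRing.injective B L
  have hprime : Q.IsPrime := inferInstance
  have hmul : ∀ {a b}, a ∉ Q → b ∉ Q → a * b ∉ Q := fun ha hb hab =>
    (hprime.mem_or_mem hab).elim ha hb
  -- The contraction to `C` of the maximal ideal of `B` localised at `Q`, written out in fractions.
  let q : Ideal C :=
    { carrier := {c | ∃ d ∉ Q, ∃ r ∈ Q, algebraMap B L r = algebraMap B L d * algebraMap C L c}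
      zero_mem' := ⟨1, (Ideal.ne_top_iff_one Q).1 hprime.ne_top, 0, Q.zero_mem, by simp⟩
      add_mem' := by
        rintro c c' ⟨d, hd, r, hr, e⟩ ⟨d', hd', r', hr', e'⟩
        refine ⟨d * d', hmul hd hd', d' * r + d * r',
          Q.add_mem (Q.mul_mem_left _ hr) (Q.mul_mem_left _ hr'), ?_⟩
        simp only [map_add, map_mul, e, e']
        ring
      smul_mem' := by
        rintro c' c ⟨d, hd, r, hr, e⟩
        obtain ⟨d', hd', r', e'⟩ := h c'
        refine ⟨d * d', hmul hd hd', r' * r, Q.mul_mem_left _ hr, ?_⟩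
        simp only [smul_eq_mul, map_mul, e, e']
        ring }
  have hq : ∀ c, c ∉ q → ∃ d ∉ Q, ∃ r ∉ Q,
      algebraMap B L r = algebraMap B L d * algebraMap C L c := by
    intro c hc
    obtain ⟨d, hd, r, e⟩ := h c
    exact ⟨d, hd, r, fun hr => hc ⟨d, hd, r, hr, e⟩, e⟩
  have hmem : ∀ c : C, ∀ d ∉ Q, ∀ r, algebraMap B L r = algebraMap B L d * algebraMap C L c →
      (c ∈ q ↔ r ∈ Q) := by
    intro c d hd r e
    refine ⟨?_, fun hr => ⟨d, hd, r, hr, e⟩⟩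
    rintro ⟨d', hd', r', hr', e'⟩
    have h1 : d' * r = d * r' := hinj (by simp only [map_mul, e, e']; ring)
    exact (hprime.mem_or_mem (h1 ▸ Q.mul_mem_left d hr' : d' * r ∈ Q)).resolve_left hd'
  have hqp : q.IsPrime := by
    refine ⟨fun htop => ?_, fun {c c'} hcc => ?_⟩
    · have h1 := (hmem 1 1 ((Ideal.ne_top_iff_one Q).1 hprime.ne_top) 1 (by simp)).1
        ((Ideal.eq_top_iff_one q).1 htop)
      exact (Ideal.ne_top_iff_one Q).1 hprime.ne_top h1
    · by_contra! hcon
      obtain ⟨d, hd, r, hr, e⟩ := hq c hcon.1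
      obtain ⟨d', hd', r', hr', e'⟩ := hq c' hcon.2
      refine hmul hr hr' ((hmem (c * c') (d * d') (hmul hd hd') (r * r') ?_).1 hcc)
      simp only [map_mul, e, e']
      ring
  have hq0 : q ≠ ⊥ := by
    obtain ⟨a, ha, ha0⟩ := Submodule.exists_mem_ne_zero_of_ne_bot hQ
    obtain ⟨c, c', hc', e⟩ := IsFractionRing.div_surjective (A := C) (algebraMap B L a)
    have hc0 : algebraMap C L c' ≠ 0 := IsFractionRing.to_map_ne_zero_of_mem_nonZeroDivisors hc'
    have ha0' : algebraMap B L a ≠ 0 := by rwa [Ne, map_eq_zero_iff _ hinj]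
    rw [div_eq_iff hc0] at e
    obtain ⟨d, hd, r, e'⟩ := h c'
    refine (Submodule.ne_bot_iff q).2 ⟨c, ⟨d, hd, a * r, Q.mul_mem_right _ ha, ?_⟩, ?_⟩
    · rw [map_mul, e, e']
      ring
    · rintro rfl
      rw [map_zero] at e
      exact (mul_ne_zero ha0' hc0) e.symm
  let v : IsDedekindDomain.HeightOneSpectrum C := ⟨q, hqp, hq0⟩
  -- The localisation of `C` at `q` is a valuation ring: either `a` or its inverse lies in it. The
  -- inverse is excluded, as it would put a unit into `q`.
  have hv : ∀ a ∈ Q, ∃ c ∈ q, ∃ d ∉ q, algebraMap B L a * algebraMap C L d = algebraMap C L c := by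
    intro a ha
    obtain ⟨c, ⟨d, hd⟩, e | e⟩ := v.exists_primeCompl_mul_eq_or_mul_eq (algebraMap B L a)
    · obtain ⟨d₁, hd₁, r₁, hr₁, e₁⟩ := hq d hd
      obtain ⟨d₂, hd₂, r₂, e₂⟩ := h c
      refine ⟨c, ⟨d₁, hd₁, a * r₁, Q.mul_mem_right _ ha, ?_⟩, d, hd, e⟩
      rw [map_mul, e₁, ← e]
      ring
    · obtain ⟨d₁, hd₁, r₁, e₁⟩ := h c
      refine absurd ⟨d₁, hd₁, a * r₁, Q.mul_mem_right _ ha, ?_⟩ hd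
      rw [map_mul, e₁, ← e]
      ring
  obtain ⟨ϖ, hϖ⟩ := v.intValuation_exists_uniformizer
  have hϖq : ϖ ∈ q := (v.intValuation_lt_one_iff_mem ϖ).1 (by
    rw [hϖ, ← WithZero.exp_zero, WithZero.exp_lt_exp]
    norm_num)
  have hϖ0 : algebraMap C L ϖ ≠ 0 := by
    rw [Ne, map_eq_zero_iff _ (IsFractionRing.injective C L)]
    rintro rfl
    rw [map_zero] at hϖ
    exact WithZero.exp_ne_zero hϖ.symm
  -- The generator is a uniformizer of `C` at `q`, moved into `B` by a factor `d₀` outside `Q`.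
  obtain ⟨d₀, hd₀, π, hπ, e₀⟩ := hϖq
  refine ⟨π, hπ, fun a ha => ?_⟩
  obtain ⟨c, hc, d, hd, e⟩ := hv a ha
  have hvc : v.valuation L (algebraMap C L c / algebraMap C L ϖ) ≤ 1 := by
    rw [map_div₀, v.valuation_of_algebraMap, v.valuation_of_algebraMap, hϖ]
    refine div_le_one_of_le₀ ?_ zero_le
    have := (v.intValuation_le_pow_iff_mem c 1).2 (by rwa [pow_one])
    simpa using this
  obtain ⟨n, ⟨d', hd'⟩, e'⟩ := v.exists_primeCompl_mul_eq_of_integer _ hvc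
  obtain ⟨d₁, hd₁, r₁, hr₁, e₁⟩ := hq d hd
  obtain ⟨d₂, hd₂, r₂, hr₂, e₂⟩ := hq d' hd'
  obtain ⟨d₃, hd₃, r₃, e₃⟩ := h n
  refine ⟨r₁ * r₂ * d₃ * d₀, hmul (hmul (hmul hr₁ hr₂) hd₃) hd₀, r₃ * d₁ * d₂, hinj ?_⟩
  have e'' : algebraMap C L c * algebraMap C L d' = algebraMap C L n * algebraMap C L ϖ := by
    rw [← e']
    field_simp
  simp only [map_mul, e₀, e₁, e₂, e₃]
  linear_combination (algebraMap B L d₁ * algebraMap B L d₂ * algebraMap B L d₃ * algebraMap B L d₀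
    * algebraMap C L d') * e + (algebraMap B L d₁ * algebraMap B L d₂ * algebraMap B L d₃ *
      algebraMap B L d₀) * e''

variable (B L C) in
include L in
/-- If the fraction field of `B` contains a Dedekind domain of finite type over the integers with
the same fraction field, almost all primes of `B` are locally principal. -/
theorem exists_eventually_generator_of_dedekind [Algebra.FiniteType ℤ C] :
    ∃ b : B, b ≠ 0 ∧ ∀ Q : Ideal B, Q.IsPrime → Q ≠ ⊥ → b ∉ Q →
      ∃ π ∈ Q, ∀ a ∈ Q, ∃ s ∉ Q, ∃ e, s * a = e * π := by
  classical
  obtain ⟨T, hT⟩ := ‹Algebra.FiniteType ℤ C›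
  -- A common denominator of the ring generators of `C`; whenever it lies outside `Q`, the
  -- localisation of `B` at `Q` contains `C`.
  obtain ⟨b, hb⟩ := IsLocalization.exist_integer_multiples_of_finset (nonZeroDivisors B)
    (T.image (algebraMap C L))
  refine ⟨b, nonZeroDivisors.ne_zero b.2, fun Q hQp hQ hbQ => ?_⟩
  have hmul : ∀ {a b}, a ∉ Q → b ∉ Q → a * b ∉ Q := fun ha hb hab =>
    (hQp.mem_or_mem hab).elim ha hb
  have h1 : (1 : B) ∉ Q := (Ideal.ne_top_iff_one Q).1 hQp.ne_top
  refine exists_generator_of_dedekind (C := C) (L := L) Q hQ fun c => ?_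
  have hc : c ∈ Algebra.adjoin ℤ (T : Set C) := hT ▸ Algebra.mem_top
  induction hc using Algebra.adjoin_induction with
  | mem c hc =>
    obtain ⟨r, hr⟩ := hb (algebraMap C L c) (Finset.mem_image_of_mem _ hc)
    exact ⟨b, hbQ, r, by rw [hr, Algebra.smul_def]⟩
  | algebraMap n => exact ⟨1, h1, n, by simp⟩
  | add c c' _ _ hc hc' =>
    obtain ⟨d, hd, r, e⟩ := hc
    obtain ⟨d', hd', r', e'⟩ := hc'
    refine ⟨d * d', hmul hd hd', d' * r + d * r', ?_⟩
    simp only [map_add, map_mul, e, e']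
    ring
  | mul c c' _ _ hc hc' =>
    obtain ⟨d, hd, r, e⟩ := hc
    obtain ⟨d', hd', r', e'⟩ := hc'
    refine ⟨d * d', hmul hd hd', r * r', ?_⟩
    simp only [map_mul, e, e']
    ring

end Dedekind

/-! ### A variant of Zariski's lemma -/

section FieldExtensions

variable {B L : Type*} [CommRing B] [IsDomain B] [Field L] [Algebra B L] [IsFractionRing B L]

variable (B) in
/-- A version of Zariski's lemma: if all the nonzero primes of `B` meet the subfield `k` of the
fraction field of `B`, then the fraction field is finite over `k`. -/
theorem module_finite_of_forall_prime [Algebra.FiniteType ℤ B] (k : Type*) [Field k] [Algebra k L]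
    (h : ∀ Q : Ideal B, Q.IsPrime → Q ≠ ⊥ →
      ∃ r ∈ Q, r ≠ 0 ∧ algebraMap B L r ∈ (algebraMap k L).range) : Module.Finite k L := by
  have hinj : Function.Injective (algebraMap B L) := IsFractionRing.injective B L
  -- Every nonzero `a` has a nonzero multiple in `k`. Otherwise some prime containing `a` avoids the
  -- nonzero elements of `k` in `B`, against the hypothesis.
  have key : ∀ a : B, a ≠ 0 → ∃ c, c * a ≠ 0 ∧ algebraMap B L (c * a) ∈ (algebraMap k L).range := by
    intro a ha
    let M : Submonoid B := nonZeroDivisors B ⊓ (algebraMap k L).range.toSubmonoid.comap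
      (algebraMap B L)
    by_contra! hcon
    have hdis : Disjoint (Ideal.span {a} : Set B) M := by
      refine Set.disjoint_left.2 fun r hr hrM => ?_
      obtain ⟨c, rfl⟩ := Ideal.mem_span_singleton'.1 hr
      exact hcon c (nonZeroDivisors.ne_zero hrM.1) hrM.2
    obtain ⟨Q, hQp, hQ, hQM⟩ := Ideal.exists_le_prime_disjoint _ M hdis
    obtain ⟨r, hr, hr0, hrk⟩ := h Q hQp fun hbot => ha
      (by simpa [hbot] using hQ (Ideal.mem_span_singleton_self a))
    exact Set.disjoint_left.1 hQM hr ⟨mem_nonZeroDivisors_of_ne_zero hr0, hrk⟩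
  obtain ⟨T, hT⟩ := ‹Algebra.FiniteType ℤ B›
  have hB : ∀ r : B, algebraMap B L r ∈ Algebra.adjoin k (algebraMap B L '' T) := by
    intro r
    have hr : r ∈ Algebra.adjoin ℤ (T : Set B) := hT ▸ Algebra.mem_top
    induction hr using Algebra.adjoin_induction with
    | mem r hr => exact Algebra.subset_adjoin ⟨r, hr, rfl⟩
    | algebraMap n =>
      rw [eq_intCast, map_intCast]
      exact intCast_mem _ n
    | add r r' _ _ hr hr' =>
      rw [map_add]
      exact add_mem hr hr'
    | mul r r' _ _ hr hr' =>
      rw [map_mul]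
      exact mul_mem hr hr'
  have : Algebra.FiniteType k L := by
    classical
    refine ⟨T.image (algebraMap B L), eq_top_iff.2 fun l _ => ?_⟩
    rw [Finset.coe_image]
    obtain ⟨r, a, ha, rfl⟩ := IsFractionRing.div_surjective (A := B) l
    obtain ⟨c, hc0, x, hx⟩ := key a (nonZeroDivisors.ne_zero ha)
    -- Division by `a` becomes division by an element of `k`, so `L` is generated as a `k`-algebra
    -- by the generators of `B`.
    have h1 : algebraMap B L r / algebraMap B L a = algebraMap k L x⁻¹ * algebraMap B L (c * r) := by
      have h2 : algebraMap B L c ≠ 0 := by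
        rw [Ne, map_eq_zero_iff _ hinj]
        exact left_ne_zero_of_mul hc0
      have h3 : algebraMap B L a ≠ 0 := by
        rw [Ne, map_eq_zero_iff _ hinj]
        exact right_ne_zero_of_mul hc0
      rw [map_inv₀, hx, map_mul, map_mul]
      field_simp
    rw [h1]
    exact mul_mem (Subalgebra.algebraMap_mem _ _) (hB _)
  exact finite_of_finite_type_of_isJacobsonRing k L

end FieldExtensions

/-! ### Generic regularity in characteristic zero and `p` -/

section GenericRegularity

/-- A finitely generated separable extension of transcendence degree one of `ℤ/p` is the fraction
field of a Dedekind domain of finite type over the integers. -/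
theorem exists_dedekind_of_isTranscendenceBasis (p : ℕ) [Fact p.Prime] (L : Type) [Field L]
    [Algebra (ZMod p) L] [Algebra.EssFiniteType (ZMod p) L] (s : L)
    (hs : Algebra.IsSeparable (IntermediateField.adjoin (ZMod p) {s}) L) :
    ∃ C : Subring L, IsDedekindDomain C ∧ IsFractionRing C L ∧ Algebra.FiniteType ℤ C := by
  open scoped IntermediateField.algebraAdjoinAdjoin in
  let k := IntermediateField.adjoin (ZMod p) {s}
  let D := Algebra.adjoin (ZMod p) {s}
  have : Algebra.EssFiniteType k L := Algebra.EssFiniteType.of_comp (ZMod p) k L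
  -- `L` is finitely generated as a field over `k`, and algebraic.
  have : Module.Finite k L := by
    obtain ⟨T, hT⟩ := IntermediateField.fg_top k L
    have h1 : FiniteDimensional k (IntermediateField.adjoin k (T : Set L)) :=
      IntermediateField.finiteDimensional_adjoin fun x _ => Algebra.IsIntegral.isIntegral x
    rw [hT] at h1
    exact Module.Finite.equiv (IntermediateField.topEquiv (F := k) (E := L)).toLinearEquiv
  -- A quotient of the polynomial ring in one variable. Separability of `L` over `k` then makes its
  -- integral closure in `L` finite and Dedekind.
  have hD : IsPrincipalIdealRing D := by
    have h1 : ∀ x : D, (x : L) ∈ (Polynomial.aeval (R := ZMod p) s).range := fun x => by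
      rw [← Algebra.adjoin_singleton_eq_range_aeval]
      exact x.2
    refine IsPrincipalIdealRing.of_surjective
      ((Polynomial.aeval (R := ZMod p) s).codRestrict D fun f => ?_) fun x => ?_
    · change _ ∈ Algebra.adjoin _ _
      rw [Algebra.adjoin_singleton_eq_range_aeval]
      exact ⟨f, rfl⟩
    · obtain ⟨f, hf⟩ := h1 x
      exact ⟨f, Subtype.ext hf⟩
  have : IsScalarTower D k L := inferInstance
  have : IsFractionRing D k := inferInstance
  have hft : Algebra.FiniteType (ZMod p) D := ⟨by
    rw [Subalgebra.fg_top]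
    exact ⟨{s}, by simp [D]⟩⟩
  refine ⟨(integralClosure D L).toSubring, integralClosure.isDedekindDomain D k L,
    IsIntegralClosure.isFractionRing_of_finite_extension D k L (integralClosure D L), ?_⟩
  have hfin : Module.Finite D (integralClosure D L) :=
    IsIntegralClosure.finite D k L (integralClosure D L)
  have h0 : Algebra.FiniteType ℤ (ZMod p) :=
    Algebra.FiniteType.of_surjective (Algebra.ofId ℤ (ZMod p)) ZMod.intCast_surjective
  have h1 : Algebra.FiniteType ℤ D := h0.trans hft
  have h2 : Algebra.FiniteType D (integralClosure D L) := inferInstance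
  have h3 : Algebra.FiniteType ℤ (integralClosure D L) := h1.trans h2
  exact h3

open scoped IntermediateField.algebraAdjoinAdjoin in
theorem isAlgebraic_adjoin_of_finite {F L : Type*} [Field F] [Field L] [Algebra F L] (x : L)
    [Module.Finite (IntermediateField.adjoin F {x}) L] :
    Algebra.IsAlgebraic (Algebra.adjoin F {x}) L :=
  (IsFractionRing.comap_isAlgebraic_iff (A := Algebra.adjoin F {x})
    (K := IntermediateField.adjoin F {x})).2 inferInstance

variable (B : Type) [CommRing B] [IsDomain B] [Algebra.FiniteType ℤ B]
  (hB : ∀ Q : Ideal B, Q.IsPrime → Q ≠ ⊥ → Q.IsMaximal ∧ ∃ n : ℕ, 0 < n ∧ (n : B) ∈ Q)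

/-- The conclusion of generic regularity. -/
def GenericallyPrincipal : Prop :=
  ∃ b : B, b ≠ 0 ∧ ∀ Q : Ideal B, Q.IsPrime → Q ≠ ⊥ → b ∉ Q →
    ∃ π ∈ Q, ∀ a ∈ Q, ∃ s ∉ Q, ∃ e, s * a = e * π

include hB

/-- Nonzero primes contain positive integers, so they meet `ℚ` and the fraction field is a number
field; its ring of integers is the Dedekind domain for comparison. -/
theorem genericallyPrincipal_of_charZero [CharZero B] : GenericallyPrincipal B := by
  let L := FractionRing B
  have : CharZero L := charZero_of_injective_algebraMap (IsFractionRing.injective B L)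
  have : Module.Finite ℚ L := by
    refine module_finite_of_forall_prime B ℚ fun Q hQp hQ => ?_
    obtain ⟨-, n, hn, hnQ⟩ := hB Q hQp hQ
    exact ⟨n, hnQ, Nat.cast_ne_zero.2 hn.ne', n, by simp⟩
  have : NumberField L := ⟨⟩
  exact exists_eventually_generator_of_dedekind B L (NumberField.RingOfIntegers L)

/-- The fraction field has transcendence degree one over the prime field, which is perfect, so a
separating element exists. -/
theorem genericallyPrincipal_of_charP (p : ℕ) [Fact p.Prime] [CharP B p] :
    GenericallyPrincipal B := by
  let L := FractionRing B
  let _ : Algebra (ZMod p) B := ZMod.algebra B p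
  have : IsScalarTower ℤ (ZMod p) B := inferInstance
  have hft : Algebra.FiniteType (ZMod p) B :=
    Algebra.FiniteType.of_restrictScalars_finiteType ℤ (ZMod p) B
  -- If `B` is algebraic over the prime field it is a field and has no nonzero primes.
  by_cases halg : Algebra.IsAlgebraic (ZMod p) B
  · refine ⟨1, one_ne_zero, fun Q hQp hQ => absurd ?_ hQ⟩
    have : Algebra.IsIntegral (ZMod p) B := Algebra.isAlgebraic_iff_isIntegral.1 halg
    have hF : IsField B := isField_of_isIntegral_of_isField' (Field.toIsField (ZMod p))
    let _ := hF.toField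
    exact (Ideal.eq_bot_or_top Q).resolve_right hQp.ne_top
  obtain ⟨b, hb⟩ : ∃ b : B, Transcendental (ZMod p) b := by
    by_contra! hcon
    exact halg ⟨fun b => not_not.1 (hcon b)⟩
  have hβ : Transcendental (ZMod p) (algebraMap B L b) :=
    (transcendental_algebraMap_iff (IsFractionRing.injective B L)).2 hb
  have hfin : Module.Finite (IntermediateField.adjoin (ZMod p) {algebraMap B L b}) L := by
    refine module_finite_of_forall_prime B _ fun Q hQp hQ => ?_
    have hmax : Q.IsMaximal := (hB Q hQp hQ).1
    let _ : Field (B ⧸ Q) := Ideal.Quotient.field Q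
    have : Module.Finite (ZMod p) (B ⧸ Q) := finite_of_finite_type_of_isJacobsonRing _ _
    -- The residue field at `Q` is finite, so the image of `b` is algebraic; thus `Q` contains a
    -- nonzero polynomial in `b`.
    obtain ⟨f, hf, hfb⟩ := Algebra.IsAlgebraic.isAlgebraic (R := ZMod p) (Ideal.Quotient.mk Q b)
    refine ⟨Polynomial.aeval b f, ?_, fun h0 => hb ⟨f, hf, h0⟩, ?_⟩
    · rw [← Ideal.Quotient.eq_zero_iff_mem]
      have h1 := Polynomial.aeval_algHom_apply (Ideal.Quotient.mkₐ (ZMod p) Q) b f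
      rw [Ideal.Quotient.mkₐ_eq_mk] at h1
      rw [← h1, hfb]
    · refine ⟨⟨Polynomial.aeval (algebraMap B L b) f, ?_⟩, ?_⟩
      · exact IntermediateField.algebra_adjoin_le_adjoin _ _
          (by rw [Algebra.adjoin_singleton_eq_range_aeval]; exact ⟨f, rfl⟩)
      · exact Polynomial.aeval_algebraMap_apply L b f
  have hbasis : IsTranscendenceBasis (ZMod p) fun _ : Unit => algebraMap B L b := by
    rw [isTranscendenceBasis_iff_algebraicIndependent_isAlgebraic,
      algebraicIndependent_unique_type_iff]
    refine ⟨hβ, ?_⟩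
    rw [Set.range_const]
    exact isAlgebraic_adjoin_of_finite _
  have : Algebra.EssFiniteType (ZMod p) L := Algebra.EssFiniteType.comp (ZMod p) B L
  obtain ⟨S, hS, hsep⟩ := exists_isTranscendenceBasis_and_isSeparable_of_perfectField (ZMod p) L
  have hcard := hS.cardinalMk_eq hbasis
  obtain ⟨s, rfl⟩ : ∃ s, S = {s} := Finset.card_eq_one.1 (by simpa using hcard)
  rw [Finset.coe_singleton] at hsep
  obtain ⟨C, h1, h2, h3⟩ := exists_dedekind_of_isTranscendenceBasis p L s hsep
  exact exists_eventually_generator_of_dedekind B L C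

theorem genericallyPrincipal : GenericallyPrincipal B := by
  obtain h | ⟨p, hp, h⟩ := CharP.exists' B
  · exact genericallyPrincipal_of_charZero B hB
  · exact genericallyPrincipal_of_charP B hB p

end GenericRegularity

/-! ## Curves on a surface -/

section Dimension

variable {Z : Type*} [TopologicalSpace Z] [T0Space Z]

/-- The irreducible closed set with generic point `a`. -/
def irreducibleClosure (a : Z) : TopologicalSpace.IrreducibleCloseds Z :=
  ⟨closure {a}, isIrreducible_singleton.closure, isClosed_closure⟩

theorem irreducibleClosure_lt {a b : Z} (h : a ⤳ b) (hne : a ≠ b) :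
    irreducibleClosure b < irreducibleClosure a := by
  refine lt_of_le_not_ge (specializes_iff_closure_subset.1 h) fun hle => hne ?_
  exact (h.antisymm (specializes_iff_closure_subset.2 hle)).eq

theorem two_le_topologicalKrullDim {a b c : Z} (hab : a ⤳ b) (hbc : b ⤳ c) (h1 : a ≠ b)
    (h2 : b ≠ c) : 2 ≤ topologicalKrullDim Z := by
  let s : LTSeries (TopologicalSpace.IrreducibleCloseds Z) :=
    ⟨2, ![irreducibleClosure c, irreducibleClosure b, irreducibleClosure a], fun i => by
      fin_cases i
      · exact irreducibleClosure_lt hbc h2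
      · exact irreducibleClosure_lt hab h1⟩
  exact Order.LTSeries.length_le_krullDim s

end Dimension

section Curves

variable {X : Scheme.{0}}

/-- Otherwise `y`, `w`, `x` would give a chain of length two in the one-dimensional closure of `y`.
-/
theorem Curve.eq_or_eq (y : Curve X) {w x : X} (hyw : y.1 ⤳ w) (hwx : w ⤳ x) :
    y.1 = w ∨ w = x := by
  by_contra! hcon
  have hmem : ∀ {v : X}, y.1 ⤳ v → v ∈ closure {y.1} := fun h => specializes_iff_mem_closure.1 h
  have h1 := two_le_topologicalKrullDim (Z := closure {y.1}) (a := ⟨y.1, hmem specializes_rfl⟩)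
    (b := ⟨w, hmem hyw⟩) (c := ⟨x, hmem (hyw.trans hwx)⟩) ((subtype_specializes_iff _ _).2 hyw)
    ((subtype_specializes_iff _ _).2 hwx) (fun h => hcon.1 (congrArg Subtype.val h))
    (fun h => hcon.2 (congrArg Subtype.val h))
  rw [y.2] at h1
  exact absurd h1 (by decide)

theorem Curve.ne_of_isClosed (y : Curve X) {x : X} (hx : IsClosed {x}) : y.1 ≠ x := by
  intro h
  have h1 := y.2
  rw [h, hx.closure_eq] at h1
  have h2 : topologicalKrullDim ({x} : Set X) ≤ 0 := 
    topologicalKrullDim_zero_of_discreteTopology _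
  rw [h1] at h2
  exact absurd h2 (by decide)

theorem Curve.ne_generic (hX : topologicalKrullDim X = 2) (y : Curve X) {η : X}
    (hη : closure {η} = Set.univ) : y.1 ≠ η := by
  intro h
  have h1 := y.2
  rw [h, hη] at h1
  have h2 := (Homeomorph.Set.univ X).isHomeomorph.topologicalKrullDim_eq
  rw [h1, hX] at h2
  exact absurd h2 (by decide)

theorem fromSpecStalk_flagPrime {x y : X} (h : y ⤳ x) :
    X.fromSpecStalk x ⟨flagPrime h, inferInstance⟩ = y := by
  have h1 := X.fromSpecStalk_closedPoint (x := y)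
  rw [← Scheme.SpecMap_stalkSpecializes_fromSpecStalk h] at h1
  exact h1

theorem fromSpecStalk_injective (x : X) : Function.Injective (X.fromSpecStalk x) :=
  (X.fromSpecStalk x).isEmbedding.injective

/-- Primes of the local ring at `x` are the generizations of `x`, so a prime between corresponds to
a point between `y` and `x`. -/
theorem Curve.isFlag [IsIntegral X] (y : Curve X) (x : y.Point)
    (hn : ∃ n : ℕ, 0 < n ∧ (n : X.presheaf.stalk x.1) ∈ IsLocalRing.maximalIdeal _) :
    IsFlag x.2.2 where
  isDomain := inferInstance
  flagPrime_ne h := by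
    refine y.ne_of_isClosed x.2.1 ((fromSpecStalk_flagPrime x.2.2).symm.trans ?_)
    have h1 : (⟨flagPrime x.2.2, inferInstance⟩ : PrimeSpectrum (X.presheaf.stalk x.1)) =
      IsLocalRing.closedPoint _ := PrimeSpectrum.ext h
    exact (congrArg (X.fromSpecStalk x.1) h1).trans X.fromSpecStalk_closedPoint
  eq_or_eq q hq hle := by
    let p : PrimeSpectrum (X.presheaf.stalk x.1) := ⟨flagPrime x.2.2, inferInstance⟩
    let q' : PrimeSpectrum (X.presheaf.stalk x.1) := ⟨q, hq⟩
    have h1 : p ⤳ q' := (PrimeSpectrum.le_iff_specializes _ _).1 hle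
    have h2 : q' ⤳ IsLocalRing.closedPoint _ :=
      (PrimeSpectrum.le_iff_specializes _ _).1 (IsLocalRing.le_maximalIdeal hq.ne_top)
    have h3 := h1.map (X.fromSpecStalk x.1).continuous
    have h4 := h2.map (X.fromSpecStalk x.1).continuous
    have h5 : X.fromSpecStalk x.1 p = y.1 := fromSpecStalk_flagPrime x.2.2
    rw [h5] at h3
    rcases y.eq_or_eq h3 h4 with h | h
    · left
      exact (congrArg PrimeSpectrum.asIdeal (fromSpecStalk_injective x.1 (h5.trans h))).symm
    · right
      exact congrArg PrimeSpectrum.asIdeal (fromSpecStalk_injective x.1 h)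
  exists_natCast_mem := hn

/-- If the maximal ideal were zero, the local ring would have only one prime and `y` would be the
generic point of `X`. -/
theorem Curve.maximalIdeal_ne_bot [IsIntegral X] (hX : topologicalKrullDim X = 2) (y : Curve X) :
    IsLocalRing.maximalIdeal (X.presheaf.stalk y.1) ≠ ⊥ := by
  intro h
  have h1 : genericPoint X ⤳ y.1 := genericPoint_specializes y.1
  refine y.ne_generic hX (genericPoint_spec X) ?_
  have h2 : genericPoint X ∈ Set.range (X.fromSpecStalk y.1) := by
    rw [Scheme.range_fromSpecStalk]
    exact h1
  obtain ⟨p, hp⟩ := h2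
  have hp' : p = IsLocalRing.closedPoint _ := PrimeSpectrum.ext
    ((le_bot_iff.1 ((IsLocalRing.le_maximalIdeal p.2.ne_top).trans h.le)).trans h.symm)
  rw [← hp, hp']
  exact X.fromSpecStalk_closedPoint.symm

/-- Almost all closed points of a curve lie in a given open set that meets the curve. -/
theorem Curve.eventually_mem_opens [TopologicalSpace.NoetherianSpace X] (y : Curve X) (U : X.Opens) (hU : y.1 ∈ U) :
    ∀ᶠ x : y.Point in cofinite, x.1 ∈ U := by
  -- The part of the curve outside `U` is a finite union of irreducible closed sets; one that
  -- contains a closed point of `y` has a generic point different from `y`, so it is that point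
  -- alone.
  obtain ⟨S, hS, hcl, hirr, hZ⟩ :=
    TopologicalSpace.NoetherianSpace.exists_finite_set_isClosed_irreducible
      ((isClosed_closure (s := {y.1})).inter
        (show IsClosed (U : Set X)ᶜ from U.2.isClosed_compl))
  have hinj : Function.Injective fun x : y.Point => ({x.1} : Set X) := fun x x' h =>
    Subtype.ext (Set.singleton_injective h)
  refine (hS.preimage hinj.injOn).subset fun x hx => ?_
  obtain ⟨W, hW, hxW⟩ : ∃ W ∈ S, x.1 ∈ W := by
    rw [← Set.mem_sUnion, ← hZ]
    exact ⟨specializes_iff_mem_closure.1 x.2.2, hx⟩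
  obtain ⟨w, hw⟩ := QuasiSober.sober (hirr W hW) (hcl W hW)
  have hwZ : w ∈ closure {y.1} ∩ (U : Set X)ᶜ := by
    rw [hZ]
    exact ⟨W, hW, hw.mem⟩
  have hwx : w ⤳ x.1 := hw.specializes hxW
  rcases y.eq_or_eq (specializes_iff_mem_closure.2 hwZ.1) hwx with h | h
  · exact absurd (h ▸ hU) hwZ.2
  · rw [Set.mem_preimage, ← x.2.1.closure_eq, ← h, hw.def]
    exact hW

end Curves

/-! ### Points and primes on an affine open set -/

section AffineOpens

variable {X : Scheme.{0}} {U : X.Opens} (hU : IsAffineOpen U)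

theorem mem_primeIdealOf_iff {x : X} (hx : x ∈ U) (r : Γ(X, U)) :
    r ∈ (hU.primeIdealOf ⟨x, hx⟩).asIdeal ↔
      (X.presheaf.germ U x hx).hom r ∈ IsLocalRing.maximalIdeal (X.presheaf.stalk x) := by
  let _ : Algebra Γ(X, U) (X.presheaf.stalk x) := (X.presheaf.germ U x hx).hom.toAlgebra
  have : IsLocalization.AtPrime (X.presheaf.stalk x) (hU.primeIdealOf ⟨x, hx⟩).asIdeal :=
    hU.isLocalization_stalk ⟨x, hx⟩
  exact (IsLocalization.AtPrime.to_map_mem_maximal_iff (X.presheaf.stalk x)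
    (hU.primeIdealOf ⟨x, hx⟩).asIdeal r).symm

include hU in
theorem exists_mul_germ_eq {x : X} (hx : x ∈ U) (c : X.presheaf.stalk x) :
    ∃ r s, IsUnit ((X.presheaf.germ U x hx).hom s) ∧
      c * (X.presheaf.germ U x hx).hom s = (X.presheaf.germ U x hx).hom r := by
  let _ : Algebra Γ(X, U) (X.presheaf.stalk x) := (X.presheaf.germ U x hx).hom.toAlgebra
  have : IsLocalization.AtPrime (X.presheaf.stalk x) (hU.primeIdealOf ⟨x, hx⟩).asIdeal :=
    hU.isLocalization_stalk ⟨x, hx⟩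
  obtain ⟨⟨r, s⟩, e⟩ := IsLocalization.surj (hU.primeIdealOf ⟨x, hx⟩).asIdeal.primeCompl c
  exact ⟨r, s, IsLocalization.map_units (X.presheaf.stalk x) s, e⟩

theorem germ_stalkSpecializes_apply {x y : X} (h : y ⤳ x) (hx : x ∈ U) (r : Γ(X, U)) :
    (X.presheaf.stalkSpecializes h).hom ((X.presheaf.germ U x hx).hom r) =
      (X.presheaf.germ U y (h.mem_open U.2 hx)).hom r := by
  rw [← X.presheaf.germ_stalkSpecializes hx h]
  rfl

theorem germ_mem_flagPrime_iff {x y : X} (h : y ⤳ x) (hx : x ∈ U) (r : Γ(X, U)) :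
    (X.presheaf.germ U x hx).hom r ∈ flagPrime h ↔
      r ∈ (hU.primeIdealOf ⟨y, h.mem_open U.2 hx⟩).asIdeal := by
  rw [mem_primeIdealOf_iff, ← germ_stalkSpecializes_apply h hx]
  rfl

theorem primeIdealOf_le {x y : X} (h : y ⤳ x) (hx : x ∈ U) :
    (hU.primeIdealOf ⟨y, h.mem_open U.2 hx⟩).asIdeal ≤ (hU.primeIdealOf ⟨x, hx⟩).asIdeal := by
  intro r hr
  rw [mem_primeIdealOf_iff]
  exact IsLocalRing.le_maximalIdeal (Ideal.IsPrime.ne_top inferInstance)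
    ((germ_mem_flagPrime_iff hU h hx r).2 hr)

theorem primeIdealOf_injective {x y : X} (hx : x ∈ U) (hy : y ∈ U)
    (h : (hU.primeIdealOf ⟨x, hx⟩).asIdeal = (hU.primeIdealOf ⟨y, hy⟩).asIdeal) : x = y := by
  have h1 : hU.primeIdealOf ⟨x, hx⟩ = hU.primeIdealOf ⟨y, hy⟩ := PrimeSpectrum.ext h
  have h2 := congrArg (fun p => hU.fromSpec p) h1
  exact ((hU.fromSpec_primeIdealOf ⟨x, hx⟩).symm.trans h2).trans (hU.fromSpec_primeIdealOf ⟨y, hy⟩)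

theorem exists_primeIdealOf_eq (Q : Ideal Γ(X, U)) (hQ : Q.IsPrime) :
    ∃ (x : X) (hx : x ∈ U), (hU.primeIdealOf ⟨x, hx⟩).asIdeal = Q := by
  have hmem : hU.fromSpec ⟨Q, hQ⟩ ∈ U := by
    have h1 : hU.fromSpec ⟨Q, hQ⟩ ∈ Set.range hU.fromSpec := ⟨_, rfl⟩
    rwa [hU.range_fromSpec] at h1
  refine ⟨hU.fromSpec ⟨Q, hQ⟩, hmem, ?_⟩
  exact congrArg PrimeSpectrum.asIdeal
    (hU.fromSpec.isEmbedding.injective (hU.fromSpec_primeIdealOf ⟨_, hmem⟩))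

theorem specializes_of_primeIdealOf_le {x y : X} (hx : x ∈ U) (hy : y ∈ U)
    (h : (hU.primeIdealOf ⟨y, hy⟩).asIdeal ≤ (hU.primeIdealOf ⟨x, hx⟩).asIdeal) : y ⤳ x := by
  have h1 := ((PrimeSpectrum.le_iff_specializes _ _).1 h).map hU.fromSpec.continuous
  exact ((hU.fromSpec_primeIdealOf ⟨y, hy⟩).symm ▸ (hU.fromSpec_primeIdealOf ⟨x, hx⟩).symm ▸ h1 :)

end AffineOpens

/-! ### Properties at almost all points of a curve -/

section Cofinite

variable {X : Scheme.{0}} [TopologicalSpace.NoetherianSpace X] (y : Curve X)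

theorem Curve.eventually_mem_range (a : X.presheaf.stalk y.1) : ∀ᶠ x : y.Point in cofinite,
    ∃ b, (X.presheaf.stalkSpecializes x.2.2).hom b = a := by
  obtain ⟨U, hy, s, rfl⟩ := X.presheaf.exists_germ_eq a
  filter_upwards [y.eventually_mem_opens U hy] with x hx
  exact ⟨(X.presheaf.germ U x.1 hx).hom s, germ_stalkSpecializes_apply x.2.2 hx s⟩

variable {U : X.Opens} (hU : IsAffineOpen U) (hy : y.1 ∈ U)

include hU hy

/-- At every point of `U` on the curve, the prime of `y` is generated by the germs of a fixed finite
set of generators on the affine open `U`. -/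
theorem Curve.eventually_flagPrime_le [IsNoetherianRing Γ(X, U)] :
    ∃ F : Finset (X.presheaf.stalk y.1),
    (∀ a ∈ F, a ∈ IsLocalRing.maximalIdeal (X.presheaf.stalk y.1)) ∧
    ∀ᶠ x : y.Point in cofinite, flagPrime x.2.2 ≤
      Ideal.span {b | (X.presheaf.stalkSpecializes x.2.2).hom b ∈ F} := by
  classical
  obtain ⟨T, hT⟩ := IsNoetherian.noetherian (hU.primeIdealOf ⟨y.1, hy⟩).asIdeal
  refine ⟨T.image (X.presheaf.germ U y.1 hy).hom, fun a ha => ?_, ?_⟩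
  · obtain ⟨r, hr, rfl⟩ := Finset.mem_image.1 ha
    rw [← mem_primeIdealOf_iff hU, ← hT]
    exact Submodule.subset_span hr
  filter_upwards [y.eventually_mem_opens U hy] with x hx c hc
  obtain ⟨r, s, hs, e⟩ := exists_mul_germ_eq hU hx c
  rw [← Ideal.mul_unit_mem_iff_mem _ hs, e]
  have hr : r ∈ Submodule.span Γ(X, U) (T : Set Γ(X, U)) := by
    rw [hT]
    refine (germ_mem_flagPrime_iff hU x.2.2 hx r).1 ?_
    rw [← e]
    exact Ideal.mul_mem_right _ _ hc
  have h1 := Ideal.mem_map_of_mem (X.presheaf.germ U x.1 hx).hom hr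
  change _ ∈ Ideal.map _ (Ideal.span _) at h1
  rw [Ideal.map_span] at h1
  refine Ideal.span_mono ?_ h1
  rintro _ ⟨a, ha, rfl⟩
  rw [Set.mem_ofPred_eq, germ_stalkSpecializes_apply]
  exact Finset.mem_image_of_mem _ ha

variable [CompactSpace X] (hn : ∀ x : X, IsClosed {x} → ∃ n : ℕ, 0 < n ∧
  (n : X.presheaf.stalk x) ∈ IsLocalRing.maximalIdeal (X.presheaf.stalk x))
include hn

omit [TopologicalSpace.NoetherianSpace X] in
-- Nonzero primes of the coordinate ring of the curve are its points in `U` other than the generic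
-- one; by dimension one they are closed in `X`.
theorem Curve.genericallyPrincipal [Algebra.FiniteType ℤ Γ(X, U)] :
    GenericallyPrincipal (Γ(X, U) ⧸ (hU.primeIdealOf ⟨y.1, hy⟩).asIdeal) := by
  let P := (hU.primeIdealOf ⟨y.1, hy⟩).asIdeal
  have hfin := Algebra.FiniteType.of_surjective (Ideal.Quotient.mkₐ ℤ P)
    (Ideal.Quotient.mkₐ_surjective ℤ P)
  -- The quotient carries two `ℤ`-algebra structures, which agree only propositionally.
  have : @Algebra.FiniteType ℤ (Γ(X, U) ⧸ P) _ _ (Ring.toIntAlgebra _) := by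
    convert hfin
    exact Algebra.algebra_ext _ _ fun n => RingHom.congr_fun (RingHom.ext_int _ _) n
  refine ArithAdele.genericallyPrincipal (Γ(X, U) ⧸ P) fun Q hQp hQ => ?_
  obtain ⟨q, hq, hqQ⟩ := exists_primeIdealOf_eq hU (Q.comap (Ideal.Quotient.mk P)) inferInstance
  have hyq : y.1 ⤳ q := by
    refine specializes_of_primeIdealOf_le hU hq hy (hqQ ▸ fun r hr => ?_)
    rw [Ideal.mem_comap, Ideal.Quotient.eq_zero_iff_mem.2 hr]
    exact Q.zero_mem
  have hne : y.1 ≠ q := by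
    intro h
    subst h
    refine hQ (eq_bot_iff.2 fun b hb => ?_)
    obtain ⟨r, rfl⟩ := Ideal.Quotient.mk_surjective b
    have h1 : r ∈ Q.comap (Ideal.Quotient.mk P) := hb
    rw [← hqQ] at h1
    exact Ideal.Quotient.eq_zero_iff_mem.2 h1
  -- By compactness `q` specializes to a closed point of `X`, which must be `q` itself.
  have hcl : IsClosed {q} := by
    obtain ⟨x, hx, hxc⟩ := (isClosed_closure (s := {q})).exists_closed_singleton ⟨q, subset_closure rfl⟩
    rcases y.eq_or_eq hyq (specializes_iff_mem_closure.2 hx) with h | h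
    · exact absurd h hne
    · rwa [h]
  have hmax := hU.primeIdealOf_isMaximal_of_isClosed ⟨q, hq⟩ hcl
  rw [hqQ] at hmax
  refine ⟨?_, ?_⟩
  · have h1 := Ideal.map_eq_top_or_isMaximal_of_surjective (Ideal.Quotient.mk P)
      Ideal.Quotient.mk_surjective hmax
    rw [Ideal.map_comap_of_surjective _ Ideal.Quotient.mk_surjective] at h1
    exact h1.resolve_left hQp.ne_top
  · obtain ⟨n, hn0, hnq⟩ := hn q hcl
    refine ⟨n, hn0, ?_⟩
    have h1 : (n : Γ(X, U)) ∈ (hU.primeIdealOf ⟨q, hq⟩).asIdeal := by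
      rw [mem_primeIdealOf_iff, map_natCast]
      exact hnq
    rw [hqQ, Ideal.mem_comap, map_natCast] at h1
    exact h1

/-- Regularity of the curve at almost all points: a local generator on the curve is lifted to the
surface, where it generates the maximal ideal together with the prime of `y`. -/
theorem Curve.eventually_maximalIdeal_eq [Algebra.FiniteType ℤ Γ(X, U)] :
    ∀ᶠ x : y.Point in cofinite, ∃ π : X.presheaf.stalk x.1,
      IsLocalRing.maximalIdeal (X.presheaf.stalk x.1) = flagPrime x.2.2 ⊔ Ideal.span {π} := by
  let P := (hU.primeIdealOf ⟨y.1, hy⟩).asIdeal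
  obtain ⟨b, hb, hprin⟩ := y.genericallyPrincipal hU hy hn
  obtain ⟨b', rfl⟩ := Ideal.Quotient.mk_surjective b
  -- Discarding the points outside this open set, finitely many closed points of the curve, leaves
  -- primes that avoid `b`.
  have hyb : y.1 ∈ X.basicOpen b' := by
    rw [X.mem_basicOpen b' y.1 hy]
    by_contra hu
    exact hb (Ideal.Quotient.eq_zero_iff_mem.2 ((mem_primeIdealOf_iff hU hy b').2 hu))
  filter_upwards [y.eventually_mem_opens _ hyb] with x hxb
  have hx : x.1 ∈ U := X.basicOpen_le b' hxb
  let R := (hU.primeIdealOf ⟨x.1, hx⟩).asIdeal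
  have hPR : P ≤ R := primeIdealOf_le hU x.2.2 hx
  have hQp : (R.map (Ideal.Quotient.mk P)).IsPrime :=
    Ideal.map_isPrime_of_surjective Ideal.Quotient.mk_surjective (by rwa [Ideal.mk_ker])
  have hmem : ∀ a, Ideal.Quotient.mk P a ∈ R.map (Ideal.Quotient.mk P) ↔ a ∈ R := fun a =>
    Ideal.mem_quotient_iff_mem hPR
  have hQ : R.map (Ideal.Quotient.mk P) ≠ ⊥ := by
    intro h
    refine y.ne_of_isClosed x.2.1 (primeIdealOf_injective hU hy hx (le_antisymm hPR fun r hr => ?_))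
    have h1 := (hmem r).2 hr
    rw [h] at h1
    exact Ideal.Quotient.eq_zero_iff_mem.1 h1
  have hbQ : Ideal.Quotient.mk P b' ∉ R.map (Ideal.Quotient.mk P) := by
    rw [hmem, mem_primeIdealOf_iff hU hx]
    exact fun h => h ((X.mem_basicOpen b' x.1 hx).1 hxb)
  obtain ⟨π, hπ, hgen⟩ := hprin _ hQp hQ hbQ
  obtain ⟨π', rfl⟩ := Ideal.Quotient.mk_surjective π
  rw [hmem] at hπ
  refine ⟨(X.presheaf.germ U x.1 hx).hom π', le_antisymm (fun c hc => ?_) (sup_le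
    (IsLocalRing.le_maximalIdeal (Ideal.IsPrime.ne_top inferInstance))
    ((Ideal.span_singleton_le_iff_mem _).2 ((mem_primeIdealOf_iff hU hx π').1 hπ)))⟩
  obtain ⟨r, s, hs, e⟩ := exists_mul_germ_eq hU hx c
  rw [← Ideal.mul_unit_mem_iff_mem _ hs, e]
  have hr : r ∈ R := by
    rw [mem_primeIdealOf_iff hU hx, ← e]
    exact Ideal.mul_mem_right _ _ hc
  obtain ⟨s', hs', e', he⟩ := hgen _ ((hmem r).2 hr)
  obtain ⟨s', rfl⟩ := Ideal.Quotient.mk_surjective s'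
  obtain ⟨e', rfl⟩ := Ideal.Quotient.mk_surjective e'
  rw [hmem, mem_primeIdealOf_iff hU hx] at hs'
  have hs'' : IsUnit ((X.presheaf.germ U x.1 hx).hom s') := not_not.1 hs'
  rw [← map_mul, ← map_mul, Ideal.Quotient.eq, ← germ_mem_flagPrime_iff hU x.2.2 hx, map_sub,
    map_mul, map_mul] at he
  rw [← Ideal.unit_mul_mem_iff_mem _ hs'']
  have h1 := Submodule.add_mem_sup he (Ideal.mul_mem_left (Ideal.span {_})
    ((X.presheaf.germ U x.1 hx).hom e')
    (Ideal.mem_span_singleton_self ((X.presheaf.germ U x.1 hx).hom π')))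
  rwa [sub_add_cancel] at h1

end Cofinite

/-! ### Countability of the set of points -/

section Countable

theorem countable_primeSpectrum (R : Type*) [CommRing R] [IsNoetherianRing R] [Countable R] :
    Countable (PrimeSpectrum R) := by
  have h1 : Function.Surjective fun s : Finset R => Ideal.span (s : Set R) := fun I => by
    obtain ⟨s, hs⟩ := IsNoetherian.noetherian I
    exact ⟨s, hs⟩
  have := h1.countable
  exact Function.Injective.countable (f := PrimeSpectrum.asIdeal) fun _ _ => PrimeSpectrum.ext

theorem countable_of_finiteType_int (R : Type*) [CommRing R] [Algebra.FiniteType ℤ R] :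
    Countable R := by
  obtain ⟨n, f, hf⟩ := Algebra.FiniteType.iff_quotient_mvPolynomial''.1 ‹Algebra.FiniteType ℤ R›
  have : Countable (MvPolynomial (Fin n) ℤ) :=
    Cardinal.mk_le_aleph0_iff.1 (MvPolynomial.cardinalMk_le_max.trans (by simp))
  exact hf.countable

/-- Finitely many affine opens cover, and a countable noetherian ring has only countably many finite
sets of generators, hence countably many primes. -/
theorem countable_scheme {X : Scheme.{0}} [CompactSpace X]
    (hX : ∀ U : X.Opens, IsAffineOpen U → Algebra.FiniteType ℤ Γ(X, U)) : Countable X := by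
  have hcover : ∀ x : X, ∃ U : X.Opens, IsAffineOpen U ∧ x ∈ U := fun x => by
    obtain ⟨_, ⟨U, hU, rfl⟩, hxU, -⟩ :=
      X.isBasis_affineOpens.exists_subset_of_mem_open (Set.mem_univ x) isOpen_univ
    exact ⟨U, hU, hxU⟩
  choose U hU hxU using hcover
  obtain ⟨t, ht⟩ := isCompact_univ.elim_nhds_subcover (fun x => (U x : Set X))
    fun x _ => (U x).2.mem_nhds (hxU x)
  refine Set.countable_univ_iff.1 (Set.Countable.mono ht.2 (t.countable_toSet.biUnion fun x _ => ?_))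
  have := hX _ (hU x)
  have := countable_of_finiteType_int Γ(X, U x)
  have : IsNoetherianRing Γ(X, U x) := Algebra.FiniteType.isNoetherianRing ℤ _
  have : Countable (Spec Γ(X, U x)) := countable_primeSpectrum Γ(X, U x)
  rw [← (hU x).range_fromSpec]
  exact Set.countable_range _

end Countable

/-! ### Verification for arithmetic surfaces -/

section ArithmeticSurface

variable {K : Type} [Field K] [NumberField K] {X : Scheme.{0}}
  (φ : X ⟶ Spec (.of (NumberField.RingOfIntegers K)))

theorem finiteType_int_of_isAffineOpen [LocallyOfFiniteType φ] (U : X.Opens) (hU : IsAffineOpen U) :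
    Algebra.FiniteType ℤ Γ(X, U) := by
  have h1 := φ.finiteType_appLE (isAffineOpen_top _) hU le_top
  have h2 : (Scheme.ΓSpecIso (.of (NumberField.RingOfIntegers K))).inv.hom.FiniteType :=
    RingHom.FiniteType.of_surjective _
      (Scheme.ΓSpecIso (.of (NumberField.RingOfIntegers K))).symm.commRingCatIsoToRingEquiv.surjective
  have h3 : (algebraMap ℤ (NumberField.RingOfIntegers K)).FiniteType :=
    RingHom.finiteType_algebraMap.2 inferInstance
  have h4 := h1.comp (h2.comp h3)
  rw [← RingHom.finiteType_algebraMap]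
  exact (RingHom.ext_int (algebraMap ℤ Γ(X, U)) _) ▸ h4

/-- A proper morphism is closed, so `φ x` is a maximal ideal of the ring of integers; it is nonzero,
and it contains its norm. -/
theorem exists_natCast_mem_maximalIdeal [IsProper φ] (x : X) (hx : IsClosed {x}) :
    ∃ n : ℕ, 0 < n ∧ (n : X.presheaf.stalk x) ∈ IsLocalRing.maximalIdeal (X.presheaf.stalk x) := by
  let g := Spec.preimage (X.fromSpecStalk x ≫ φ)
  have hg : Spec.map g = X.fromSpecStalk x ≫ φ := Spec.map_preimage _
  have h1 : IsClosed {φ x} := by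
    rw [← Set.image_singleton]
    exact φ.isClosedMap _ hx
  have h2 := (PrimeSpectrum.isClosed_singleton_iff_isMaximal _).1 h1
  have h3 : Spec.map g (IsLocalRing.closedPoint (X.presheaf.stalk x)) = φ x := by
    rw [hg]
    exact (Scheme.Hom.comp_apply _ _ _).trans (congrArg φ X.fromSpecStalk_closedPoint)
  let P : Ideal (NumberField.RingOfIntegers K) :=
    (IsLocalRing.maximalIdeal (X.presheaf.stalk x)).comap g.hom
  have h4 : P.IsMaximal := by
    rw [← h3] at h2
    exact h2
  have h5 : P ≠ ⊥ := Ring.ne_bot_of_isMaximal_of_not_isField h4 (NumberField.RingOfIntegers.not_isField K)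
  refine ⟨Ideal.absNorm P, Nat.pos_of_ne_zero (Ideal.absNorm_eq_zero_iff.not.2 h5), ?_⟩
  have h6 : ((Ideal.absNorm P : ℕ) : NumberField.RingOfIntegers K) ∈ P := Ideal.absNorm_mem P
  rw [Ideal.mem_comap, map_natCast] at h6
  exact h6

variable {φ}

theorem IsArithmeticSurface.isFlagCurve (hφ : IsArithmeticSurface φ) (y : Curve X) :
    IsFlagCurve y := by
  have := hφ.isIntegral
  have := hφ.isProper
  have : IsLocallyNoetherian X := LocallyOfFiniteType.isLocallyNoetherian φ
  have : CompactSpace X := QuasiCompact.compactSpace_of_compactSpace φ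
  have : IsNoetherian X := ⟨⟩
  have hn := exists_natCast_mem_maximalIdeal φ
  obtain ⟨_, ⟨U, hU, rfl⟩, hy, -⟩ :=
    X.isBasis_affineOpens.exists_subset_of_mem_open (Set.mem_univ y.1) isOpen_univ
  have := finiteType_int_of_isAffineOpen φ U hU
  have : IsNoetherianRing Γ(X, U) := Algebra.FiniteType.isNoetherianRing ℤ _
  exact ⟨fun x => y.isFlag x (hn x.1 x.2.1), y.maximalIdeal_ne_bot hφ.dim_eq_two,
    y.eventually_mem_range, y.eventually_flagPrime_le hU hy, y.eventually_maximalIdeal_eq hU hy hn⟩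

theorem IsArithmeticSurface.countable_curve (hφ : IsArithmeticSurface φ) : Countable (Curve X) := by
  have := hφ.isProper
  have : CompactSpace X := QuasiCompact.compactSpace_of_compactSpace φ
  have := countable_scheme (finiteType_int_of_isAffineOpen φ)
  infer_instance

end ArithmeticSurface

end ArithAdele

end

theorem mainTheorem11 {K : Type} [Field K] [NumberField K] {X : Scheme.{0}}
    (φ : X ⟶ Spec (.of (NumberField.RingOfIntegers K))) (hφ : IsArithmeticSurface φ)
    (c : Choices φ) :
    (∃ Ψ : (RestrictedProd (fun y : Curve X => Dual (CompletedCurveAdele c y))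
          (fun y => annihilator (completedIntegral c y)) ×
        ∀ σ : NumberField.InfinitePlace K, Dual (FibreAdele c σ)) ≃ₜ+ Dual (CompletedAdele c),
      ∀ χ (β : CompletedAdele c),
        {y : Curve X | χ.1.coord y (β.1.coord y) ≠ 0}.Finite ∧
        Ψ χ β = ∑ᶠ y : Curve X, χ.1.coord y (β.1.coord y) + ∑ σ, χ.2 σ (β.2 σ)) ∧
    ((∀ σ : NumberField.InfinitePlace K, Nonempty (FibreAdele c σ ≃ₜ+ Dual (FibreAdele c σ))) →
      ∀ θ : ∀ y : Curve X, CompletedCurveAdele c y ≃ₜ+ Dual (CompletedCurveAdele c y),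
        {y : Curve X | θ y '' (completedIntegral c y) ≠ annihilator (completedIntegral c y)}.Finite →
        Nonempty (CompletedAdele c ≃ₜ+ Dual (CompletedAdele c))) := by
  have := hφ.countable_curve
  -- Regular local rings are noetherian; this supplies the instance on the stalks.
  have := hφ.isRegular
  exact exists_dual_equiv_completedAdele c hφ.isFlagCurve
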